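/- Let $K$ be a number field with ring of integers $\mathcal O_K$, let $n\ge 0$ and $\delta\geq 0$ be integers, and let $X\subset\mathbb P^n_K$ be a hypersurface of degree $\delta$, i.e. the closed subscheme defined by a nonzero homogeneous polynomial $f=\sum_{i_0+\cdots+i_n=\delta} a_{i_0,\ldots,i_n}T_0^{i_0}\cdots T_n^{i_n}\in K[T_0,\ldots,T_n]$ of degree $\delta$. Suppose that $X$ is geometrically integral over $K$. Let $$h(X)=h(f)=\frac{1}{[K:\mathbb Q]}\log\prod_{v}\max_{(i_0,\ldots,i_n)}|a_{i_0,\ldots,i_n}|_v^{[K_v:\mathbb Q_v]}$$ be its naive height, where $v$ runs over all the places of $K$ and $|\cdot|_v$ extends the usual absolute value of $\mathbb Q_v$. Let $\mathscr X$ be the Zariski closure of $X$ in $\mathbb P^n_{\mathcal O_K}$ and let $$\mathcal Q(\mathscr X)=\{\mathfrak p\subset\mathcal O_K \text{ maximal ideal} : \mathscr X\times_{\operatorname{Spec}\mathcal O_K}\operatorname{Spec}(\mathcal O_K/\mathfrak p)\text{ is not geometrically integral over } \mathcal O_K/\mathfrak p\}.$$ Then $\mathcal Q(\mathscr X)$ is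 finite and, with $N(\mathfrak p)=\#(\mathcal O_K/\mathfrak p)$, $$\frac{1}{[K:\mathbb Q]}\sum_{\mathfrak p\in\mathcal Q(\mathscr X)}\log N(\mathfrak p)\le(\delta^2-1)\,h(X)+C(n,\delta),$$ where $$C(n,\delta)=(\delta^2-1)\left(3\log\delta+\delta\log 3+\log\binom{n+\delta}{\delta}\right).$$ -/

import Mathlib

universe u

open CategoryTheory CategoryTheory.Limits AlgebraicGeometry

noncomputable section

namespace HypersurfaceReduction

attribute [local instance] MvPolynomial.gradedAlgebra

/-- The grading of `R[T₀, …, Tₙ]` by the total degree. -/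
abbrev grading (n : ℕ) (R : Type u) [CommRing R] :
    ℕ → Submodule R (MvPolynomial (Fin (n + 1)) R) :=
  MvPolynomial.homogeneousSubmodule (Fin (n + 1)) R

/-- Projective space `ℙⁿ_R = Proj R[T₀, …, Tₙ]`. -/
abbrev projectiveSpace (n : ℕ) (R : Type u) [CommRing R] : Scheme.{u} :=
  Proj (grading n R)

/-- The structure morphism `ℙⁿ_R ⟶ Spec R`. -/
def projectiveSpaceToSpec (n : ℕ) (R : Type u) [CommRing R] :
    projectiveSpace n R ⟶ Spec (.of R) :=
  Proj.toSpecZero (grading n R) ≫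
    Spec.map (CommRingCat.ofHom (algebraMap R (grading n R 0)))

/-- Extension of scalars `R[T₀, …, Tₙ] → S[T₀, …, Tₙ]`, as a homomorphism of graded rings. -/
def scalarExtension (n : ℕ) (R S : Type u) [CommRing R] [CommRing S] [Algebra R S] :
    GradedRingHom (grading n R) (grading n S) where
  __ := MvPolynomial.map (algebraMap R S)
  map_mem := fun {_ _} hx ↦ MvPolynomial.IsHomogeneous.map hx _

theorem irrelevant_le_map_scalarExtension (n : ℕ) (R S : Type u) [CommRing R] [CommRing S]
    [Algebra R S] :
    HomogeneousIdeal.irrelevant (grading n S) ≤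
      (HomogeneousIdeal.irrelevant (grading n R)).map (scalarExtension n R S) := by
  rw [HomogeneousIdeal.irrelevant_le]
  intro d hd x hx
  have hX : x ∈ Ideal.span (MvPolynomial.X '' (Set.univ : Set (Fin (n + 1))) :
      Set (MvPolynomial (Fin (n + 1)) S)) := by
    rw [MvPolynomial.mem_ideal_span_X_image]
    intro m hm
    by_contra! h
    have hm0 : m = 0 := Finsupp.ext fun j ↦ h j (Set.mem_univ j)
    have hdeg := hx (MvPolynomial.mem_support_iff.mp hm)
    simp [hm0] at hdeg
    omega
  refine (Ideal.span_le.mpr ?_) hX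
  rintro _ ⟨j, -, rfl⟩
  have h1 : (MvPolynomial.X j : MvPolynomial (Fin (n + 1)) R) ∈
      HomogeneousIdeal.irrelevant (grading n R) :=
    HomogeneousIdeal.mem_irrelevant_of_mem _ one_pos (MvPolynomial.isHomogeneous_X R j)
  have h2 : scalarExtension n R S (MvPolynomial.X j) = MvPolynomial.X j :=
    MvPolynomial.map_X (algebraMap R S) j
  exact h2 ▸ Ideal.mem_map_of_mem (scalarExtension n R S) h1

/-- The canonical morphism `ℙⁿ_S ⟶ ℙⁿ_R` for an `R`-algebra `S`. -/
def projectiveSpaceMap (n : ℕ) (R S : Type u) [CommRing R] [CommRing S] [Algebra R S] :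
    projectiveSpace n S ⟶ projectiveSpace n R :=
  Proj.map (scalarExtension n R S) (irrelevant_le_map_scalarExtension n R S)

theorem X_mem_grading (n : ℕ) (R : Type u) [CommRing R] (j : Fin (n + 1)) :
    (MvPolynomial.X j : MvPolynomial (Fin (n + 1)) R) ∈ grading n R 1 :=
  MvPolynomial.isHomogeneous_X R j

/-- The standard affine chart `D₊(T_j)` of `ℙⁿ_R`. -/
def chart (n : ℕ) (R : Type u) [CommRing R] (j : Fin (n + 1)) :
    (projectiveSpace n R).affineOpens :=
  ⟨Proj.basicOpen (grading n R) (MvPolynomial.X j),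
    Proj.isAffineOpen_basicOpen (grading n R) (MvPolynomial.X j) (X_mem_grading n R j) one_pos⟩

/-- For `f` homogeneous of degree `δ`, the function `f / T_j ^ δ` on the chart `D₊(T_j)`. -/
def dehomogenize {n : ℕ} {R : Type u} [CommRing R] {δ : ℕ}
    (f : MvPolynomial (Fin (n + 1)) R) (hf : f.IsHomogeneous δ) (j : Fin (n + 1)) :
    Γ(projectiveSpace n R, (chart n R j).1) :=
  (Proj.awayToSection (grading n R) (MvPolynomial.X j)).hom
    (HomogeneousLocalization.Away.mk (grading n R) (X_mem_grading n R j) δ f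
      (by simpa using hf))

/-- The morphism `i : X ⟶ ℙⁿ_K` is the inclusion of the hypersurface of degree `δ` with defining
polynomial `f`: it is a closed immersion, `f` is a nonzero homogeneous polynomial of degree `δ`, and
on each chart `D₊(T_j)` the ideal of `X` is generated by `f / T_j ^ δ`. -/
structure IsHypersurface {n : ℕ} {K : Type u} [Field K] {X : Scheme.{u}}
    (i : X ⟶ projectiveSpace n K) (δ : ℕ) (f : MvPolynomial (Fin (n + 1)) K) : Prop where
  isClosedImmersion : IsClosedImmersion i
  ne_zero : f ≠ 0
  isHomogeneous : f.IsHomogeneous δ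
  ideal_eq : ∀ j : Fin (n + 1),
    i.ker.ideal (chart n K j) = Ideal.span {dehomogenize f isHomogeneous j}

/-- The naive height `h(f) = [K : ℚ]⁻¹ log ∏_v max |a|_v ^ [K_v : ℚ_v]`, the maximum being taken over
the (nonzero) coefficients `a` of `f`. -/
def naiveHeight {n : ℕ} {K : Type u} [Field K] [NumberField K]
    (f : MvPolynomial (Fin (n + 1)) K) : ℝ :=
  (1 / (Module.finrank ℚ K : ℝ)) *
    Real.log (Height.mulHeight (fun m : f.support ↦ f.coeff m.1))

section Closure

variable {n : ℕ} {K : Type u} [Field K] [NumberField K] {X : Scheme.{u}}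

/-- The Zariski closure in `ℙⁿ_{𝓞 K}` of a closed subscheme `X` of `ℙⁿ_K`, that is, the
scheme-theoretic image of `X ⟶ ℙⁿ_K ⟶ ℙⁿ_{𝓞 K}`. -/
def zariskiClosure (i : X ⟶ projectiveSpace n K) : Scheme.{u} :=
  (i ≫ projectiveSpaceMap n (NumberField.RingOfIntegers K) K).image

/-- The structure morphism of the Zariski closure over `Spec (𝓞 K)`. -/
def zariskiClosureToSpec (i : X ⟶ projectiveSpace n K) :
    zariskiClosure i ⟶ Spec (.of (NumberField.RingOfIntegers K)) :=
  (i ≫ projectiveSpaceMap n (NumberField.RingOfIntegers K) K).imageι ≫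
    projectiveSpaceToSpec n (NumberField.RingOfIntegers K)

/-- The reduction at `𝔭` of the Zariski closure: its base change to the residue field `𝓞 K ⧸ 𝔭`,
as a morphism to `Spec (𝓞 K ⧸ 𝔭)`. -/
def reductionToSpec (i : X ⟶ projectiveSpace n K)
    (𝔭 : MaximalSpectrum (NumberField.RingOfIntegers K)) :
    pullback (zariskiClosureToSpec i)
        (Spec.map (CommRingCat.ofHom (Ideal.Quotient.mk 𝔭.asIdeal))) ⟶
      Spec (.of (NumberField.RingOfIntegers K ⧸ 𝔭.asIdeal)) :=
  pullback.snd (zariskiClosureToSpec i)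
    (Spec.map (CommRingCat.ofHom (Ideal.Quotient.mk 𝔭.asIdeal)))

/-- The set of maximal ideals of `𝓞 K` at which the reduction is not geometrically integral. -/
def badPrimes (i : X ⟶ projectiveSpace n K) :
    Set (MaximalSpectrum (NumberField.RingOfIntegers K)) :=
  {𝔭 | ¬ GeometricallyIntegral (reductionToSpec i 𝔭)}

end Closure

end HypersurfaceReduction

end

-- The tool is Ruppert's criterion. To a polynomial F of degree d in x, y it attaches the 1-forms ω
-- = g dx + h dy with deg g, deg h and deg (x g + y h) at most d - 1, and asks whether ω / F can be
-- closed. This is a linear system in the d^2 - 1 coefficients of ω, with a matrix linear in F; its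
-- maximal minors are therefore homogeneous of degree d^2 - 1 in the coefficients of F, and they
-- commute with ring homomorphisms. To reach n + 1 variables without a Bertini theorem, F is the
-- restriction of f to the plane T_t = u_t x + v_t y + w_t with u, v, w indeterminate, and the
-- invariants of f are the coefficients in u, v, w of these minors (`ruppertMinor`).
--
-- Two facts make the minors detect irreducibility. In every characteristic they all vanish on a
-- reducible form over an algebraically closed field (`ruppertMinor_eq_zero_of_not_irreducible`):
-- two factors, or a repeated one, give a nonzero closed form on projective space, which pulls back
-- to a solution of the system. In characteristic zero an irreducible form has a nonzero minor
-- (`exists_ruppertMinor_ne_zero`): the residue of a closed ω / F along F = 0 is constant, which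
-- forces ω = a dF, and the condition on x g + y h forces a = 0.
--
-- Fix a nonzero minor D of f. At an infinite place, |D| is at most the (δ^2 - 1)-st power of δ^3
-- 3^δ binom(n + δ, δ) max |a|: a column of the matrix has coefficient sum at most 4δ 3^δ times that
-- of f, and 4δ ≤ δ^3 once δ ≥ 2, while for δ = 1 the exponent is zero. At a finite place, rescaling
-- f to be primitive gives |D| ≤ (max |a|)^(δ^2 - 1). If the primitive reduction is geometrically
-- reducible, the rescaled minor lies in 𝔭 and a factor N(𝔭)⁻¹ is gained. The product formula for D
-- (`finite_and_sum_log_absNorm_le`) turns these gains into the bound.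
--
-- It remains to relate schemes to forms. On the standard charts, Gauss's lemma
-- (`map_dvd_map_of_primitive`) shows that the reduction of the closure is cut out by the reduction
-- of a primitive multiple of f, and `isIntegral_pullback_iff_irreducible` translates integrality of
-- a projective hypersurface over a field into irreducibility of its equation together with n ≥ 1.

universe v

namespace Ruppert

open MvPolynomial

/-! ### Ruppert's linear system for closed forms in two variables -/

section System

variable {R S : Type*} [CommRing R] [CommRing S]

/-- The polynomial `f ^ 2 * (∂(g / f)/∂y - ∂(h / f)/∂x)`, which vanishes exactly when the rational
form `(g dx + h dy) / f` is closed. -/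
noncomputable def closedDefect (f g h : MvPolynomial (Fin 2) R) : MvPolynomial (Fin 2) R :=
  f * (pderiv 1 g - pderiv 0 h) - (g * pderiv 1 f - h * pderiv 0 f)

/-- The exponents of the monomials of degree at most `d - 2`. -/
def lowExponents (d : ℕ) : Finset (ℕ × ℕ) :=
  (Finset.range d ×ˢ Finset.range d).filter fun p ↦ p.1 + p.2 + 2 ≤ d

/-- The exponents of the monomials of degree exactly `d - 2`. -/
def topExponents (d : ℕ) : Finset (ℕ × ℕ) :=
  (Finset.range d ×ˢ Finset.range d).filter fun p ↦ p.1 + p.2 + 2 = d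

lemma mem_lowExponents {d : ℕ} {p : ℕ × ℕ} : p ∈ lowExponents d ↔ p.1 + p.2 + 2 ≤ d := by
  simp only [lowExponents, Finset.mem_filter, Finset.mem_product, Finset.mem_range]
  omega

lemma mem_topExponents {d : ℕ} {p : ℕ × ℕ} : p ∈ topExponents d ↔ p.1 + p.2 + 2 = d := by
  simp only [topExponents, Finset.mem_filter, Finset.mem_product, Finset.mem_range]
  omega

lemma card_topExponents (d : ℕ) : (topExponents d).card = d - 1 := by
  rcases Nat.lt_or_ge d 2 with hd | hd
  · rw [Finset.card_eq_zero.mpr]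
    · omega
    · ext p
      simp only [mem_topExponents, Finset.notMem_empty, iff_false]
      omega
  · have : topExponents d = Finset.HasAntidiagonal.antidiagonal (d - 2) := by
      ext p
      simp only [mem_topExponents, Finset.HasAntidiagonal.mem_antidiagonal]
      omega
    rw [this, Finset.Nat.card_antidiagonal]
    omega

lemma card_lowExponents (d : ℕ) : (lowExponents (d + 1)).card * 2 = (d + 1) * d := by
  induction d with
  | zero => decide
  | succ d ih =>
    have h : lowExponents (d + 1 + 1) = lowExponents (d + 1) ∪ topExponents (d + 1 + 1) := by
      ext p
      simp only [mem_lowExponents, mem_topExponents, Finset.mem_union]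
      omega
    have hdisj : Disjoint (lowExponents (d + 1)) (topExponents (d + 1 + 1)) := by
      rw [Finset.disjoint_left]
      intro p
      simp only [mem_lowExponents, mem_topExponents]
      omega
    rw [h, Finset.card_union_of_disjoint hdisj, add_mul, ih, card_topExponents]
    simp only [Nat.add_sub_cancel]
    ring

/-- The index set of a basis of the space of polynomial forms `g dx + h dy` with
`deg g, deg h, deg (x g + y h) ≤ d - 1`. -/
abbrev FormIndex (d : ℕ) : Type :=
  (lowExponents d) ⊕ ((lowExponents d) ⊕ (topExponents d))

/-- The count is 2 · d(d - 1)/2 + (d - 1). This number is the size of the maximal minors, hence the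
factor δ^2 - 1 of the final bound. -/
lemma card_formIndex {d : ℕ} (hd : 1 ≤ d) : Fintype.card (FormIndex d) = d ^ 2 - 1 := by
  obtain ⟨d, rfl⟩ := Nat.exists_eq_add_of_le' hd
  have h := card_lowExponents d
  have h' := card_topExponents (d + 1)
  simp only [Fintype.card_sum, Fintype.card_coe, h']
  have : (d + 1) ^ 2 = (d + 1) * d + d + 1 := by ring
  omega

/-- The `dx`-component of a basis form. -/
noncomputable def formX (R : Type*) [CommRing R] {d : ℕ} : FormIndex d → MvPolynomial (Fin 2) R
  | .inl p => X 0 ^ p.1.1 * X 1 ^ p.1.2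
  | .inr (.inl _) => 0
  | .inr (.inr p) => X 0 ^ p.1.1 * X 1 ^ (p.1.2 + 1)

/-- The `dy`-component of a basis form. -/
noncomputable def formY (R : Type*) [CommRing R] {d : ℕ} : FormIndex d → MvPolynomial (Fin 2) R
  | .inl _ => 0
  | .inr (.inl p) => X 0 ^ p.1.1 * X 1 ^ p.1.2
  | .inr (.inr p) => -(X 0 ^ (p.1.1 + 1) * X 1 ^ p.1.2)

/-- The matrix of `ω ↦ f ^ 2 d(ω / f)` on the forms spanned by the basis forms. -/
noncomputable def ruppertMatrix (d : ℕ) (f : MvPolynomial (Fin 2) R) :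
    Matrix (Fin 2 →₀ ℕ) (FormIndex d) R :=
  fun m s ↦ coeff m (closedDefect f (formX R s) (formY R s))

variable (φ : R →+* S)

lemma map_closedDefect (f g h : MvPolynomial (Fin 2) R) :
    map φ (closedDefect f g h) = closedDefect (map φ f) (map φ g) (map φ h) := by
  simp [closedDefect, pderiv_map]

lemma map_formX {d : ℕ} (s : FormIndex d) : map φ (formX R s) = formX S s := by
  rcases s with s | s | s <;> simp [formX]

lemma map_formY {d : ℕ} (s : FormIndex d) : map φ (formY R s) = formY S s := by
  rcases s with s | s | s <;> simp [formY]

lemma ruppertMatrix_map (d : ℕ) (f : MvPolynomial (Fin 2) R) :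
    ruppertMatrix d (map φ f) = (ruppertMatrix d f).map φ := by
  ext m s
  simp [ruppertMatrix, ← coeff_map, map_closedDefect, map_formX, map_formY]

lemma ruppertMatrix_C_mul (d : ℕ) (c : R) (f : MvPolynomial (Fin 2) R) :
    ruppertMatrix d (C c * f) = c • ruppertMatrix d f := by
  ext m s
  simp only [ruppertMatrix, Matrix.smul_apply, smul_eq_mul]
  rw [← coeff_C_mul]
  congr 1
  simp only [closedDefect, pderiv_C_mul]
  ring

lemma ruppertMatrix_mulVec (d : ℕ) (f : MvPolynomial (Fin 2) R) (c : FormIndex d → R)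
    (m : Fin 2 →₀ ℕ) :
    ∑ s, ruppertMatrix d f m s * c s =
      coeff m (closedDefect f (∑ s, C (c s) * formX R s) (∑ s, C (c s) * formY R s)) := by
  have h : closedDefect f (∑ s, C (c s) * formX R s) (∑ s, C (c s) * formY R s) =
      ∑ s, C (c s) * closedDefect f (formX R s) (formY R s) := by
    simp only [closedDefect, map_sum, pderiv_C_mul, Finset.sum_mul, ← Finset.sum_sub_distrib,
      Finset.mul_sum]
    exact Finset.sum_congr rfl fun s _ ↦ by ring
  rw [h, coeff_sum]
  exact Finset.sum_congr rfl fun s _ ↦ by rw [coeff_C_mul, mul_comm]; rfl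

end System

/-! ### Generic plane sections and their minors -/

section Generic

variable {R S : Type*} [CommRing R] [CommRing S] {τ : Type*}

/-- The `t`-th coordinate `u_t x + v_t y + w_t` on the generic plane. -/
noncomputable def genericLine (R : Type*) [CommRing R] {τ : Type*} (t : τ) :
    MvPolynomial (Fin 2) (MvPolynomial (τ × Fin 3) R) :=
  C (X (t, 0)) * X 0 + C (X (t, 1)) * X 1 + C (X (t, 2))

/-- Restriction of polynomials to the generic plane `T_t = u_t x + v_t y + w_t`. -/
noncomputable def genericSection (R : Type*) [CommRing R] (τ : Type*) :
    MvPolynomial τ R →+* MvPolynomial (Fin 2) (MvPolynomial (τ × Fin 3) R) :=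
  eval₂Hom (C.comp C) (genericLine R)

@[simp]
lemma genericSection_C (a : R) : genericSection R τ (C a) = C (C a) := by
  simp [genericSection]

@[simp]
lemma genericSection_X (t : τ) : genericSection R τ (X t) = genericLine R t := by
  simp [genericSection]

lemma map_genericSection (φ : R →+* S) (f : MvPolynomial τ R) :
    map (map φ) (genericSection R τ f) = genericSection S τ (map φ f) := by
  induction f using MvPolynomial.induction_on with
  | C a => simp
  | add p q hp hq => simp [hp, hq]
  | mul_X p t hp => simp [hp, genericLine]

/-- A coefficient of a maximal minor of the Ruppert matrix of the generic plane section of `f`. -/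
noncomputable def ruppertMinor (d : ℕ) (ρ : FormIndex d → (Fin 2 →₀ ℕ)) (μ : (τ × Fin 3) →₀ ℕ)
    (f : MvPolynomial τ R) : R :=
  coeff μ ((ruppertMatrix d (genericSection R τ f)).submatrix ρ id).det

/-- This is what allows one and the same minor to be compared over the number field, its integers,
its algebraic closure and the residue fields. -/
lemma ruppertMinor_map (φ : R →+* S) (d : ℕ) (ρ : FormIndex d → (Fin 2 →₀ ℕ))
    (μ : (τ × Fin 3) →₀ ℕ) (f : MvPolynomial τ R) :
    ruppertMinor d ρ μ (map φ f) = φ (ruppertMinor d ρ μ f) := by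
  rw [ruppertMinor, ruppertMinor, ← coeff_map, RingHom.map_det, ← map_genericSection,
    ruppertMatrix_map]
  rfl

lemma ruppertMinor_C_mul (d : ℕ) (ρ : FormIndex d → (Fin 2 →₀ ℕ)) (μ : (τ × Fin 3) →₀ ℕ)
    (c : R) (f : MvPolynomial τ R) :
    ruppertMinor d ρ μ (C c * f) = c ^ Fintype.card (FormIndex d) * ruppertMinor d ρ μ f := by
  rw [ruppertMinor, ruppertMinor, map_mul, genericSection_C, ruppertMatrix_C_mul,
    Matrix.submatrix_smul, Pi.smul_apply, Pi.smul_apply, Matrix.det_smul, ← C_pow, coeff_C_mul]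

end Generic

/-! ### Coefficient-sum estimates for the minors -/

section Seminorm

variable {R : Type*} [CommRing R] {σ : Type*}

/-- The sum of the sizes of the coefficients of a polynomial. -/
noncomputable def coeffSum (N : RingSeminorm R) : RingSeminorm (MvPolynomial σ R) where
  toFun p := ∑ m ∈ p.support, N (coeff m p)
  map_zero' := by simp
  neg' p := by simp [MvPolynomial.support_neg]
  add_le' p q := by
    classical
    have key (r : MvPolynomial σ R) (s : Finset (σ →₀ ℕ)) (h : r.support ⊆ s) :
        ∑ m ∈ r.support, N (coeff m r) = ∑ m ∈ s, N (coeff m r) :=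
      Finset.sum_subset h fun m _ hm ↦ by simp [notMem_support_iff.mp hm]
    rw [key p _ Finset.subset_union_left, key q _ (Finset.subset_union_right (s₁ := p.support)),
      key (p + q) _ MvPolynomial.support_add, ← Finset.sum_add_distrib]
    exact Finset.sum_le_sum fun m _ ↦ by
      rw [coeff_add]
      exact map_add_le_add N _ _
  mul_le' p q := by
    classical
    have h (m : σ →₀ ℕ) : N (coeff m (p * q)) ≤
        ∑ x ∈ p.support ×ˢ q.support,
          if x.1 + x.2 = m then N (coeff x.1 p) * N (coeff x.2 q) else 0 := by
      have hpq : coeff m (p * q) = ∑ x ∈ p.support ×ˢ q.support,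
          if x.1 + x.2 = m then coeff x.1 p * coeff x.2 q else 0 := by
        conv_lhs => rw [p.as_sum, q.as_sum, Finset.sum_mul_sum, ← Finset.sum_product', coeff_sum]
        exact Finset.sum_congr rfl fun x _ ↦ by rw [monomial_mul, coeff_monomial]
      rw [hpq]
      refine (Finset.le_sum_of_subadditive N (map_zero N).le (map_add_le_add N) _ _).trans ?_
      refine Finset.sum_le_sum fun x _ ↦ ?_
      split_ifs
      · exact map_mul_le_mul N _ _
      · simp
    calc ∑ m ∈ (p * q).support, N (coeff m (p * q))
        ≤ ∑ m ∈ (p * q).support, ∑ x ∈ p.support ×ˢ q.support,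
            if x.1 + x.2 = m then N (coeff x.1 p) * N (coeff x.2 q) else 0 :=
          Finset.sum_le_sum fun m _ ↦ h m
      _ = ∑ x ∈ p.support ×ˢ q.support, ∑ m ∈ (p * q).support,
            if x.1 + x.2 = m then N (coeff x.1 p) * N (coeff x.2 q) else 0 := Finset.sum_comm
      _ ≤ ∑ x ∈ p.support ×ˢ q.support, N (coeff x.1 p) * N (coeff x.2 q) := by
          refine Finset.sum_le_sum fun x _ ↦ ?_
          rw [Finset.sum_ite_eq]
          split_ifs
          · exact le_rfl
          · exact mul_nonneg (apply_nonneg N _) (apply_nonneg N _)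
      _ = (∑ m ∈ p.support, N (coeff m p)) * ∑ m ∈ q.support, N (coeff m q) := by
          rw [Finset.sum_product, Finset.sum_mul_sum]

variable (N : RingSeminorm R)

lemma coeffSum_eq_sum {p : MvPolynomial σ R} {s : Finset (σ →₀ ℕ)} (h : p.support ⊆ s) :
    coeffSum N p = ∑ m ∈ s, N (coeff m p) :=
  Finset.sum_subset h fun m _ hm ↦ by simp [notMem_support_iff.mp hm]

lemma sum_coeff_le_coeffSum (p : MvPolynomial σ R) (s : Finset (σ →₀ ℕ)) :
    ∑ m ∈ s, N (coeff m p) ≤ coeffSum N p := by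
  classical
  rw [coeffSum_eq_sum N (s := p.support ∪ s) Finset.subset_union_left]
  exact Finset.sum_le_sum_of_subset_of_nonneg Finset.subset_union_right
    fun _ _ _ ↦ apply_nonneg N _

lemma coeffSum_monomial (m : σ →₀ ℕ) (a : R) : coeffSum N (monomial m a) = N a := by
  classical
  rw [coeffSum_eq_sum N (s := {m}) support_monomial_subset]
  simp

lemma coeffSum_C (a : R) : coeffSum N (C a : MvPolynomial σ R) = N a :=
  coeffSum_monomial N 0 a

lemma coeffSum_X (i : σ) : coeffSum N (X i : MvPolynomial σ R) = N 1 :=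
  coeffSum_monomial N _ 1

lemma seminorm_nsmul_le (n : ℕ) (a : R) : N (n * a) ≤ n * N a := by
  induction n with
  | zero => simp
  | succ n ih =>
    push_cast
    rw [add_mul, add_mul, one_mul, one_mul]
    exact (map_add_le_add N _ _).trans (by gcongr)

lemma coeffSum_pderiv_le (i : σ) {p : MvPolynomial σ R} {d : ℕ} (hp : p.totalDegree ≤ d) :
    coeffSum N (pderiv i p) ≤ d * coeffSum N p := by
  conv_lhs => rw [p.as_sum, map_sum]
  refine (Finset.le_sum_of_subadditive _ (map_zero _).le (map_add_le_add _) _ _).trans ?_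
  change _ ≤ d * ∑ m ∈ p.support, N (coeff m p)
  rw [Finset.mul_sum]
  refine Finset.sum_le_sum fun m hm ↦ ?_
  rw [pderiv_monomial, coeffSum_monomial, mul_comm]
  refine (seminorm_nsmul_le N _ _).trans ?_
  gcongr
  refine le_trans ?_ ((le_totalDegree hm).trans hp)
  by_cases hi : i ∈ m.support
  · exact Finset.single_le_sum (fun _ _ ↦ Nat.zero_le _) hi
  · simp [Finsupp.notMem_support_iff.mp hi]

lemma seminorm_prod_le (h1 : N 1 ≤ 1) {ι : Type*} (s : Finset ι) (a : ι → R) :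
    N (∏ i ∈ s, a i) ≤ ∏ i ∈ s, N (a i) := by
  classical
  induction s using Finset.induction_on with
  | empty => simpa using h1
  | insert i s hi ih =>
    rw [Finset.prod_insert hi, Finset.prod_insert hi]
    exact (map_mul_le_mul N _ _).trans (by gcongr)

lemma seminorm_pow_le (h1 : N 1 ≤ 1) (a : R) (n : ℕ) : N (a ^ n) ≤ N a ^ n := by
  simpa using seminorm_prod_le N h1 (Finset.range n) fun _ ↦ a

/-- In the Leibniz expansion the sum over permutations is enlarged to all maps ι → ι, and that
larger sum factors as a product of column sums. No factorial is lost. -/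
lemma seminorm_det_le (h1 : N 1 ≤ 1) {ι : Type*} [Fintype ι] [DecidableEq ι]
    (A : Matrix ι ι R) : N A.det ≤ ∏ j, ∑ i, N (A i j) := by
  rw [Matrix.det_apply]
  refine (Finset.le_sum_of_subadditive N (map_zero N).le (map_add_le_add N) _ _).trans ?_
  calc ∑ s : Equiv.Perm ι, N (Equiv.Perm.sign s • ∏ j, A (s j) j)
      ≤ ∑ s : Equiv.Perm ι, ∏ j, N (A (s j) j) := by
        refine Finset.sum_le_sum fun s _ ↦ ?_
        rcases Int.units_eq_one_or (Equiv.Perm.sign s) with h | h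
        · simpa [h] using seminorm_prod_le N h1 Finset.univ fun j ↦ A (s j) j
        · simpa [h] using seminorm_prod_le N h1 Finset.univ fun j ↦ A (s j) j
    _ = ∑ p ∈ (Finset.univ : Finset (Equiv.Perm ι)).map
            (⟨fun s ↦ ⇑s, DFunLike.coe_injective⟩ : Equiv.Perm ι ↪ (ι → ι)),
          ∏ j, N (A (p j) j) := by simp
    _ ≤ ∑ p ∈ Fintype.piFinset fun _ : ι ↦ (Finset.univ : Finset ι), ∏ j, N (A (p j) j) :=
        Finset.sum_le_sum_of_subset_of_nonneg (fun p _ ↦ by simp)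
          fun p _ _ ↦ Finset.prod_nonneg fun j _ ↦ apply_nonneg N _
    _ = ∏ j, ∑ i, N (A i j) := by
        rw [Finset.prod_univ_sum]

lemma coeffSum_one_le (h1 : N 1 ≤ 1) : coeffSum N (1 : MvPolynomial σ R) ≤ 1 := by
  rwa [← C_1, coeffSum_C]

lemma coeffSum_formX_le (h1 : N 1 ≤ 1) {d : ℕ} (s : FormIndex d) :
    coeffSum N (formX R s) ≤ 1 := by
  have h (a b : ℕ) : coeffSum N (X 0 ^ a * X 1 ^ b : MvPolynomial (Fin 2) R) ≤ 1 := by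
    rw [X_pow_eq_monomial, X_pow_eq_monomial, monomial_mul, coeffSum_monomial]
    simpa using h1
  rcases s with s | s | s
  · exact h _ _
  · simp [formX]
  · exact h _ _

lemma coeffSum_formY_le (h1 : N 1 ≤ 1) {d : ℕ} (s : FormIndex d) :
    coeffSum N (formY R s) ≤ 1 := by
  have h (a b : ℕ) : coeffSum N (X 0 ^ a * X 1 ^ b : MvPolynomial (Fin 2) R) ≤ 1 := by
    rw [X_pow_eq_monomial, X_pow_eq_monomial, monomial_mul, coeffSum_monomial]
    simpa using h1
  rcases s with s | s | s
  · simp [formY]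
  · exact h _ _
  · simpa only [formY, map_neg_eq_map] using h _ _

end Seminorm

section Degree

variable {R : Type*} [CommRing R]

lemma totalDegree_X_pow_mul_X_pow_le (a b : ℕ) :
    (X 0 ^ a * X 1 ^ b : MvPolynomial (Fin 2) R).totalDegree ≤ a + b := by
  rw [X_pow_eq_monomial, X_pow_eq_monomial, monomial_mul]
  refine (totalDegree_monomial_le _ _).trans ?_
  rw [Finsupp.sum_add_index' (by simp) (by simp)]
  simp

lemma totalDegree_formX_le {d : ℕ} (s : FormIndex d) : (formX R s).totalDegree ≤ d - 1 := by
  rcases s with s | s | s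
  · have := mem_lowExponents.mp s.2
    exact (totalDegree_X_pow_mul_X_pow_le _ _).trans (by omega)
  · simp [formX]
  · have := mem_topExponents.mp s.2
    exact (totalDegree_X_pow_mul_X_pow_le _ _).trans (by omega)

lemma totalDegree_formY_le {d : ℕ} (s : FormIndex d) : (formY R s).totalDegree ≤ d - 1 := by
  rcases s with s | s | s
  · simp [formY]
  · have := mem_lowExponents.mp s.2
    exact (totalDegree_X_pow_mul_X_pow_le _ _).trans (by omega)
  · have := mem_topExponents.mp s.2
    simp only [formY, totalDegree_neg]
    exact (totalDegree_X_pow_mul_X_pow_le _ _).trans (by omega)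

end Degree

section Bound

variable {R : Type*} [CommRing R] (N : RingSeminorm R) {τ : Type*}

/-- The defect consists of four products, each with one differentiated factor. A basis form has
coefficients of total size at most 1, so each product costs at most d times the size of f. -/
lemma coeffSum_closedDefect_le (h1 : N 1 ≤ 1) {d : ℕ} {f : MvPolynomial (Fin 2) R}
    (hf : f.totalDegree ≤ d) (s : FormIndex d) :
    coeffSum N (closedDefect f (formX R s) (formY R s)) ≤ 4 * d * coeffSum N f := by
  have hX := coeffSum_formX_le N h1 s
  have hY := coeffSum_formY_le N h1 s
  have hX' := coeffSum_pderiv_le N 1 ((totalDegree_formX_le (R := R) s).trans (Nat.sub_le d 1))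
  have hY' := coeffSum_pderiv_le N 0 ((totalDegree_formY_le (R := R) s).trans (Nat.sub_le d 1))
  have hf0 := coeffSum_pderiv_le N 0 hf
  have hf1 := coeffSum_pderiv_le N 1 hf
  have h0 := apply_nonneg (coeffSum N) f
  have hd : (0 : ℝ) ≤ d := d.cast_nonneg
  have e1 : coeffSum N (pderiv 1 (formX R s)) ≤ d := hX'.trans (mul_le_of_le_one_right hd hX)
  have e2 : coeffSum N (pderiv 0 (formY R s)) ≤ d := hY'.trans (mul_le_of_le_one_right hd hY)
  have e3 : coeffSum N (f * (pderiv 1 (formX R s) - pderiv 0 (formY R s))) ≤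
      coeffSum N f * (d + d) :=
    (map_mul_le_mul _ _ _).trans (mul_le_mul_of_nonneg_left
      ((map_sub_le_add _ _ _).trans (add_le_add e1 e2)) h0)
  have e4 : coeffSum N (formX R s * pderiv 1 f) ≤ d * coeffSum N f :=
    (map_mul_le_mul _ _ _).trans
      ((mul_le_of_le_one_left (apply_nonneg _ _) hX).trans hf1)
  have e5 : coeffSum N (formY R s * pderiv 0 f) ≤ d * coeffSum N f :=
    (map_mul_le_mul _ _ _).trans
      ((mul_le_of_le_one_left (apply_nonneg _ _) hY).trans hf0)
  refine (map_sub_le_add _ _ _).trans ?_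
  have e6 := map_sub_le_add (coeffSum N) (formX R s * pderiv 1 f) (formY R s * pderiv 0 f)
  linarith

lemma coeffSum_genericLine_le (h1 : N 1 ≤ 1) (t : τ) :
    coeffSum (coeffSum N) (genericLine R t) ≤ 3 := by
  have h (i : Fin 3) : coeffSum (coeffSum N)
      (C (X (t, i)) : MvPolynomial (Fin 2) (MvPolynomial (τ × Fin 3) R)) ≤ 1 := by
    rwa [coeffSum_C, coeffSum_X]
  have hX (i : Fin 2) : coeffSum (coeffSum N)
      (X i : MvPolynomial (Fin 2) (MvPolynomial (τ × Fin 3) R)) ≤ 1 := by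
    rw [coeffSum_X]
    exact coeffSum_one_le N h1
  have hm (i : Fin 3) (j : Fin 2) : coeffSum (coeffSum N)
      (C (X (t, i)) * X j : MvPolynomial (Fin 2) (MvPolynomial (τ × Fin 3) R)) ≤ 1 :=
    (map_mul_le_mul _ _ _).trans (mul_le_one₀ (h i) (apply_nonneg _ _) (hX j))
  refine (map_add_le_add _ _ _).trans ?_
  have := (map_add_le_add (coeffSum (coeffSum N)) (C (X (t, 0)) * X 0) (C (X (t, 1)) * X 1)).trans
    (add_le_add (hm 0 0) (hm 1 1))
  linarith [h 2]

/-- Each monomial becomes a product of d generic linear polynomials, each with three terms of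
coefficient 1. -/
lemma coeffSum_genericSection_le (h1 : N 1 ≤ 1) {d : ℕ} {f : MvPolynomial τ R}
    (hf : f.IsHomogeneous d) :
    coeffSum (coeffSum N) (genericSection R τ f) ≤ 3 ^ d * coeffSum N f := by
  have h1' : coeffSum (coeffSum N)
      (1 : MvPolynomial (Fin 2) (MvPolynomial (τ × Fin 3) R)) ≤ 1 :=
    coeffSum_one_le _ (coeffSum_one_le N h1)
  conv_lhs => rw [f.as_sum, map_sum]
  refine (Finset.le_sum_of_subadditive _ (map_zero _).le (map_add_le_add _) _ _).trans ?_
  change _ ≤ 3 ^ d * ∑ m ∈ f.support, N (coeff m f)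
  rw [Finset.mul_sum]
  refine Finset.sum_le_sum fun m hm ↦ ?_
  rw [monomial_eq, map_mul, Finsupp.prod, map_prod]
  refine (map_mul_le_mul _ _ _).trans ?_
  rw [genericSection_C, coeffSum_C, coeffSum_C, mul_comm]
  refine mul_le_mul_of_nonneg_right ?_ (apply_nonneg N _)
  refine (seminorm_prod_le _ h1' _ _).trans ?_
  have hd : ∑ t ∈ m.support, m t = d := (hf.degree_eq_sum_deg_support hm).symm
  rw [← hd, ← Finset.prod_pow_eq_pow_sum]
  refine Finset.prod_le_prod (fun _ _ ↦ apply_nonneg _ _) fun t _ ↦ ?_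
  rw [map_pow, genericSection_X]
  exact (seminorm_pow_le _ h1' _ _).trans
    (pow_le_pow_left₀ (apply_nonneg _ _) (coeffSum_genericLine_le N h1 t) _)

lemma totalDegree_genericLine_le (t : τ) : (genericLine R t).totalDegree ≤ 1 := by
  refine (totalDegree_add _ _).trans (max_le ((totalDegree_add _ _).trans (max_le ?_ ?_)) ?_)
  · rw [C_mul_X_eq_monomial]
    exact (totalDegree_monomial_le _ _).trans (by simp)
  · rw [C_mul_X_eq_monomial]
    exact (totalDegree_monomial_le _ _).trans (by simp)
  · simp

lemma totalDegree_genericSection_le {d : ℕ} {f : MvPolynomial τ R} (hf : f.IsHomogeneous d) :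
    (genericSection R τ f).totalDegree ≤ d := by
  conv_lhs => rw [f.as_sum, map_sum]
  refine (totalDegree_finsetSum _ _).trans (Finset.sup_le fun m hm ↦ ?_)
  rw [monomial_eq, map_mul, Finsupp.prod, map_prod, genericSection_C]
  refine (totalDegree_mul _ _).trans ?_
  rw [totalDegree_C, zero_add]
  refine (totalDegree_finsetProd _ _).trans ?_
  have hd : ∑ t ∈ m.support, m t = d := (hf.degree_eq_sum_deg_support hm).symm
  rw [← hd]
  refine Finset.sum_le_sum fun t _ ↦ ?_
  rw [map_pow, genericSection_X]
  refine (totalDegree_pow _ _).trans ?_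
  nlinarith [totalDegree_genericLine_le (R := R) t]

lemma seminorm_ruppertMinor_le (h1 : N 1 ≤ 1) {d : ℕ} {f : MvPolynomial τ R}
    (hf : f.IsHomogeneous d) (ρ : FormIndex d → (Fin 2 →₀ ℕ)) (μ : (τ × Fin 3) →₀ ℕ) :
    N (ruppertMinor d ρ μ f) ≤
      (4 * d * (3 ^ d * coeffSum N f)) ^ Fintype.card (FormIndex d) := by
  have h1' : coeffSum N (1 : MvPolynomial (τ × Fin 3) R) ≤ 1 := coeffSum_one_le N h1
  have hpos : 0 ≤ coeffSum N f := apply_nonneg _ _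
  refine le_trans (b := coeffSum N
    ((ruppertMatrix d (genericSection R τ f)).submatrix ρ id).det) ?_ ?_
  · rw [ruppertMinor]
    simpa using sum_coeff_le_coeffSum N ((ruppertMatrix d (genericSection R τ f)).submatrix ρ id).det {μ}
  -- For distinct row indices, the entries of a selected column are distinct coefficients of one
  -- defect polynomial, so the column sum is at most its coefficient sum. A repeated index makes the
  -- determinant zero.
  by_cases hρ : Function.Injective ρ
  · refine (seminorm_det_le _ h1' _).trans ?_
    rw [← Finset.card_univ, ← Finset.prod_const]
    refine Finset.prod_le_prod (fun _ _ ↦ Finset.sum_nonneg fun _ _ ↦ apply_nonneg _ _)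
      fun s _ ↦ ?_
    have e1 := sum_coeff_le_coeffSum (coeffSum N)
      (closedDefect (genericSection R τ f) (formX _ s) (formY _ s))
      (Finset.univ.map ⟨ρ, hρ⟩)
    rw [Finset.sum_map] at e1
    refine e1.trans ((coeffSum_closedDefect_le _ h1' (totalDegree_genericSection_le hf) s).trans ?_)
    gcongr
    exact coeffSum_genericSection_le N h1 hf
  · simp only [Function.Injective, not_forall] at hρ
    obtain ⟨a, b, hab, hne⟩ := hρ
    rw [Matrix.det_zero_of_row_eq hne (by ext s; simp [hab]), map_zero]
    positivity

end Bound

/-! ### Factors of homogeneous polynomials -/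

section Homogeneous

variable {R : Type*} [CommRing R] {τ : Type*}

lemma pderiv_comm (i j : τ) (p : MvPolynomial τ R) :
    pderiv i (pderiv j p) = pderiv j (pderiv i p) := by
  classical
  ext m
  simp only [coeff_pderiv, Finsupp.add_apply]
  rw [add_right_comm]
  rcases eq_or_ne i j with rfl | h
  · ring
  · simp [h, h.symm]
    ring

/-- The homomorphism `T_t ↦ T_t X`, recording degrees as powers of `X`. -/
noncomputable def degreeHom (R : Type*) [CommRing R] (τ : Type*) :
    MvPolynomial τ R →ₐ[R] Polynomial (MvPolynomial τ R) :=
  aeval fun t ↦ Polynomial.C (X t) * Polynomial.X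

lemma degreeHom_monomial (m : τ →₀ ℕ) (a : R) :
    degreeHom R τ (monomial m a) = Polynomial.C (monomial m a) * Polynomial.X ^ m.degree := by
  rw [degreeHom, aeval_monomial, Finsupp.prod]
  simp_rw [mul_pow]
  rw [Finset.prod_mul_distrib, Finset.prod_pow_eq_pow_sum, monomial_eq (a := a), Finsupp.prod,
    map_mul, map_prod, Finsupp.degree, mul_assoc]
  simp only [map_pow]
  rfl

lemma coeff_degreeHom (p : MvPolynomial τ R) (n : ℕ) :
    (degreeHom R τ p).coeff n = homogeneousComponent n p := by
  classical
  induction p using MvPolynomial.induction_on' with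
  | monomial m a =>
    rw [degreeHom_monomial, Polynomial.coeff_C_mul, Polynomial.coeff_X_pow]
    ext m'
    rw [coeff_homogeneousComponent]
    split_ifs with h1 h2 h2
    · simp
    · have : m ≠ m' := by rintro rfl; exact h2 h1.symm
      simp [coeff_monomial, this]
    · have : m ≠ m' := by rintro rfl; exact h1 h2.symm
      simp [coeff_monomial, this]
    · simp
  | add p q hp hq => simp [hp, hq]

lemma degreeHom_of_isHomogeneous {p : MvPolynomial τ R} {d : ℕ} (hp : p.IsHomogeneous d) :
    degreeHom R τ p = Polynomial.C p * Polynomial.X ^ d := by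
  ext1 n
  rw [coeff_degreeHom, Polynomial.coeff_C_mul, Polynomial.coeff_X_pow,
    homogeneousComponent_of_mem hp]
  split_ifs <;> simp

lemma isHomogeneous_of_natDegree_eq {p : MvPolynomial τ R}
    (h : (degreeHom R τ p).natTrailingDegree = (degreeHom R τ p).natDegree) :
    p.IsHomogeneous (degreeHom R τ p).natDegree := by
  intro m hm
  have hc : (degreeHom R τ p).coeff m.degree ≠ 0 := by
    intro h0
    rw [coeff_degreeHom] at h0
    apply hm
    have := congr_arg (coeff m) h0
    rwa [coeff_homogeneousComponent, if_pos rfl] at this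
  have h1 := Polynomial.natTrailingDegree_le_of_ne_zero hc
  have h2 := Polynomial.le_natDegree_of_ne_zero hc
  have h3 : Finsupp.weight 1 m = m.degree := by rw [Finsupp.degree_eq_weight_one]; rfl
  omega

/-- Under `degreeHom` the lowest and highest exponents of X are additive on products. They agree for
a * b, hence they agree for each factor. -/
lemma isHomogeneous_of_mul [IsDomain R] {a b : MvPolynomial τ R} {d : ℕ}
    (h : (a * b).IsHomogeneous d) (h0 : a * b ≠ 0) :
    ∃ i j, a.IsHomogeneous i ∧ b.IsHomogeneous j ∧ i + j = d := by
  have hab := degreeHom_of_isHomogeneous h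
  have hne : degreeHom R τ (a * b) ≠ 0 := by
    rw [hab]
    exact mul_ne_zero (by simpa using h0) (pow_ne_zero _ Polynomial.X_ne_zero)
  have hd1 : (degreeHom R τ (a * b)).natDegree = d := by
    rw [hab, Polynomial.natDegree_C_mul_X_pow _ _ h0]
  have hd2 : (degreeHom R τ (a * b)).natTrailingDegree = d := by
    rw [hab, Polynomial.C_mul_X_pow_eq_monomial, Polynomial.natTrailingDegree_monomial h0]
  rw [map_mul] at hne hd1 hd2
  have ha := left_ne_zero_of_mul hne
  have hb := right_ne_zero_of_mul hne
  rw [Polynomial.natDegree_mul ha hb] at hd1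
  rw [Polynomial.natTrailingDegree_mul ha hb] at hd2
  have h1 := Polynomial.natTrailingDegree_le_natDegree (degreeHom R τ a)
  have h2 := Polynomial.natTrailingDegree_le_natDegree (degreeHom R τ b)
  exact ⟨_, _, isHomogeneous_of_natDegree_eq (by omega), isHomogeneous_of_natDegree_eq (by omega),
    hd1⟩

lemma not_dvd_of_totalDegree_lt [IsDomain R] {a b : MvPolynomial τ R} (hb : b ≠ 0)
    (h : b.totalDegree < a.totalDegree) : ¬ a ∣ b := by
  rintro ⟨c, rfl⟩
  rw [totalDegree_mul_of_isDomain (left_ne_zero_of_mul hb) (right_ne_zero_of_mul hb)] at h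
  omega

end Homogeneous

/-! ### Closed forms attached to a reducible form -/

section Perfect

variable {Ω : Type*} [Field Ω] [IsAlgClosed Ω] {τ : Type*}

/-- Vanishing derivatives make every exponent divisible by p; the coefficients have p-th roots, and
Frobenius is additive. -/
lemma exists_pow_eq_of_pderiv_eq_zero (p : ℕ) [hp : Fact p.Prime] [CharP Ω p]
    (f : MvPolynomial τ Ω) (hf : ∀ i, pderiv i f = 0) : ∃ g, f = g ^ p := by
  classical
  have hdvd : ∀ m ∈ f.support, ∀ i, p ∣ m i := by
    intro m hm i
    rcases Nat.eq_zero_or_pos (m i) with h0 | hpos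
    · simp [h0]
    have h := congr_arg (coeff (m - Finsupp.single i 1)) (hf i)
    have hle : Finsupp.single i 1 ≤ m := by
      rw [Finsupp.single_le_iff]
      exact hpos
    rw [coeff_pderiv, tsub_add_cancel_of_le hle, coeff_zero, mul_eq_zero] at h
    rcases h with h | h
    · exact absurd h (mem_support_iff.mp hm)
    · rw [← CharP.cast_eq_zero_iff Ω p, ← h]
      simp only [Finsupp.tsub_apply, Finsupp.single_eq_same]
      rw [← Nat.cast_add_one, Nat.sub_add_cancel hpos]
  choose r hr using fun a : Ω ↦ IsAlgClosed.exists_pow_nat_eq a hp.out.pos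
  refine ⟨∑ m ∈ f.support, monomial (m.mapRange (· / p) (Nat.zero_div p)) (r (coeff m f)), ?_⟩
  rw [sum_pow_char p]
  conv_lhs => rw [f.as_sum]
  refine Finset.sum_congr rfl fun m hm ↦ ?_
  rw [monomial_pow, hr]
  refine congr_arg (fun m' ↦ monomial m' (coeff m f)) (Finsupp.ext fun i ↦ ?_)
  simp [Nat.mul_div_cancel' (hdvd m hm i)]

/-- If all derivatives vanished, Euler's relation would give d f = 0. So d = 0 in Ω, and f is then a
p-th power in characteristic p, or a constant in characteristic zero. -/
lemma exists_pderiv_ne_zero_of_irreducible {f : MvPolynomial τ Ω} {d : ℕ} (hf : Irreducible f)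
    (hd : f.IsHomogeneous d) [Fintype τ] : ∃ i, pderiv i f ≠ 0 := by
  by_contra! h
  have he := hd.sum_X_mul_pderiv
  simp only [h, mul_zero, Finset.sum_const_zero] at he
  by_cases hd0 : (d : Ω) = 0
  · obtain ⟨p, hp⟩ := CharP.exists Ω
    rcases CharP.char_is_prime_or_zero Ω p with hp' | rfl
    · have := Fact.mk hp'
      obtain ⟨g, rfl⟩ := exists_pow_eq_of_pderiv_eq_zero p f h
      exact not_irreducible_pow hp'.ne_one hf
    · have := CharP.charP_to_charZero Ω
      have hd' : d = 0 := by exact_mod_cast hd0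
      subst hd'
      have h1 := (totalDegree_eq_zero_iff_eq_C (p := f)).mp (Nat.le_zero.mp hd.totalDegree_le)
      rw [h1] at hf
      refine hf.not_isUnit ((IsUnit.mk0 _ ?_).map C)
      intro h2
      exact hf.ne_zero (by rw [h2, C_0])
  · apply hf.ne_zero
    rw [nsmul_eq_mul, ← map_natCast (C : Ω →+* MvPolynomial τ Ω)] at he
    rcases mul_eq_zero.mp he.symm with h2 | h2
    · exact absurd (C_injective _ _ (h2.trans C_0.symm)) hd0
    · exact h2

end Perfect

section Forms

variable {R : Type*} [CommRing R] {τ : Type*}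

lemma natCast_eq_C (n : ℕ) : (n : MvPolynomial τ R) = C (n : R) := (map_natCast C n).symm

variable [Fintype τ]

/-- The data of a nonzero closed rational `1`-form `∑ A_i dT_i / φ` on projective space. -/
structure IsClosedForm (φ : MvPolynomial τ R) (d : ℕ) (A : τ → MvPolynomial τ R) : Prop where
  isHomogeneous : ∀ i, (A i).IsHomogeneous (d - 1)
  trace : ∑ i, X i * A i = 0
  closed : ∀ i j, φ * (pderiv j (A i) - pderiv i (A j)) = A i * pderiv j φ - A j * pderiv i φ
  ne_zero : ∃ i, A i ≠ 0

/-- The form is the exact differential d(u / F), with u of the same degree as F and not divisible by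
F. Such a u exists because F, not being a unit, cannot divide powers of two different variables. The
form is nonzero because F divides neither u nor a nonzero derivative of F. -/
lemma exists_isClosedForm_of_sq_dvd [IsDomain R] [Nontrivial τ] {F B : MvPolynomial τ R} {e b : ℕ}
    (hF : Prime F) (hFe : F.IsHomogeneous e) (he : 1 ≤ e) (hB : B.IsHomogeneous b) (hB0 : B ≠ 0)
    (hdF : ∃ i, pderiv i F ≠ 0) : ∃ A, IsClosedForm (F ^ 2 * B) (2 * e + b) A := by
  obtain ⟨s, t, hst⟩ := exists_pair_ne τ
  obtain ⟨u, hu, hFu⟩ : ∃ u : MvPolynomial τ R, u.IsHomogeneous e ∧ ¬ F ∣ u := by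
    by_contra! h
    have h1 := hF.dvd_of_dvd_pow (h _ (isHomogeneous_X_pow s e))
    have h2 := hF.dvd_of_dvd_pow (h _ (isHomogeneous_X_pow t e))
    have h3 := ((X_prime (R := R) (i := s)).irreducible).dvd_iff.mp h1
    rcases h3 with h3 | h3
    · exact hF.not_isUnit h3
    · have h4 : (X s : MvPolynomial τ R) ∣ X t := h3.dvd.trans h2
      exact hst (X_dvd_X.mp h4)
  have hE1 := hFe.sum_X_mul_pderiv
  have hE2 := hu.sum_X_mul_pderiv
  refine ⟨fun i ↦ B * (F * pderiv i u - u * pderiv i F), ⟨fun i ↦ ?_, ?_, fun i j ↦ ?_, ?_⟩⟩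
  · have h1 := hB.mul ((hFe.mul (hu.pderiv (i := i))).sub
      (by simpa [add_comm] using hu.mul (hFe.pderiv (i := i))))
    convert h1 using 1
    omega
  · have : ∑ i, X i * (B * (F * pderiv i u - u * pderiv i F)) =
        B * (F * ∑ i, X i * pderiv i u - u * ∑ i, X i * pderiv i F) := by
      simp only [Finset.mul_sum, ← Finset.sum_sub_distrib]
      exact Finset.sum_congr rfl fun i _ ↦ by ring
    rw [this, hE1, hE2]
    simp only [nsmul_eq_mul]
    ring
  · simp only [pow_two, pderiv_mul, map_sub, pderiv_comm i j]
    ring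
  · by_contra! h
    obtain ⟨i, hi⟩ := hdF
    have h1 := (mul_eq_zero.mp (h i)).resolve_left hB0
    have h2 : F ∣ u * pderiv i F := ⟨pderiv i u, by linear_combination -h1⟩
    have h3 := (hF.dvd_or_dvd h2).resolve_left hFu
    refine not_dvd_of_totalDegree_lt hi ?_ h3
    rw [hFe.totalDegree hF.ne_zero]
    exact (hFe.pderiv.totalDegree_le).trans_lt (by omega)

/-- The form is dF / F. Its contraction with the Euler field is e, so it lives on projective space
exactly because e vanishes in R. -/
lemma isClosedForm_of_natCast_eq_zero [IsDomain R] {F B : MvPolynomial τ R} {e b : ℕ}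
    (hFe : F.IsHomogeneous e) (he : 1 ≤ e) (hB : B.IsHomogeneous b) (hB0 : B ≠ 0)
    (hdF : ∃ i, pderiv i F ≠ 0) (he0 : (e : R) = 0) :
    IsClosedForm (F * B) (e + b) fun i ↦ B * pderiv i F := by
  have hE := hFe.sum_X_mul_pderiv
  refine ⟨fun i ↦ ?_, ?_, fun i j ↦ ?_, ?_⟩
  · convert hB.mul (hFe.pderiv (i := i)) using 1
    omega
  · have : ∑ i, X i * (B * pderiv i F) = B * ∑ i, X i * pderiv i F := by
      simp only [Finset.mul_sum]
      exact Finset.sum_congr rfl fun i _ ↦ by ring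
    rw [this, hE, nsmul_eq_mul, natCast_eq_C, he0]
    simp
  · simp only [pderiv_mul, pderiv_comm i j]
    ring
  · exact hdF.imp fun i hi ↦ mul_ne_zero hB0 hi

/-- The form is g dF / F - e dG / G, the combination of logarithmic differentials whose Euler
contraction cancels. Were it zero, F would divide all its own derivatives, which would then vanish,
contradicting Euler's relation with e ≠ 0. -/
lemma isClosedForm_of_two_factors [IsDomain R] {F G B : MvPolynomial τ R} {e g b : ℕ}
    (hF : Prime F) (hFe : F.IsHomogeneous e) (hGg : G.IsHomogeneous g) (he : 1 ≤ e)
    (hg : 1 ≤ g) (hB : B.IsHomogeneous b) (hB0 : B ≠ 0) (hFG : ¬ F ∣ G) (he0 : (e : R) ≠ 0)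
    (hg0 : (g : R) ≠ 0) :
    IsClosedForm (F * G * B) (e + g + b)
      fun i ↦ B * (C (g : R) * (G * pderiv i F) - C (e : R) * (F * pderiv i G)) := by
  have hE1 := hFe.sum_X_mul_pderiv
  have hE2 := hGg.sum_X_mul_pderiv
  refine ⟨fun i ↦ ?_, ?_, fun i j ↦ ?_, ?_⟩
  · have h1 := (hGg.mul (hFe.pderiv (i := i))).C_mul (g : R)
    have h2 := (hFe.mul (hGg.pderiv (i := i))).C_mul (e : R)
    rw [show e + (g - 1) = g + (e - 1) by omega] at h2
    convert hB.mul (h1.sub h2) using 1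
    omega
  · have : ∑ i, X i * (B * (C (g : R) * (G * pderiv i F) - C (e : R) * (F * pderiv i G))) =
        B * (C (g : R) * (G * ∑ i, X i * pderiv i F) - C (e : R) * (F * ∑ i, X i * pderiv i G)) := by
      simp only [Finset.mul_sum, ← Finset.sum_sub_distrib]
      exact Finset.sum_congr rfl fun i _ ↦ by ring
    rw [this, hE1, hE2]
    simp only [nsmul_eq_mul, natCast_eq_C]
    ring
  · simp only [pderiv_mul, map_sub, pderiv_C, pderiv_comm i j]
    ring
  · by_contra! h
    have hz : ∀ i, pderiv i F = 0 := by
      intro i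
      by_contra hi
      have h1 := (mul_eq_zero.mp (h i)).resolve_left hB0
      have h2 : F ∣ (C (g : R) : MvPolynomial τ R) * (G * pderiv i F) :=
        ⟨C (e : R) * pderiv i G, by linear_combination h1⟩
      have hgu : (C (g : R) : MvPolynomial τ R) ≠ 0 := by
        rwa [Ne, C_eq_zero]
      have h3 : ¬ F ∣ (C (g : R) : MvPolynomial τ R) := by
        refine not_dvd_of_totalDegree_lt hgu ?_
        rw [totalDegree_C, hFe.totalDegree hF.ne_zero]
        omega
      have h4 := (hF.dvd_or_dvd ((hF.dvd_or_dvd h2).resolve_left h3)).resolve_left hFG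
      refine not_dvd_of_totalDegree_lt hi ?_ h4
      rw [hFe.totalDegree hF.ne_zero]
      exact (hFe.pderiv.totalDegree_le).trans_lt (by omega)
    simp only [hz, mul_zero, Finset.sum_const_zero, nsmul_eq_mul] at hE1
    rcases mul_eq_zero.mp hE1.symm with h2 | h2
    · rw [natCast_eq_C] at h2
      exact he0 (C_eq_zero.mp h2)
    · exact hF.ne_zero h2

end Forms

section Reducible

variable {Ω : Type*} [Field Ω] {τ : Type*}

lemma one_le_of_not_isUnit {F : MvPolynomial τ Ω} {e : ℕ} (hF : F.IsHomogeneous e)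
    (h0 : F ≠ 0) (hu : ¬ IsUnit F) : 1 ≤ e := by
  by_contra! h
  have he : e = 0 := by omega
  subst he
  have h1 := (totalDegree_eq_zero_iff_eq_C (p := F)).mp (Nat.le_zero.mp hF.totalDegree_le)
  apply hu
  rw [h1]
  refine (IsUnit.mk0 _ fun h2 ↦ h0 ?_).map C
  rw [h1, h2, C_0]

/-- Split off two irreducible factors F and G. If they are associated, F^2 divides φ; otherwise a
logarithmic form is used, of one factor when its degree vanishes in Ω and of both factors when
neither degree does. -/
lemma exists_isClosedForm_of_not_irreducible [IsAlgClosed Ω] [Fintype τ] [Nontrivial τ]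
    {φ : MvPolynomial τ Ω} {d : ℕ}
    (hφ : φ.IsHomogeneous d) (h0 : φ ≠ 0) (hd : 1 ≤ d) (hirr : ¬ Irreducible φ) :
    ∃ A, IsClosedForm φ d A := by
  have hunit : ¬ IsUnit φ := by
    intro hu
    have := (isUnit_iff_totalDegree_of_isReduced.mp hu).2
    rw [hφ.totalDegree h0] at this
    omega
  obtain ⟨F, hF, Q, rfl⟩ := WfDvdMonoid.exists_irreducible_factor hunit h0
  have hQ0 := right_ne_zero_of_mul h0
  have hQu : ¬ IsUnit Q := fun hu ↦ hirr ((irreducible_mul_isUnit hu).mpr hF)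
  obtain ⟨G, hG, B, rfl⟩ := WfDvdMonoid.exists_irreducible_factor hQu hQ0
  obtain ⟨e, q, hFe, hQq, rfl⟩ := isHomogeneous_of_mul hφ h0
  obtain ⟨g, b, hGg, hBb, rfl⟩ := isHomogeneous_of_mul hQq hQ0
  have hB0 := right_ne_zero_of_mul hQ0
  have he := one_le_of_not_isUnit hFe hF.ne_zero hF.not_isUnit
  have hg := one_le_of_not_isUnit hGg hG.ne_zero hG.not_isUnit
  have hdF := exists_pderiv_ne_zero_of_irreducible hF hFe
  have hdG := exists_pderiv_ne_zero_of_irreducible hG hGg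
  by_cases hFG : F ∣ G
  · obtain ⟨c, rfl⟩ := hFG
    have hc : IsUnit c := (hG.isUnit_or_isUnit rfl).resolve_left hF.not_isUnit
    obtain ⟨e', j, hFe', hcj, rfl⟩ := isHomogeneous_of_mul hGg hG.ne_zero
    have hee : e' = e := hFe'.inj_right hFe hF.ne_zero
    subst hee
    have hj : j = 0 := by
      rw [← hcj.totalDegree hc.ne_zero]
      exact (isUnit_iff_totalDegree_of_isReduced.mp hc).2
    subst hj
    obtain ⟨A, hA⟩ := exists_isClosedForm_of_sq_dvd hF.prime hFe he (hcj.mul hBb)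
      (mul_ne_zero hc.ne_zero hB0) hdF
    refine ⟨A, ?_⟩
    convert hA using 1
    · ring
    · omega
  · by_cases he0 : (e : Ω) = 0
    · exact ⟨_, isClosedForm_of_natCast_eq_zero hFe he hQq hQ0 hdF he0⟩
    by_cases hg0 : (g : Ω) = 0
    · obtain ⟨A, hA⟩ : ∃ A, IsClosedForm _ _ A := ⟨_, isClosedForm_of_natCast_eq_zero hGg hg (hFe.mul hBb)
        (mul_ne_zero hF.ne_zero hB0) hdG hg0⟩
      refine ⟨A, ?_⟩
      convert hA using 1
      · ring
      · omega
    · obtain ⟨A, hA⟩ : ∃ A, IsClosedForm _ _ A := ⟨_, isClosedForm_of_two_factors hF.prime hFe hGg he hg hBb hB0 hFG he0 hg0⟩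
      refine ⟨A, ?_⟩
      convert hA using 1
      · ring
      · omega

end Reducible

/-! ### Coordinates on the space of admissible forms -/

section Coordinates

variable {R : Type*} [CommRing R]

lemma coeff_X_pow_mul_X_pow (a b : ℕ) (m : Fin 2 →₀ ℕ) :
    coeff m (X 0 ^ a * X 1 ^ b : MvPolynomial (Fin 2) R) =
      if a = m 0 ∧ b = m 1 then 1 else 0 := by
  classical
  rw [X_pow_eq_monomial, X_pow_eq_monomial, monomial_mul, one_mul, coeff_monomial]
  refine if_congr ⟨?_, ?_⟩ rfl rfl
  · rintro rfl
    simp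
  · rintro ⟨rfl, rfl⟩
    ext i
    fin_cases i <;> simp

lemma sum_ite_pair {s : Finset (ℕ × ℕ)} (c : s → R) (a b : ℕ) :
    ∑ p : s, (if p.1.1 = a ∧ p.1.2 = b then c p else 0) =
      if h : (a, b) ∈ s then c ⟨(a, b), h⟩ else 0 := by
  split_ifs with h
  · rw [Finset.sum_eq_single ⟨(a, b), h⟩]
    · simp
    · rintro ⟨⟨a', b'⟩, hp⟩ - hne
      rw [if_neg]
      rintro ⟨rfl, rfl⟩
      exact hne rfl
    · simp
  · refine Finset.sum_eq_zero fun p _ ↦ if_neg ?_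
    rintro ⟨rfl, rfl⟩
    exact h p.2

lemma coeff_sum_formX {d : ℕ} (c : FormIndex d → R) (m : Fin 2 →₀ ℕ) :
    coeff m (∑ s, C (c s) * formX R s) =
      (if h : (m 0, m 1) ∈ lowExponents d then c (.inl ⟨_, h⟩) else 0) +
        if h : 1 ≤ m 1 ∧ (m 0, m 1 - 1) ∈ topExponents d then c (.inr (.inr ⟨_, h.2⟩)) else 0 := by
  rw [Fintype.sum_sum_type, Fintype.sum_sum_type, coeff_add, coeff_add, coeff_sum, coeff_sum,
    coeff_sum]
  simp only [formX, coeff_C_mul, coeff_X_pow_mul_X_pow, mul_ite, mul_one, mul_zero, coeff_zero,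
    Finset.sum_const_zero, zero_add]
  rw [sum_ite_pair fun p ↦ c (.inl p)]
  congr 1
  split_ifs with h
  · have := sum_ite_pair (fun p ↦ c (.inr (.inr p))) (m 0) (m 1 - 1)
    rw [dif_pos h.2] at this
    rw [← this]
    refine Finset.sum_congr rfl fun p _ ↦ if_congr ?_ rfl rfl
    omega
  · refine Finset.sum_eq_zero fun p _ ↦ if_neg ?_
    rintro ⟨h1, h2⟩
    refine h ⟨by omega, ?_⟩
    rw [← h1, ← h2]
    exact p.2

lemma coeff_sum_formY {d : ℕ} (c : FormIndex d → R) (m : Fin 2 →₀ ℕ) :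
    coeff m (∑ s, C (c s) * formY R s) =
      (if h : (m 0, m 1) ∈ lowExponents d then c (.inr (.inl ⟨_, h⟩)) else 0) -
        if h : 1 ≤ m 0 ∧ (m 0 - 1, m 1) ∈ topExponents d then c (.inr (.inr ⟨_, h.2⟩)) else 0 := by
  rw [Fintype.sum_sum_type, Fintype.sum_sum_type, coeff_add, coeff_add, coeff_sum, coeff_sum,
    coeff_sum]
  simp only [formY, coeff_C_mul, coeff_neg, coeff_X_pow_mul_X_pow, mul_neg, mul_ite, mul_one,
    mul_zero, coeff_zero, Finset.sum_const_zero, zero_add, Finset.sum_neg_distrib]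
  rw [sum_ite_pair fun p ↦ c (.inr (.inl p)), sub_eq_add_neg]
  congr 2
  split_ifs with h
  · have := sum_ite_pair (fun p ↦ c (.inr (.inr p))) (m 0 - 1) (m 1)
    rw [dif_pos h.2] at this
    rw [← this]
    refine Finset.sum_congr rfl fun p _ ↦ if_congr ?_ rfl rfl
    omega
  · refine Finset.sum_eq_zero fun p _ ↦ if_neg ?_
    rintro ⟨h1, h2⟩
    refine h ⟨by omega, ?_⟩
    rw [← h1, ← h2]
    exact p.2

/-- The exponent of `x ^ a * y ^ b`. -/
noncomputable def exponent (a b : ℕ) : Fin 2 →₀ ℕ := Finsupp.single 0 a + Finsupp.single 1 b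

@[simp] lemma exponent_zero (a b : ℕ) : exponent a b 0 = a := by simp [exponent]

@[simp] lemma exponent_one (a b : ℕ) : exponent a b 1 = b := by simp [exponent]

lemma exponent_apply_zero_apply_one (m : Fin 2 →₀ ℕ) : exponent (m 0) (m 1) = m := by
  ext i
  fin_cases i <;> simp

lemma coeff_eq_zero_of_totalDegree_lt_add {f : MvPolynomial (Fin 2) R} {m : Fin 2 →₀ ℕ}
    (h : f.totalDegree < m 0 + m 1) : coeff m f = 0 := by
  by_contra hc
  have := le_totalDegree (mem_support_iff.mpr hc)
  rw [Finsupp.sum_fintype _ _ (by simp), Fin.sum_univ_two] at this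
  omega

lemma coeff_trace (g h : MvPolynomial (Fin 2) R) (a b : ℕ) :
    coeff (exponent a b) (X 0 * g + X 1 * h) =
      (if 1 ≤ a then coeff (exponent (a - 1) b) g else 0) +
        if 1 ≤ b then coeff (exponent a (b - 1)) h else 0 := by
  classical
  rw [coeff_add, mul_comm, coeff_mul_X', mul_comm, coeff_mul_X']
  simp only [Finsupp.mem_support_iff, exponent_zero, exponent_one, ← Nat.one_le_iff_ne_zero]
  congr 1
  · refine if_congr Iff.rfl (congr_arg (coeff · g) ?_) rfl
    ext i
    fin_cases i <;> simp
  · refine if_congr Iff.rfl (congr_arg (coeff · h) ?_) rfl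
    ext i
    fin_cases i <;> simp

/-- The basis forms span the forms `g dx + h dy` with `deg g, deg h, deg (x g + y h) ≤ d - 1`. -/
lemma exists_eq_sum_forms {d : ℕ} (hd : 1 ≤ d) {g h : MvPolynomial (Fin 2) R}
    (hg : g.totalDegree ≤ d - 1) (hh : h.totalDegree ≤ d - 1)
    (hgh : (X 0 * g + X 1 * h).totalDegree ≤ d - 1) :
    ∃ c : FormIndex d → R, ∑ s, C (c s) * formX R s = g ∧ ∑ s, C (c s) * formY R s = h := by
  -- The degree d part of x g + y h vanishes. This ties the top-degree part of h to that of g, so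
  -- only the third family of basis forms is needed in degree d - 1.
  have htr (a b : ℕ) (hab : a + b = d) := coeff_trace g h a b ▸
    coeff_eq_zero_of_totalDegree_lt_add (m := exponent a b) (f := X 0 * g + X 1 * h)
      (by simp only [exponent_zero, exponent_one]; omega)
  let c : FormIndex d → R := fun
    | .inl p => coeff (exponent p.1.1 p.1.2) g
    | .inr (.inl p) => coeff (exponent p.1.1 p.1.2) h
    | .inr (.inr p) => coeff (exponent p.1.1 (p.1.2 + 1)) g
  refine ⟨c, ?_, ?_⟩
  · ext m
    rw [coeff_sum_formX, ← exponent_apply_zero_apply_one m]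
    generalize m 0 = a, m 1 = b
    simp only [exponent_zero, exponent_one, mem_lowExponents, mem_topExponents, c]
    rcases lt_trichotomy (a + b + 1) d with hlt | heq | hgt
    · rw [dif_pos (by omega), dif_neg (by omega), add_zero]
    · rw [dif_neg (by omega), zero_add]
      rcases Nat.eq_zero_or_pos b with rfl | hb
      · rw [dif_neg (by omega)]
        have := htr (a + 1) 0 (by omega)
        simpa using this.symm
      · rw [dif_pos (by omega), Nat.sub_add_cancel hb]
    · rw [dif_neg (by omega), dif_neg (by omega), add_zero,
        coeff_eq_zero_of_totalDegree_lt_add]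
      simp only [exponent_zero, exponent_one]
      omega
  · ext m
    rw [coeff_sum_formY, ← exponent_apply_zero_apply_one m]
    generalize m 0 = a, m 1 = b
    simp only [exponent_zero, exponent_one, mem_lowExponents, mem_topExponents, c]
    rcases lt_trichotomy (a + b + 1) d with hlt | heq | hgt
    · rw [dif_pos (by omega), dif_neg (by omega), sub_zero]
    · rw [dif_neg (by omega), zero_sub]
      have := htr a (b + 1) (by omega)
      rcases Nat.eq_zero_or_pos a with rfl | ha
      · rw [dif_neg (by omega), neg_zero]
        simpa using this.symm
      · rw [dif_pos (by omega)]
        rw [if_pos (by omega), if_pos (by omega), Nat.add_sub_cancel] at this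
        exact neg_eq_of_add_eq_zero_right this
    · rw [dif_neg (by omega), dif_neg (by omega), sub_zero,
        coeff_eq_zero_of_totalDegree_lt_add]
      simp only [exponent_zero, exponent_one]
      omega

lemma forms_linearIndependent {d : ℕ} {c : FormIndex d → R}
    (hX : ∑ s, C (c s) * formX R s = 0) (hY : ∑ s, C (c s) * formY R s = 0) : c = 0 := by
  funext s
  rcases s with ⟨p, hp⟩ | ⟨p, hp⟩ | ⟨p, hp⟩
  · have h := congr_arg (coeff (exponent p.1 p.2)) hX
    have hp' := mem_lowExponents.mp hp
    rw [coeff_sum_formX, coeff_zero] at h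
    simp only [exponent_zero, exponent_one, mem_topExponents] at h
    rwa [dif_pos hp, dif_neg (by omega), add_zero] at h
  · have h := congr_arg (coeff (exponent p.1 p.2)) hY
    have hp' := mem_lowExponents.mp hp
    rw [coeff_sum_formY, coeff_zero] at h
    simp only [exponent_zero, exponent_one, mem_topExponents] at h
    rwa [dif_pos hp, dif_neg (by omega), sub_zero] at h
  · have h := congr_arg (coeff (exponent p.1 (p.2 + 1))) hX
    have hp' := mem_topExponents.mp hp
    rw [coeff_sum_formX, coeff_zero] at h
    simp only [exponent_zero, exponent_one, mem_lowExponents, Nat.add_sub_cancel] at h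
    rwa [dif_neg (by omega), dif_pos ⟨by omega, hp⟩, zero_add] at h

lemma totalDegree_trace_sum_forms_le {d : ℕ} (c : FormIndex d → R) :
    (X 0 * ∑ s, C (c s) * formX R s + X 1 * ∑ s, C (c s) * formY R s).totalDegree ≤ d - 1 := by
  rw [Finset.mul_sum, Finset.mul_sum, ← Finset.sum_add_distrib]
  refine (totalDegree_finsetSum _ _).trans (Finset.sup_le fun s _ ↦ ?_)
  have h : X 0 * (C (c s) * formX R s) + X 1 * (C (c s) * formY R s) =
      C (c s) * (X 0 * formX R s + X 1 * formY R s) := by ring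
  rw [h]
  refine (totalDegree_mul _ _).trans ?_
  rw [totalDegree_C, zero_add]
  rcases s with s | s | s
  · have := mem_lowExponents.mp s.2
    have h : X 0 * formX R (.inl s : FormIndex d) + X 1 * formY R (.inl s : FormIndex d) =
        X 0 ^ (s.1.1 + 1) * X 1 ^ s.1.2 := by
      simp only [formX, formY]; ring
    rw [h]
    exact (totalDegree_X_pow_mul_X_pow_le _ _).trans (by omega)
  · have := mem_lowExponents.mp s.2
    have h : X 0 * formX R (.inr (.inl s) : FormIndex d) +
        X 1 * formY R (.inr (.inl s) : FormIndex d) = X 0 ^ s.1.1 * X 1 ^ (s.1.2 + 1) := by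
      simp only [formX, formY]; ring
    rw [h]
    exact (totalDegree_X_pow_mul_X_pow_le _ _).trans (by omega)
  · have h : X 0 * formX R (.inr (.inr s) : FormIndex d) +
        X 1 * formY R (.inr (.inr s) : FormIndex d) = 0 := by
      simp only [formX, formY]; ring
    simp [h]

lemma totalDegree_sum_formX_le {d : ℕ} (c : FormIndex d → R) :
    (∑ s, C (c s) * formX R s).totalDegree ≤ d - 1 := by
  refine (totalDegree_finsetSum _ _).trans (Finset.sup_le fun s _ ↦ ?_)
  refine (totalDegree_mul _ _).trans ?_
  rw [totalDegree_C, zero_add]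
  exact totalDegree_formX_le s

lemma totalDegree_sum_formY_le {d : ℕ} (c : FormIndex d → R) :
    (∑ s, C (c s) * formY R s).totalDegree ≤ d - 1 := by
  refine (totalDegree_finsetSum _ _).trans (Finset.sup_le fun s _ ↦ ?_)
  refine (totalDegree_mul _ _).trans ?_
  rw [totalDegree_C, zero_add]
  exact totalDegree_formY_le s

end Coordinates

/-! ### Vanishing of the minors on reducible forms -/

section Pullback

variable {R : Type*} [CommRing R] {τ : Type*} [Fintype τ]

lemma pderiv_genericSection (k : Fin 2) (f : MvPolynomial τ R) :
    pderiv k (genericSection R τ f) =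
      ∑ t, genericSection R τ (pderiv t f) * C (X (t, k.castSucc)) := by
  classical
  induction f using MvPolynomial.induction_on with
  | C a => simp
  | add p q hp hq => simp [hp, hq, add_mul, Finset.sum_add_distrib]
  | mul_X p s hp =>
    have h : pderiv k (genericLine R s) = C (X (s, k.castSucc)) := by
      fin_cases k <;> simp [genericLine, pderiv_X]
    have h2 (t : τ) : genericSection R τ (pderiv t (p * X s)) * C (X (t, k.castSucc)) =
        genericSection R τ (pderiv t p) * C (X (t, k.castSucc)) * genericLine R s +
        if t = s then genericSection R τ p * C (X (t, k.castSucc)) else 0 := by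
      rw [pderiv_mul, map_add, map_mul, map_mul, genericSection_X, pderiv_X]
      rcases eq_or_ne t s with rfl | hts
      · simp; ring
      · simp [hts, hts.symm]; ring
    simp only [h2]
    rw [map_mul, pderiv_mul, hp, genericSection_X, h, Finset.sum_add_distrib, ← Finset.sum_mul,
      Finset.sum_ite_eq' Finset.univ s, if_pos (Finset.mem_univ s)]

/-- The component along the `k`-th direction of the pullback of a form to the generic plane. -/
noncomputable def pullbackForm (A : τ → MvPolynomial τ R) (k : Fin 2) :
    MvPolynomial (Fin 2) (MvPolynomial (τ × Fin 3) R) :=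
  ∑ t, genericSection R τ (A t) * C (X (t, k.castSucc))

/-- Pullback commutes with d. By the chain rule the defect is the antisymmetrization in the two
plane directions of the array `Z`, and closedness upstairs says precisely that `Z` is symmetric. -/
lemma closedDefect_pullbackForm {φ : MvPolynomial τ R} {d : ℕ} {A : τ → MvPolynomial τ R}
    (hA : IsClosedForm φ d A) :
    closedDefect (genericSection R τ φ) (pullbackForm A 0) (pullbackForm A 1) = 0 := by
  let S := genericSection R τ
  let Z (i j : τ) := S (φ * pderiv j (A i) - A i * pderiv j φ)
  have hZ (i j : τ) : Z i j = Z j i := by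
    refine congr_arg S ?_
    linear_combination hA.closed i j
  let U (t : τ) (k : Fin 3) : MvPolynomial (Fin 2) (MvPolynomial (τ × Fin 3) R) := C (X (t, k))
  have h1 (k l : Fin 2) : S φ * pderiv l (pullbackForm A k) - pullbackForm A k * pderiv l (S φ) =
      ∑ i, ∑ j, Z i j * (U i k.castSucc * U j l.castSucc) := by
    have e : pullbackForm A k * pderiv l (S φ) = ∑ i, ∑ j,
        S (A i) * C (X (i, k.castSucc)) * (S (pderiv j φ) * C (X (j, l.castSucc))) := by
      rw [pullbackForm, pderiv_genericSection, Finset.sum_mul_sum]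
    rw [e]
    simp only [pullbackForm, map_sum, pderiv_mul, pderiv_C, mul_zero, add_zero, S,
      pderiv_genericSection, Finset.mul_sum, Finset.sum_mul, ← Finset.sum_sub_distrib]
    refine Finset.sum_congr rfl fun i _ ↦ Finset.sum_congr rfl fun j _ ↦ ?_
    simp only [Z, U, S, map_sub, map_mul]
    ring
  have h2 : closedDefect (S φ) (pullbackForm A 0) (pullbackForm A 1) =
      (S φ * pderiv 1 (pullbackForm A 0) - pullbackForm A 0 * pderiv 1 (S φ)) -
      (S φ * pderiv 0 (pullbackForm A 1) - pullbackForm A 1 * pderiv 0 (S φ)) := by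
    simp only [closedDefect]
    ring
  change closedDefect (S φ) _ _ = 0
  rw [h2, h1, h1, sub_eq_zero, Finset.sum_comm]
  refine Finset.sum_congr rfl fun i _ ↦ Finset.sum_congr rfl fun j _ ↦ ?_
  rw [hZ, mul_comm (U _ _)]

lemma totalDegree_pullback_le {d : ℕ} {A : τ → MvPolynomial τ R}
    (hA : ∀ i, (A i).IsHomogeneous d) (k : Fin 3) :
    (∑ t, genericSection R τ (A t) * C (X (t, k))).totalDegree ≤ d := by
  refine (totalDegree_finsetSum _ _).trans (Finset.sup_le fun t _ ↦ ?_)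
  refine (totalDegree_mul _ _).trans ?_
  rw [totalDegree_C, add_zero]
  exact totalDegree_genericSection_le (hA t)

/-- Substituting T_t = u_t x + v_t y + w_t in ∑ T_t A_t = 0 isolates the w-part. The right side
visibly has degree at most d - 1 in x, y, which is the third degree condition on admissible forms.
-/
lemma trace_pullbackForm {φ : MvPolynomial τ R} {d : ℕ} {A : τ → MvPolynomial τ R}
    (hA : IsClosedForm φ d A) :
    X 0 * pullbackForm A 0 + X 1 * pullbackForm A 1 =
      -∑ t, genericSection R τ (A t) * C (X (t, 2)) := by
  have h := congr_arg (genericSection R τ) hA.trace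
  rw [map_sum, map_zero] at h
  rw [eq_neg_iff_add_eq_zero, ← h]
  simp only [pullbackForm, Finset.mul_sum, ← Finset.sum_add_distrib, map_mul, genericSection_X,
    genericLine]
  refine Finset.sum_congr rfl fun t _ ↦ ?_
  simp only [Fin.castSucc_zero, Fin.castSucc_one]
  ring

/-- At x = y = 0 the component becomes ∑ A_t(w) u_t; setting u_i = 1 and the other u_t to 0 recovers
A_i. -/
lemma pullbackForm_zero_ne_zero {A : τ → MvPolynomial τ R} (hA : ∃ i, A i ≠ 0) :
    pullbackForm A 0 ≠ 0 := by
  classical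
  obtain ⟨i, hi⟩ := hA
  intro h0
  have h1 (f : MvPolynomial τ R) :
      constantCoeff (genericSection R τ f) = rename (fun t ↦ (t, (2 : Fin 3))) f := by
    induction f using MvPolynomial.induction_on with
    | C a => simp
    | add p q hp hq => simp [hp, hq]
    | mul_X p t hp => simp [hp, genericLine]
  have h2 := congr_arg constantCoeff h0
  simp only [pullbackForm, map_sum, map_mul, h1, map_zero, constantCoeff_C] at h2
  have h3 := congr_arg (aeval fun p : τ × Fin 3 ↦
    if p.2 = 2 then (X p.1 : MvPolynomial τ R) else if p = (i, 0) then 1 else 0) h2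
  simp only [map_sum, map_mul, aeval_rename, aeval_X, map_zero] at h3
  rw [Finset.sum_eq_single i] at h3
  · apply hi
    have hX : ((fun p : τ × Fin 3 ↦ if p.2 = 2 then (X p.1 : MvPolynomial τ R)
        else if p = (i, 0) then 1 else 0) ∘ fun t ↦ (t, (2 : Fin 3))) = X := by
      funext t
      simp
    rw [hX, aeval_X_left_apply] at h3
    simpa using h3
  · intro t _ ht
    simp [ht]
  · simp

lemma det_submatrix_eq_zero_of_solution {P : Type*} [CommRing P] [IsDomain P] {d : ℕ} (hd : 1 ≤ d)
    {f g h : MvPolynomial (Fin 2) P} (hg : g.totalDegree ≤ d - 1) (hh : h.totalDegree ≤ d - 1)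
    (hgh : (X 0 * g + X 1 * h).totalDegree ≤ d - 1) (hne : g ≠ 0)
    (hdef : closedDefect f g h = 0) (ρ : FormIndex d → (Fin 2 →₀ ℕ)) :
    ((ruppertMatrix d f).submatrix ρ id).det = 0 := by
  obtain ⟨c, rfl, rfl⟩ := exists_eq_sum_forms hd hg hh hgh
  refine Matrix.exists_mulVec_eq_zero_iff.mp ⟨c, ?_, ?_⟩
  · rintro rfl
    simp at hne
  · funext s
    have := ruppertMatrix_mulVec d f c (ρ s)
    rw [hdef, coeff_zero] at this
    simpa [Matrix.mulVec, dotProduct] using this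

/-- The pullback to the generic plane of a closed form attached to a factorization is a nonzero
kernel vector of the Ruppert matrix, so every maximal minor is zero. No assumption on the
characteristic enters, which is essential for its use at all primes. -/
theorem ruppertMinor_eq_zero_of_not_irreducible {Ω : Type*} [Field Ω] [IsAlgClosed Ω]
    [Nontrivial τ] {φ : MvPolynomial τ Ω} {d : ℕ} (hφ : φ.IsHomogeneous d) (h0 : φ ≠ 0)
    (hd : 1 ≤ d) (hirr : ¬ Irreducible φ) (ρ : FormIndex d → (Fin 2 →₀ ℕ))
    (μ : (τ × Fin 3) →₀ ℕ) : ruppertMinor d ρ μ φ = 0 := by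
  obtain ⟨A, hA⟩ := exists_isClosedForm_of_not_irreducible hφ h0 hd hirr
  rw [ruppertMinor, det_submatrix_eq_zero_of_solution hd
    (totalDegree_pullback_le hA.isHomogeneous _) (totalDegree_pullback_le hA.isHomogeneous _) ?_
    (pullbackForm_zero_ne_zero hA.ne_zero) (closedDefect_pullbackForm hA), coeff_zero]
  have := trace_pullbackForm hA
  simp only [pullbackForm] at this
  rw [this, totalDegree_neg]
  exact totalDegree_pullback_le hA.isHomogeneous _

end Pullback

/-! ### The function field of an irreducible hypersurface and its derivations -/

section FunctionField

variable {k : Type*} [Field k] {σ : Type*}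

lemma derivation_aeval {ι A : Type*} [Fintype ι] [CommRing A] [Algebra k A]
    (D : Derivation k A A) (t : ι → A) (p : MvPolynomial ι k) :
    D (aeval t p) = ∑ j, aeval t (pderiv j p) * D (t j) := by
  classical
  induction p using MvPolynomial.induction_on with
  | C a => simp
  | add p q hp hq => simp [hp, hq, add_mul, Finset.sum_add_distrib]
  | mul_X p s hp =>
    have h2 (j : ι) : aeval t (pderiv j (p * X s)) * D (t j) =
        t s * (aeval t (pderiv j p) * D (t j)) + if j = s then aeval t p * D (t j) else 0 := by
      rw [pderiv_mul, map_add, map_mul, map_mul, aeval_X, pderiv_X]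
      rcases eq_or_ne j s with rfl | hjs
      · simp; ring
      · simp [hjs, hjs.symm]; ring
    simp only [h2]
    rw [Finset.sum_add_distrib, Finset.sum_ite_eq' Finset.univ s, if_pos (Finset.mem_univ s),
      ← Finset.mul_sum, ← hp, map_mul, aeval_X, Derivation.leibniz, smul_eq_mul, smul_eq_mul,
      add_comm]

/-- `E` is the function field of the hypersurface `f = 0`, the images of the coordinates being
`t`. -/
structure IsFunctionField {ι : Type*} (f : MvPolynomial ι k) {E : Type*} [Field E] [Algebra k E]
    (t : ι → E) : Prop where
  aeval_eq_zero_iff : ∀ p : MvPolynomial ι k, aeval t p = 0 ↔ f ∣ p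
  exists_eq_div : ∀ e : E, ∃ a b : MvPolynomial ι k, aeval t b ≠ 0 ∧ e = aeval t a / aeval t b

lemma exists_isFunctionField {k : Type u} {ι : Type v} [Field k]
    {f : MvPolynomial ι k} (hf : Irreducible f) :
    ∃ (E : Type (max u v)) (_ : Field E) (_ : Algebra k E) (t : ι → E), IsFunctionField f t := by
  have hprime : (Ideal.span {f}).IsPrime := (Ideal.span_singleton_prime hf.ne_zero).mpr hf.prime
  let B := MvPolynomial ι k ⧸ Ideal.span {f}
  have hB : IsDomain B := Ideal.Quotient.isDomain _
  let π : MvPolynomial ι k →ₐ[k] FractionRing B :=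
    (IsScalarTower.toAlgHom k B (FractionRing B)).comp (Ideal.Quotient.mkₐ k _)
  have hπ : aeval (fun i ↦ π (X i)) = π := by
    ext i
    simp
  have hπ' (p) : π p = algebraMap B (FractionRing B) (Ideal.Quotient.mk _ p) := rfl
  refine ⟨FractionRing B, inferInstance, inferInstance, fun i ↦ π (X i), ?_, ?_⟩
  · intro p
    rw [hπ, hπ', FaithfulSMul.algebraMap_eq_zero_iff, Ideal.Quotient.eq_zero_iff_dvd]
  · intro e
    obtain ⟨a, b, hb, rfl⟩ := IsFractionRing.div_surjective (A := B) e
    obtain ⟨a, rfl⟩ := Ideal.Quotient.mk_surjective a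
    obtain ⟨b, rfl⟩ := Ideal.Quotient.mk_surjective b
    refine ⟨a, b, ?_, ?_⟩
    · rw [hπ, hπ', Ne, FaithfulSMul.algebraMap_eq_zero_iff]
      exact nonZeroDivisors.ne_zero hb
    · rw [hπ, hπ', hπ']

namespace IsFunctionField

variable {ι : Type*} {f : MvPolynomial ι k} {E : Type*} [Field E] [Algebra k E] {t : ι → E}

lemma derivation_eq_zero_of_coords [Fintype ι] (h : IsFunctionField f t) (D : Derivation k E E)
    (hD : ∀ i, D (t i) = 0) (e : E) : D e = 0 := by
  obtain ⟨a, b, hb, rfl⟩ := h.exists_eq_div e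
  have hp (p : MvPolynomial ι k) : D (aeval t p) = 0 := by
    rw [derivation_aeval]
    simp [hD]
  rw [Derivation.leibniz_div, hp, hp]
  simp

/-- The hypothesis says that the vector c is tangent to f = 0, so p ↦ ∑ c_j ∂_j p descends modulo f.
It is extended to fractions by the quotient rule. -/
lemma exists_derivation [Fintype ι] (h : IsFunctionField f t) (c : ι → E)
    (hc : ∑ j, aeval t (pderiv j f) * c j = 0) :
    ∃ D : Derivation k E E, ∀ j, D (t j) = c j := by
  classical
  let num (e : E) : MvPolynomial ι k := (h.exists_eq_div e).choose
  let den (e : E) : MvPolynomial ι k := (h.exists_eq_div e).choose_spec.choose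
  have hden (e : E) : aeval t (den e) ≠ 0 := (h.exists_eq_div e).choose_spec.choose_spec.1
  have hnum (e : E) : e = aeval t (num e) / aeval t (den e) :=
    (h.exists_eq_div e).choose_spec.choose_spec.2
  let d (p : MvPolynomial ι k) : E := ∑ j, aeval t (pderiv j p) * c j
  have hd (p q) : d (p * q) = aeval t p * d q + aeval t q * d p := by
    simp only [d, pderiv_mul, map_add, map_mul, Finset.mul_sum, ← Finset.sum_add_distrib]
    exact Finset.sum_congr rfl fun j _ ↦ by ring
  have hd' (p q) (hpq : aeval t p = aeval t q) : d p = d q := by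
    obtain ⟨r, hr⟩ : f ∣ p - q := by rw [← h.aeval_eq_zero_iff, map_sub, hpq, sub_self]
    have h2 : d (p - q) = d p - d q := by simp [d, sub_mul, Finset.sum_sub_distrib]
    rw [← sub_eq_zero, ← h2, hr, hd, (h.aeval_eq_zero_iff f).mpr dvd_rfl, zero_mul, zero_add]
    exact mul_eq_zero_of_right _ hc
  let D (e : E) : E :=
    (d (num e) * aeval t (den e) - aeval t (num e) * d (den e)) / aeval t (den e) ^ 2
  -- The value of `D` does not depend on the chosen fraction. Additivity and the Leibniz rule then
  -- follow by computing with convenient representatives.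
  have hD (e : E) (a b : MvPolynomial ι k) (hb : aeval t b ≠ 0) (he : e * aeval t b = aeval t a) :
      aeval t b * D e = d a - e * d b := by
    have e0 := hden e
    have e1 : aeval t (num e) = e * aeval t (den e) := ((eq_div_iff e0).mp (hnum e)).symm
    have e2 := hd' (num e * b) (a * den e) (by rw [map_mul, map_mul, e1, ← he]; ring)
    rw [hd, hd, e1] at e2
    have e3 : aeval t (den e) * D e = d (num e) - e * d (den e) := by
      simp only [D, e1]
      field_simp
    have e4 : aeval t (den e) * (aeval t b * D e) = aeval t (den e) * (d a - e * d b) := by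
      rw [← he] at e2
      linear_combination aeval t b * e3 + e2
    exact mul_left_cancel₀ e0 e4
  have hden' (e : E) : e * aeval t (den e) = aeval t (num e) :=
    (eq_div_iff (hden e)).mp (hnum e)
  have hDe (e : E) := hD e (num e) (den e) (hden e) (hden' e)
  have hdadd (p q) : d (p + q) = d p + d q := by
    simp [d, add_mul, Finset.sum_add_distrib]
  have hadd (x y : E) : D (x + y) = D x + D y := by
    have h1 := hD (x + y) (num x * den y + num y * den x) (den x * den y)
      (by rw [map_mul]; exact mul_ne_zero (hden x) (hden y))
      (by simp only [map_add, map_mul, ← hden']; ring)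
    have h2 := hDe x
    have h3 := hDe y
    rw [hdadd, hd, hd, hd, ← hden', ← hden', map_mul] at h1
    refine mul_left_cancel₀ (mul_ne_zero (hden x) (hden y)) ?_
    linear_combination h1 - aeval t (den y) * h2 - aeval t (den x) * h3
  have hmul (x y : E) : D (x * y) = x * D y + y * D x := by
    have h1 := hD (x * y) (num x * num y) (den x * den y)
      (by rw [map_mul]; exact mul_ne_zero (hden x) (hden y))
      (by simp only [map_mul, ← hden']; ring)
    have h2 := hDe x
    have h3 := hDe y
    rw [hd, hd, ← hden', ← hden', map_mul] at h1
    refine mul_left_cancel₀ (mul_ne_zero (hden x) (hden y)) ?_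
    linear_combination h1 - y * aeval t (den y) * h2 - x * aeval t (den x) * h3
  have hone : d 1 = 0 := by simp [d]
  have hpoly (p) : D (aeval t p) = d p := by
    have := hD (aeval t p) p 1 (by simp) (by simp)
    simpa [hone] using this
  have hconst (a : k) : D (algebraMap k E a) = 0 := by
    have := hpoly (C a)
    simpa [d] using this
  refine ⟨Derivation.mk' ⟨⟨D, hadd⟩, fun a x ↦ ?_⟩ fun x y ↦ hmul x y, fun j ↦ ?_⟩
  · simp [Algebra.smul_def, hmul, hconst]
  · have := hpoly (X j)
    rw [aeval_X] at this
    simpa [d, pderiv_X, Pi.single_apply] using this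

end IsFunctionField

end FunctionField

section PartialDerivatives

variable {R : Type*} [CommRing R] {τ : Type*}

lemma totalDegree_pderiv_lt {i : τ} {p : MvPolynomial τ R} (h : pderiv i p ≠ 0) :
    (pderiv i p).totalDegree < p.totalDegree := by
  have key : ∀ m ∈ (pderiv i p).support, m.degree < p.totalDegree := by
    intro m hm
    rw [mem_support_iff, coeff_pderiv] at hm
    have := le_totalDegree (mem_support_iff.mpr (left_ne_zero_of_mul hm))
    change (m + Finsupp.single i 1).degree ≤ _ at this
    rw [map_add, Finsupp.degree_single] at this
    omega
  obtain ⟨m, hm⟩ := ne_zero_iff.mp h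
  refine (Finset.sup_lt_iff ?_).mpr key
  exact (Nat.zero_le _).trans_lt (key m (mem_support_iff.mpr hm))

lemma apply_eq_zero_of_pderiv_eq_zero [IsDomain R] [CharZero R] {i : τ} {p : MvPolynomial τ R}
    (h : pderiv i p = 0) {m : τ →₀ ℕ} (hm : coeff m p ≠ 0) : m i = 0 := by
  by_contra hi
  have hle : Finsupp.single i 1 ≤ m := by
    rw [Finsupp.single_le_iff]
    omega
  have h1 := congr_arg (coeff (m - Finsupp.single i 1)) h
  rw [coeff_pderiv, tsub_add_cancel_of_le hle, coeff_zero] at h1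
  exact mul_ne_zero hm (Nat.cast_add_one_ne_zero _) h1

lemma eq_C_of_pderiv_eq_zero [IsDomain R] [CharZero R] {p : MvPolynomial τ R}
    (h : ∀ i, pderiv i p = 0) : p = C (coeff 0 p) := by
  classical
  ext m
  rw [coeff_C]
  split_ifs with hm
  · rw [hm]
  · by_contra hc
    exact hm (Finsupp.ext fun i ↦ (apply_eq_zero_of_pderiv_eq_zero (h i) hc).symm)

lemma degreeOf_eq_zero_iff_pderiv_eq_zero [IsDomain R] [CharZero R] {i : τ}
    {p : MvPolynomial τ R} : degreeOf i p = 0 ↔ pderiv i p = 0 := by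
  constructor
  · intro h
    ext m
    rw [coeff_pderiv, coeff_zero]
    by_contra hc
    have := monomial_le_degreeOf i (mem_support_iff.mpr (left_ne_zero_of_mul hc))
    simp [h] at this
  · intro h
    refine Nat.le_zero.mp (degreeOf_le_iff.mpr fun m hm ↦ ?_)
    exact (apply_eq_zero_of_pderiv_eq_zero h (mem_support_iff.mp hm)).le

lemma pderiv_eq_zero_of_dvd [IsDomain R] [CharZero R] {i : τ} {f p : MvPolynomial τ R}
    (hfp : f ∣ p) (hp : p ≠ 0) (h : pderiv i p = 0) : pderiv i f = 0 := by
  obtain ⟨r, rfl⟩ := hfp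
  rw [← degreeOf_eq_zero_iff_pderiv_eq_zero] at h ⊢
  rw [degreeOf_mul_eq (left_ne_zero_of_mul hp) (right_ne_zero_of_mul hp)] at h
  omega

lemma coeff_sum_X_mul_pderiv [Fintype τ] (p : MvPolynomial τ R) (m : τ →₀ ℕ) :
    coeff m (∑ i, X i * pderiv i p) = m.degree * coeff m p := by
  classical
  induction p using MvPolynomial.induction_on' with
  | monomial m' a =>
    rw [(isHomogeneous_monomial a rfl).sum_X_mul_pderiv, coeff_smul, nsmul_eq_mul, coeff_monomial]
    split_ifs with h
    · rw [h]
    · simp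
  | add p q hp hq => simp [mul_add, Finset.sum_add_distrib, hp, hq]

end PartialDerivatives

section FunctionField

variable {k : Type*} [Field k] {σ : Type*} {f : MvPolynomial (Option σ) k}
  {E : Type*} [Field E] [Algebra k E] {t : Option σ → E}

namespace IsFunctionField

lemma aeval_pderiv_ne_zero (h : IsFunctionField f t) (hf : pderiv none f ≠ 0) :
    aeval t (pderiv none f) ≠ 0 := by
  rw [Ne, h.aeval_eq_zero_iff]
  exact not_dvd_of_totalDegree_lt hf (totalDegree_pderiv_lt hf)

/-- A relation among the other coordinates would be a multiple of f not involving T_none; in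
characteristic zero f would not involve it either. -/
lemma aeval_some_injective [CharZero k] (h : IsFunctionField f t) (hf : pderiv none f ≠ 0) :
    Function.Injective (aeval (fun i ↦ t (some i)) : MvPolynomial σ k →ₐ[k] E) := by
  classical
  rw [injective_iff_map_eq_zero]
  intro p hp
  by_contra hne
  have h1 : f ∣ rename some p := by
    rw [← h.aeval_eq_zero_iff, aeval_rename]
    exact hp
  have h2 : rename some p ≠ 0 := by
    rw [Ne, map_eq_zero_iff _ (rename_injective _ (Option.some_injective σ))]
    exact hne
  refine hf (pderiv_eq_zero_of_dvd h1 h2 (pderiv_eq_zero_of_notMem_vars ?_))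
  intro hmem
  obtain ⟨x, -, hx⟩ := Finset.mem_image.mp (vars_rename _ _ hmem)
  exact Option.some_ne_none x hx

/-- Implicit differentiation: the value on t_none is forced to be -f_i / f_none by tangency. -/
lemma exists_partials [Fintype σ] [DecidableEq σ] (h : IsFunctionField f t)
    (hf : pderiv none f ≠ 0) :
    ∃ D : σ → Derivation k E E, ∀ i j, D i (t (some j)) = if i = j then 1 else 0 := by
  have h0 := h.aeval_pderiv_ne_zero hf
  have key (i : σ) : ∃ D : Derivation k E E, ∀ j, D (t (some j)) = if i = j then 1 else 0 := by
    obtain ⟨D, hD⟩ := h.exists_derivation (fun o : Option σ ↦ o.elim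
      (-aeval t (pderiv (some i) f) / aeval t (pderiv none f)) fun j ↦ if i = j then 1 else 0) (by
        rw [Fintype.sum_option]
        simp
        field_simp
        ring)
    exact ⟨D, fun j ↦ hD (some j)⟩
  choose D hD using key
  exact ⟨D, hD⟩

lemma derivation_eq_zero [Fintype σ] (h : IsFunctionField f t) (hf : pderiv none f ≠ 0)
    (D : Derivation k E E) (hD : ∀ i, D (t (some i)) = 0) (e : E) : D e = 0 := by
  refine h.derivation_eq_zero_of_coords D (fun o ↦ ?_) e
  rcases o with _ | i
  · have h1 := derivation_aeval D t f
    rw [(h.aeval_eq_zero_iff f).mpr dvd_rfl, map_zero, Fintype.sum_option] at h1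
    simp only [hD, mul_zero, Finset.sum_const_zero, add_zero] at h1
    exact (mul_eq_zero.mp h1.symm).resolve_left (h.aeval_pderiv_ne_zero hf)
  · exact hD i

section Partials

variable [Fintype σ] [DecidableEq σ] {D : σ → Derivation k E E}
  (hD : ∀ i j, D i (t (some j)) = if i = j then 1 else 0)

include hD

lemma partials_comm (h : IsFunctionField f t) (hf : pderiv none f ≠ 0) (i j : σ) (e : E) :
    D i (D j e) = D j (D i e) := by
  have := h.derivation_eq_zero hf ⁅D i, D j⁆ (fun l ↦ by
    rw [Derivation.commutator_apply, hD, hD]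
    split_ifs <;> simp) e
  rwa [Derivation.commutator_apply, sub_eq_zero] at this

lemma partials_aeval (i : σ) (p : MvPolynomial σ k) :
    D i (aeval (fun j ↦ t (some j)) p) = aeval (fun j ↦ t (some j)) (pderiv i p) := by
  rw [derivation_aeval, Finset.sum_eq_single i]
  · simp [hD]
  · intro j _ hj
    simp [hD, hj.symm]
  · simp

omit [Fintype σ] [DecidableEq σ] hD in
lemma isAlgebraic_none (h : IsFunctionField f t) (hf : f ≠ 0) :
    let := (aeval (fun j ↦ t (some j)) : MvPolynomial σ k →ₐ[k] E).toRingHom.toAlgebra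
    IsAlgebraic (MvPolynomial σ k) (t none) := by
  let := (aeval (fun j ↦ t (some j)) : MvPolynomial σ k →ₐ[k] E).toRingHom.toAlgebra
  refine ⟨optionEquivLeft k σ f, ?_, ?_⟩
  · rwa [Ne, EmbeddingLike.map_eq_zero_iff]
  · rw [← (h.aeval_eq_zero_iff f).mpr dvd_rfl]
    have : IsScalarTower k (MvPolynomial σ k) E := IsScalarTower.of_algebraMap_eq fun x ↦ by
      change _ = aeval _ _
      simp [algebraMap_eq]
    have h2 : ((Polynomial.aeval (R := MvPolynomial σ k) (t none)).restrictScalars k).comp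
        (optionEquivLeft k σ).toAlgHom = aeval t := by
      ext o
      rcases o with _ | i
      · simp
      · simp
        change aeval _ _ = _
        simp
    exact congr($h2 f)

omit [Fintype σ] [DecidableEq σ] hD in
lemma exists_relation [CharZero k] (h : IsFunctionField f t) (hf : pderiv none f ≠ 0) (e : E) :
    ∃ P : MvPolynomial (Option σ) k, P ≠ 0 ∧
      aeval (fun o : Option σ ↦ o.elim e fun i ↦ t (some i)) P = 0 := by
  let := (aeval (fun j ↦ t (some j)) : MvPolynomial σ k →ₐ[k] E).toRingHom.toAlgebra
  have hf0 : f ≠ 0 := by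
    rintro rfl
    simp at hf
  have htower : IsScalarTower k (MvPolynomial σ k) E := IsScalarTower.of_algebraMap_eq fun x ↦ by
    change _ = aeval _ _
    simp [algebraMap_eq]
  have hpoly (p : MvPolynomial (Option σ) k) : IsAlgebraic (MvPolynomial σ k) (aeval t p) := by
    induction p using MvPolynomial.induction_on with
    | C a =>
      have : aeval t (C a) = algebraMap (MvPolynomial σ k) E (C a) := by
        change _ = aeval _ _
        simp
      rw [this]
      exact isAlgebraic_algebraMap _
    | add p q hp hq => rw [map_add]; exact hp.add hq
    | mul_X p o hp =>
      rw [map_mul, aeval_X]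
      refine hp.mul ?_
      rcases o with _ | i
      · exact h.isAlgebraic_none hf0
      · have : t (some i) = algebraMap (MvPolynomial σ k) E (X i) := by
          change _ = aeval _ _
          simp
        rw [this]
        exact isAlgebraic_algebraMap _
  have hfaith : FaithfulSMul (MvPolynomial σ k) E :=
    (faithfulSMul_iff_algebraMap_injective _ _).mpr (h.aeval_some_injective hf)
  obtain ⟨a, b, hb, rfl⟩ := h.exists_eq_div e
  have halg : IsAlgebraic (MvPolynomial σ k) (aeval t a / aeval t b) := by
    rw [div_eq_mul_inv]
    exact (hpoly a).mul (hpoly b).inv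
  obtain ⟨p, hp, hp0⟩ := halg
  refine ⟨(optionEquivLeft k σ).symm p, by rwa [Ne, EmbeddingLike.map_eq_zero_iff], ?_⟩
  rw [← hp0]
  have h2 : ((Polynomial.aeval (R := MvPolynomial σ k)
      (aeval t a / aeval t b)).restrictScalars k).comp (optionEquivLeft k σ).toAlgHom =
      aeval (fun o : Option σ ↦ o.elim (aeval t a / aeval t b) fun i ↦ t (some i)) := by
    ext o
    rcases o with _ | i
    · simp
    · simp
      change aeval _ _ = _
      simp
  rw [← h2]
  simp

/-- Start from an algebraic relation P(e, t) = 0. Since all D_i e vanish, applying D_i yields the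
relation ∂_i P, of smaller degree. Descent ends with a nonzero relation involving e alone, so e is
algebraic over k, hence in k. -/
lemma mem_range_of_partials_eq_zero [CharZero k] [IsAlgClosed k] (h : IsFunctionField f t)
    (hf : pderiv none f ≠ 0) (e : E) (he : ∀ i, D i e = 0) : ∃ a : k, e = algebraMap k E a := by
  classical
  let s : Option σ → E := fun o ↦ o.elim e fun i ↦ t (some i)
  have hder (i : σ) (P : MvPolynomial (Option σ) k) :
      D i (aeval s P) = aeval s (pderiv (some i) P) := by
    rw [derivation_aeval, Finset.sum_eq_single (some i)]
    · simp [s, hD]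
    · rintro (_ | j) _ hj
      · simp [s, he]
      · have : i ≠ j := by rintro rfl; exact hj rfl
        simp [s, hD, this]
    · simp
  obtain ⟨P, hP0, hP, hmin⟩ : ∃ P : MvPolynomial (Option σ) k, P ≠ 0 ∧ aeval s P = 0 ∧
      ∀ i : σ, pderiv (some i) P = 0 := by
    obtain ⟨P, hP0, hP⟩ := h.exists_relation hf e
    induction hn : P.totalDegree using Nat.strong_induction_on generalizing P with
    | _ n ih =>
      by_cases hz : ∀ i : σ, pderiv (some i) P = 0
      · exact ⟨P, hP0, hP, hz⟩
      · push Not at hz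
        obtain ⟨i, hi⟩ := hz
        refine ih _ (hn ▸ totalDegree_pderiv_lt hi) _ hi ?_ rfl
        have := hder i P
        rw [← this]
        change D i (aeval s P) = 0
        rw [show aeval s P = 0 from hP, map_zero]
  have hvars : (P.vars : Set (Option σ)) ⊆ Set.range fun _ : Unit ↦ (none : Option σ) := by
    rintro (_ | i) hi
    · simp
    · obtain ⟨m, hm, hmi⟩ := (mem_vars_iff_mem_support _).mp hi
      exact absurd (apply_eq_zero_of_pderiv_eq_zero (hmin i) (mem_support_iff.mp hm))
        (Finsupp.mem_support_iff.mp hmi)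
  obtain ⟨q, rfl⟩ := exists_rename_eq_of_vars_subset_range P (fun _ : Unit ↦ (none : Option σ))
    (fun _ _ _ ↦ rfl) hvars
  have halg : IsAlgebraic k e := by
    refine ⟨uniqueAlgEquiv k Unit q, ?_, ?_⟩
    · rw [Ne, EmbeddingLike.map_eq_zero_iff]
      rintro rfl
      simp at hP0
    · rw [aeval_rename] at hP
      rw [← hP]
      have h2 : (Polynomial.aeval (R := k) e).comp (uniqueAlgEquiv k Unit).toAlgHom =
          aeval (s ∘ fun _ : Unit ↦ none) := by
        ext o
        simp [s]
      exact congr($h2 q)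
  obtain ⟨a, ha⟩ := minpoly.mem_range_of_degree_eq_one k e
    (IsAlgClosed.degree_eq_one_of_irreducible k (minpoly.irreducible halg.isIntegral))
  exact ⟨a, ha.symm⟩

/-- An element of the function field all of whose partial derivatives are polynomials in the
coordinates `t_i` is itself such a polynomial. -/
lemma mem_range_of_partials_mem_range [CharZero k] [IsAlgClosed k] (h : IsFunctionField f t)
    (hf : pderiv none f ≠ 0) (e : E)
    (he : ∀ i, ∃ p : MvPolynomial σ k, D i e = aeval (fun j ↦ t (some j)) p) :
    ∃ p : MvPolynomial σ k, e = aeval (fun j ↦ t (some j)) p := by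
  choose p hp using he
  let ε : MvPolynomial σ k →ₐ[k] E := aeval fun j ↦ t (some j)
  have hp' (i : σ) : D i e = ε (p i) := hp i
  let s : MvPolynomial σ k := ∑ i, X i * p i
  -- The primitive of the form ∑ p_i dX_i given by the Euler homotopy: each degree n part of s is
  -- divided by n. The convention for the inverse of 0 is harmless because s has no constant term.
  let q : MvPolynomial σ k := ∑ n ∈ Finset.range (s.totalDegree + 1),
    C ((n : k)⁻¹) * homogeneousComponent n s
  have hq : ∑ i, X i * pderiv i q = s := by
    ext m
    rw [coeff_sum_X_mul_pderiv]
    simp only [q, coeff_sum, coeff_C_mul, coeff_homogeneousComponent]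
    rcases eq_or_ne m.degree 0 with h0 | h0
    · have : m = 0 := by simpa [Finsupp.degree_eq_zero_iff] using h0
      subst this
      simp only [map_zero, Nat.cast_zero, zero_mul, s, ← constantCoeff_eq, map_sum, map_mul,
        constantCoeff_X, Finset.sum_const_zero, ite_self]
    · simp only [mul_ite, mul_zero, Finset.sum_ite_eq, Finset.mem_range]
      split_ifs with hlt
      · have : (m.degree : k) ≠ 0 := by exact_mod_cast h0
        field_simp
      · symm
        by_contra hc
        have := le_totalDegree (mem_support_iff.mpr hc)
        change m.degree ≤ _ at this
        omega
  let r (i : σ) : MvPolynomial σ k := p i - pderiv i q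
  have hr (i : σ) : D i (e - ε q) = ε (r i) := by
    rw [map_sub, hp', partials_aeval hD, map_sub]
  have hεX (i : σ) : ε (X i) = t (some i) := aeval_X _ _
  have hE : ∑ i, t (some i) * D i (e - ε q) = 0 := by
    have : ∑ i, X i * r i = 0 := by
      simp only [r, mul_sub, Finset.sum_sub_distrib, hq]
      exact sub_self s
    have h2 := congr_arg ε this
    simpa only [map_sum, map_mul, hεX, ← hr, map_zero] using h2
  -- Applying D_i to ∑ t_j D_j(e - q) = 0 and commuting derivations gives (Euler operator + 1) r_i =
  -- 0. This operator multiplies a degree m coefficient by m + 1, so it is injective.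
  have hr0 (i : σ) : r i = 0 := by
    have h1 := congr_arg (D i) hE
    simp only [map_sum, Derivation.leibniz, smul_eq_mul, hD, map_zero] at h1
    rw [Finset.sum_add_distrib] at h1
    simp only [partials_comm hD h hf i, mul_ite, mul_one, mul_zero, Finset.sum_ite_eq,
      Finset.mem_univ, if_true] at h1
    simp only [hr, ε, partials_aeval hD] at h1
    have h2 : ε (∑ j, X j * pderiv j (r i) + r i) = 0 := by
      simpa only [map_add, map_sum, map_mul, hεX] using h1
    have h3 := (map_eq_zero_iff ε (h.aeval_some_injective hf)).mp h2
    ext m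
    have h4 := congr_arg (coeff m) h3
    rw [coeff_add, coeff_sum_X_mul_pderiv, coeff_zero] at h4
    have h5 : ((m.degree : k) + 1) * coeff m (r i) = 0 := by linear_combination h4
    exact (mul_eq_zero.mp h5).resolve_left (Nat.cast_add_one_ne_zero _)
  obtain ⟨a, ha⟩ := h.mem_range_of_partials_eq_zero hD hf (e - ε q) fun i ↦ by
    rw [hr, hr0, map_zero]
  refine ⟨q + C a, ?_⟩
  rw [map_add, aeval_C, ← ha]
  ring

end Partials

end IsFunctionField

end FunctionField

section CoeffDerivation

variable {k E : Type*} [Field k] [Field E] [Algebra k E] {ι : Type*}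

/-- The action of a derivation on the coefficients of polynomials, as a linear map. -/
noncomputable def coeffMap (D : Derivation k E E) : MvPolynomial ι E →ₗ[k] MvPolynomial ι E where
  toFun p := ∑ m ∈ p.support, monomial m (D (coeff m p))
  map_add' p q := by
    classical
    have key (r : MvPolynomial ι E) (m' : ι →₀ ℕ) :
        coeff m' (∑ m ∈ r.support, monomial m (D (coeff m r))) = D (coeff m' r) := by
      simp only [coeff_sum, coeff_monomial, Finset.sum_ite_eq']
      split_ifs with h
      · rfl
      · rw [notMem_support_iff.mp h, map_zero]
    ext m
    rw [coeff_add, key, key, key, coeff_add, map_add]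
  map_smul' a p := by
    classical
    have key (r : MvPolynomial ι E) (m' : ι →₀ ℕ) :
        coeff m' (∑ m ∈ r.support, monomial m (D (coeff m r))) = D (coeff m' r) := by
      simp only [coeff_sum, coeff_monomial, Finset.sum_ite_eq']
      split_ifs with h
      · rfl
      · rw [notMem_support_iff.mp h, map_zero]
    ext m
    rw [RingHom.id_apply, coeff_smul, key, key, coeff_smul, Derivation.map_smul]

lemma coeff_coeffMap (D : Derivation k E E) (p : MvPolynomial ι E) (m' : ι →₀ ℕ) :
    coeff m' (coeffMap D p) = D (coeff m' p) := by
  classical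
  change coeff m' (∑ m ∈ p.support, monomial m (D (coeff m p))) = _
  simp only [coeff_sum, coeff_monomial, Finset.sum_ite_eq']
  split_ifs with h
  · rfl
  · rw [notMem_support_iff.mp h, map_zero]

/-- The action of a derivation on the coefficients of polynomials. -/
noncomputable def coeffDerivation (D : Derivation k E E) :
    Derivation k (MvPolynomial ι E) (MvPolynomial ι E) :=
  Derivation.mk' (coeffMap D) fun p q ↦ by
    classical
    ext m
    rw [coeff_coeffMap, smul_eq_mul, smul_eq_mul, mul_comm q, coeff_add, coeff_mul, coeff_mul,
      coeff_mul, map_sum, ← Finset.sum_add_distrib]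
    refine Finset.sum_congr rfl fun x _ ↦ ?_
    rw [Derivation.leibniz, coeff_coeffMap, coeff_coeffMap, smul_eq_mul, smul_eq_mul]
    ring

variable (D D' : Derivation k E E)

lemma coeff_coeffDerivation (p : MvPolynomial ι E) (m : ι →₀ ℕ) :
    coeff m (coeffDerivation D p) = D (coeff m p) :=
  coeff_coeffMap D p m

@[simp]
lemma coeffDerivation_C (e : E) : coeffDerivation D (C e : MvPolynomial ι E) = C (D e) := by
  classical
  ext m
  rw [coeff_coeffDerivation, coeff_C, coeff_C]
  split_ifs <;> simp

@[simp]
lemma coeffDerivation_X (i : ι) : coeffDerivation D (X i : MvPolynomial ι E) = 0 := by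
  classical
  ext m
  rw [coeff_coeffDerivation, coeff_X, coeff_zero]
  split_ifs <;> simp

lemma pderiv_coeffDerivation (i : ι) (p : MvPolynomial ι E) :
    pderiv i (coeffDerivation D p) = coeffDerivation D (pderiv i p) := by
  ext m
  rw [coeff_pderiv, coeff_coeffDerivation, coeff_coeffDerivation, coeff_pderiv, Derivation.leibniz]
  have : D ((m i : E) + 1) = 0 := by
    rw [map_add, Derivation.map_natCast, Derivation.map_one_eq_zero, add_zero]
  rw [this, smul_zero, zero_add, smul_eq_mul, mul_comm]

lemma coeffDerivation_comm (h : ∀ e, D (D' e) = D' (D e)) (p : MvPolynomial ι E) :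
    coeffDerivation D (coeffDerivation D' p) = coeffDerivation D' (coeffDerivation D p) := by
  ext m
  simp only [coeff_coeffDerivation, h]

end CoeffDerivation

/-! ### Differentiation along generic lines -/

section LineDerivation

variable {k E : Type*} [Field k] [Field E] [Algebra k E] {σ : Type*} [Fintype σ]

/-- The derivation `∂/∂y + ∑ v_i D_i` of the polynomial ring `E[y, v_i]`. -/
noncomputable def lineDerivation (D : σ → Derivation k E E) :
    Derivation k (MvPolynomial (Option σ) E) (MvPolynomial (Option σ) E) :=
  (pderiv none).restrictScalars k + ∑ i, (X (some i) : MvPolynomial (Option σ) E) •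
    coeffDerivation (D i)

variable (D : σ → Derivation k E E)

lemma lineDerivation_apply (p : MvPolynomial (Option σ) E) :
    lineDerivation D p = pderiv none p + ∑ i, X (some i) * coeffDerivation (D i) p := by
  have (s : Finset σ) : (∑ i ∈ s, (X (some i) : MvPolynomial (Option σ) E) •
      coeffDerivation (D i)) p = ∑ i ∈ s, X (some i) * coeffDerivation (D i) p := by
    classical
    induction s using Finset.induction_on with
    | empty => simp
    | insert i s hi ih =>
      rw [Finset.sum_insert hi, Finset.sum_insert hi, Derivation.add_apply, ih,
        Derivation.smul_apply, smul_eq_mul]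
  rw [lineDerivation, Derivation.add_apply, this]
  rfl

lemma lineDerivation_C (e : E) :
    lineDerivation D (C e) = ∑ i, X (some i) * C (D i e) := by
  simp [lineDerivation_apply]

lemma lineDerivation_X_some (i : σ) : lineDerivation D (X (some i)) = 0 := by
  classical
  simp [lineDerivation_apply, pderiv_X]

lemma lineDerivation_X_none : lineDerivation D (X none) = 1 := by
  simp [lineDerivation_apply]

lemma lineDerivation_pderiv_none (p : MvPolynomial (Option σ) E) :
    pderiv none (lineDerivation D p) = lineDerivation D (pderiv none p) := by
  classical
  simp only [lineDerivation_apply, map_add, map_sum, pderiv_mul, pderiv_coeffDerivation]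
  simp [pderiv_X]

lemma lineDerivation_pderiv_some (i : σ) (p : MvPolynomial (Option σ) E) :
    pderiv (some i) (lineDerivation D p) =
      lineDerivation D (pderiv (some i) p) + coeffDerivation (D i) p := by
  classical
  simp only [lineDerivation_apply, map_add, map_sum, pderiv_mul, pderiv_coeffDerivation,
    pderiv_comm (some i) none, Finset.sum_add_distrib]
  rw [add_assoc, add_comm (Finset.sum _ _)]
  congr 2
  rw [Finset.sum_eq_single i]
  · simp
  · intro j _ hj
    simp [hj.symm]
  · simp

lemma lineDerivation_coeffDerivation (hcomm : ∀ i j e, D i (D j e) = D j (D i e)) (i : σ)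
    (p : MvPolynomial (Option σ) E) :
    coeffDerivation (D i) (lineDerivation D p) = lineDerivation D (coeffDerivation (D i) p) := by
  simp only [lineDerivation_apply, map_add, map_sum, Derivation.leibniz, smul_eq_mul,
    coeffDerivation_X, mul_zero, add_zero, pderiv_coeffDerivation,
    coeffDerivation_comm (D i) _ (hcomm i _)]

/-- The commutator of ∂/∂v_i with the line derivation is D_i on coefficients, which commutes with
both; hence the usual binomial formula with a single correction term. -/
lemma iterate_lineDerivation_pderiv_some (hcomm : ∀ i j e, D i (D j e) = D j (D i e)) (i : σ)
    (p : MvPolynomial (Option σ) E) (n : ℕ) :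
    pderiv (some i) ((lineDerivation D)^[n + 1] p) =
      (lineDerivation D)^[n + 1] (pderiv (some i) p) +
        ((n : MvPolynomial (Option σ) E) + 1) *
          (lineDerivation D)^[n] (coeffDerivation (D i) p) := by
  have hc (m : ℕ) : coeffDerivation (D i) ((lineDerivation D)^[m] p) =
      (lineDerivation D)^[m] (coeffDerivation (D i) p) := by
    induction m with
    | zero => rfl
    | succ m ih =>
      rw [Function.iterate_succ_apply', Function.iterate_succ_apply',
        lineDerivation_coeffDerivation D hcomm, ih]
  induction n with
  | zero => simp [lineDerivation_pderiv_some]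
  | succ n ih =>
    have h0 : lineDerivation D ((n : MvPolynomial (Option σ) E) + 1) = 0 := by
      rw [map_add, Derivation.map_natCast, Derivation.map_one_eq_zero, add_zero]
    rw [Function.iterate_succ_apply', lineDerivation_pderiv_some, ih, map_add, hc,
      Derivation.leibniz, h0, smul_zero, add_zero, smul_eq_mul,
      ← Function.iterate_succ_apply' (lineDerivation D) n,
      ← Function.iterate_succ_apply' (lineDerivation D) (n + 1)]
    push_cast
    ring

/-- The elements annihilated by a power of the line derivation. -/
def IsLineNilpotent (p : MvPolynomial (Option σ) E) : Prop :=
  ∃ n, (lineDerivation D)^[n] p = 0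

variable {D}

lemma iterate_eq_zero_of_le {p : MvPolynomial (Option σ) E} {m n : ℕ}
    (h : (lineDerivation D)^[m] p = 0) (hmn : m ≤ n) : (lineDerivation D)^[n] p = 0 := by
  obtain ⟨l, rfl⟩ := Nat.exists_eq_add_of_le' hmn
  rw [Function.iterate_add_apply, h, iterate_map_zero]

lemma IsLineNilpotent.add {p q : MvPolynomial (Option σ) E} (hp : IsLineNilpotent D p)
    (hq : IsLineNilpotent D q) : IsLineNilpotent D (p + q) := by
  obtain ⟨m, hm⟩ := hp
  obtain ⟨n, hn⟩ := hq
  refine ⟨max m n, ?_⟩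
  rw [iterate_map_add, iterate_eq_zero_of_le hm (le_max_left _ _),
    iterate_eq_zero_of_le hn (le_max_right _ _), add_zero]

lemma IsLineNilpotent.neg {p : MvPolynomial (Option σ) E} (hp : IsLineNilpotent D p) :
    IsLineNilpotent D (-p) := by
  obtain ⟨m, hm⟩ := hp
  exact ⟨m, by rw [iterate_map_neg, hm, neg_zero]⟩

lemma IsLineNilpotent.mul {p q : MvPolynomial (Option σ) E} (hp : IsLineNilpotent D p)
    (hq : IsLineNilpotent D q) : IsLineNilpotent D (p * q) := by
  obtain ⟨m, hm⟩ := hp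
  obtain ⟨n, hn⟩ := hq
  refine ⟨m + n, ?_⟩
  induction hN : m + n generalizing m n p q with
  | zero =>
    have : m = 0 := by omega
    subst this
    rw [Function.iterate_zero_apply] at hm ⊢
    rw [hm, zero_mul]
  | succ N ih =>
    rw [Function.iterate_succ_apply, Derivation.leibniz, iterate_map_add, smul_eq_mul,
      smul_eq_mul, mul_comm q]
    have h1 : (lineDerivation D)^[N] (p * lineDerivation D q) = 0 := by
      rcases n with _ | n
      · rw [Function.iterate_zero_apply] at hn
        rw [hn, map_zero, mul_zero, iterate_map_zero]
      · exact ih m hm n hn (by omega)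
    have h2 : (lineDerivation D)^[N] (lineDerivation D p * q) = 0 := by
      rcases m with _ | m
      · rw [Function.iterate_zero_apply] at hm
        rw [hm, map_zero, zero_mul, iterate_map_zero]
      · exact ih m hm n hn (by omega)
    rw [h1, h2, add_zero]

lemma isLineNilpotent_X (o : Option σ) : IsLineNilpotent D (X o) := by
  rcases o with _ | i
  · refine ⟨2, ?_⟩
    simp [lineDerivation_X_none]
  · exact ⟨1, lineDerivation_X_some D i⟩

lemma IsLineNilpotent.pderiv (hcomm : ∀ i j e, D i (D j e) = D j (D i e))
    {p : MvPolynomial (Option σ) E} (hp : IsLineNilpotent D p) (o : Option σ) :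
    IsLineNilpotent D (MvPolynomial.pderiv o p) := by
  obtain ⟨n, hn⟩ := hp
  rcases o with _ | i
  · refine ⟨n, ?_⟩
    have (m : ℕ) : (lineDerivation D)^[m] (MvPolynomial.pderiv none p) =
        MvPolynomial.pderiv none ((lineDerivation D)^[m] p) := by
      induction m with
      | zero => rfl
      | succ m ih =>
        rw [Function.iterate_succ_apply', Function.iterate_succ_apply', ih,
          lineDerivation_pderiv_none]
    rw [this, hn, map_zero]
  · refine ⟨n + 2, ?_⟩
    have h1 := iterate_lineDerivation_pderiv_some D hcomm i p (n + 1)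
    have hc : (lineDerivation D)^[n + 1] (coeffDerivation (D i) p) =
        coeffDerivation (D i) ((lineDerivation D)^[n + 1] p) := by
      generalize n + 1 = m
      induction m with
      | zero => rfl
      | succ m ih =>
        rw [Function.iterate_succ_apply', Function.iterate_succ_apply',
          lineDerivation_coeffDerivation D hcomm, ih]
    rw [hc, iterate_eq_zero_of_le hn (by omega), iterate_eq_zero_of_le hn (by omega), map_zero,
      map_zero, mul_zero, add_zero] at h1
    exact h1.symm

end LineDerivation

section Polynomiality

variable {k E : Type*} [Field k] [CharZero k] [IsAlgClosed k] [Field E] [Algebra k E]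
  {σ : Type*} [Fintype σ] [DecidableEq σ] {f : MvPolynomial (Option σ) k} {t : Option σ → E}
  {D : σ → Derivation k E E} (hD : ∀ i j, D i (t (some j)) = if i = j then 1 else 0)

include hD

omit [CharZero k] [IsAlgClosed k] in
lemma isLineNilpotent_map (q : MvPolynomial (Option σ) (MvPolynomial σ k)) :
    IsLineNilpotent D
      (map (aeval (fun j ↦ t (some j)) : MvPolynomial σ k →ₐ[k] E).toRingHom q) := by
  induction q using MvPolynomial.induction_on with
  | C p =>
    rw [map_C]
    induction p using MvPolynomial.induction_on with
    | C a =>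
      refine ⟨1, ?_⟩
      simp [lineDerivation_C]
    | add p q hp hq =>
      rw [map_add, map_add]
      exact hp.add hq
    | mul_X p i hp =>
      rw [map_mul, map_mul]
      refine hp.mul ⟨2, ?_⟩
      simp [lineDerivation_C, hD, Function.iterate_succ, lineDerivation_X_some]
  | add p q hp hq =>
    rw [map_add]
    exact hp.add hq
  | mul_X p o hp =>
    rw [map_mul, map_X]
    exact hp.mul (isLineNilpotent_X o)

/-- Differentiating the hypothesis in v_i lowers the exponent by one and replaces e by D_i e. By
induction all the D_i e are polynomials in the coordinates, and then so is e. -/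
lemma mem_range_of_iterate_C (h : IsFunctionField f t) (hf : pderiv none f ≠ 0) (n : ℕ) (e : E)
    (he : (lineDerivation D)^[n] (C e) = 0) :
    ∃ p : MvPolynomial σ k, e = aeval (fun j ↦ t (some j)) p := by
  have : CharZero E := charZero_of_injective_algebraMap (algebraMap k E).injective
  induction n generalizing e with
  | zero =>
    rw [Function.iterate_zero_apply, C_eq_zero] at he
    exact ⟨0, by rw [he, map_zero]⟩
  | succ n ih =>
    refine h.mem_range_of_partials_mem_range hD hf e fun i ↦ ih _ ?_
    have h1 := iterate_lineDerivation_pderiv_some D (h.partials_comm hD hf) i (C e) n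
    rw [he, map_zero, pderiv_C, iterate_map_zero, zero_add, coeffDerivation_C] at h1
    refine (mul_eq_zero.mp h1.symm).resolve_left ?_
    rw [← map_natCast (C : E →+* MvPolynomial (Option σ) E), ← C_1, ← C_add, C_eq_zero]
    exact Nat.cast_add_one_ne_zero n

/-- The coefficients of an element killed by a power of the line derivation are polynomials in the
coordinates. -/
lemma IsLineNilpotent.exists_map_eq (h : IsFunctionField f t)
    (hf : MvPolynomial.pderiv none f ≠ 0) {q : MvPolynomial (Option σ) E} (hq : IsLineNilpotent D q) :
    ∃ q' : MvPolynomial (Option σ) (MvPolynomial σ k),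
      q = map (aeval (fun j ↦ t (some j)) : MvPolynomial σ k →ₐ[k] E).toRingHom q' := by
  classical
  have : CharZero E := charZero_of_injective_algebraMap (algebraMap k E).injective
  let ε : MvPolynomial σ k →+* E := (aeval (fun j ↦ t (some j)) : MvPolynomial σ k →ₐ[k] E).toRingHom
  have lift (r : MvPolynomial (Option σ) E) (hr : ∀ m, ∃ p, coeff m r = ε p) :
      ∃ r' : MvPolynomial (Option σ) (MvPolynomial σ k), r = map ε r' := by
    choose p hp using hr
    refine ⟨∑ m ∈ r.support, monomial m (p m), ?_⟩
    conv_lhs => rw [r.as_sum]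
    simp only [map_sum, map_monomial, hp]
  induction hn : q.totalDegree using Nat.strong_induction_on generalizing q with
  | _ n ih =>
    have hder (o : Option σ) : ∃ r' : MvPolynomial (Option σ) (MvPolynomial σ k),
        MvPolynomial.pderiv o q = map ε r' := by
      by_cases h0 : MvPolynomial.pderiv o q = 0
      · exact ⟨0, by rw [h0, map_zero]⟩
      · exact ih _ (hn ▸ totalDegree_pderiv_lt h0) (hq.pderiv (h.partials_comm hD hf) o) rfl
    -- Partial derivatives of q are again nilpotent and of smaller degree, so induction controls all
    -- nonconstant coefficients, up to division by a positive integer. The constant coefficient is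
    -- isolated below by subtraction.
    have hcoeff (m : Option σ →₀ ℕ) (hm : m ≠ 0) : ∃ p, coeff m q = ε p := by
      obtain ⟨o, ho⟩ := Finsupp.ne_iff.mp hm
      obtain ⟨r', hr'⟩ := hder o
      have hle : Finsupp.single o 1 ≤ m := by
        rw [Finsupp.single_le_iff]
        exact Nat.one_le_iff_ne_zero.mpr ho
      have h1 := congr_arg (coeff (m - Finsupp.single o 1)) hr'
      rw [coeff_pderiv, tsub_add_cancel_of_le hle, coeff_map] at h1
      generalize ((m - Finsupp.single o 1 : Option σ →₀ ℕ) o : ℕ) = b at h1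
      refine ⟨C ((b : k) + 1)⁻¹ * coeff (m - Finsupp.single o 1) r', ?_⟩
      have hb : (b : E) + 1 ≠ 0 := Nat.cast_add_one_ne_zero b
      rw [map_mul, ← h1]
      have : ε (C ((b : k) + 1)⁻¹) = ((b : E) + 1)⁻¹ := by
        simp [ε]
      rw [this]
      field_simp
    obtain ⟨r', hr'⟩ := lift (q - C (coeff 0 q)) fun m ↦ by
      rcases eq_or_ne m 0 with rfl | hm
      · exact ⟨0, by simp⟩
      · obtain ⟨p, hp⟩ := hcoeff m hm
        exact ⟨p, by rw [coeff_sub, coeff_C, if_neg hm.symm, sub_zero, hp]⟩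
    have hnil : IsLineNilpotent D (C (coeff 0 q)) := by
      have h1 := hq.add (isLineNilpotent_map hD r').neg
      have h2 : q + -(map (aeval (fun j ↦ t (some j)) : MvPolynomial σ k →ₐ[k] E).toRingHom r') =
          C (coeff 0 q) := by
        rw [← sub_eq_add_neg, sub_eq_iff_eq_add, ← sub_eq_iff_eq_add']
        exact hr'
      rwa [h2] at h1
    obtain ⟨N, hN⟩ := hnil
    obtain ⟨p, hp⟩ := mem_range_of_iterate_C hD h hf N _ hN
    refine lift q fun m ↦ ?_
    rcases eq_or_ne m 0 with rfl | hm
    · exact ⟨p, hp⟩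
    · exact hcoeff m hm

end Polynomiality

/-! ### A special family of planes and its parametrization by the hypersurface -/

section GraphSection

variable (k : Type*) [Field k] (σ : Type*)

/-- Restriction of polynomials to the plane `T = x`, `T_i = v_i y + w_i`. -/
noncomputable def graphSection :
    MvPolynomial (Option σ) k →+* MvPolynomial (Fin 2) (MvPolynomial (σ ⊕ σ) k) :=
  eval₂Hom (C.comp C) fun o ↦ o.elim (X 0) fun i ↦ C (X (.inl i)) * X 1 + C (X (.inr i))

@[simp]
lemma graphSection_C (a : k) : graphSection k σ (C a) = C (C a) := by
  simp [graphSection]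

@[simp]
lemma graphSection_X_none : graphSection k σ (X none) = X 0 := by
  simp [graphSection]

@[simp]
lemma graphSection_X_some (i : σ) :
    graphSection k σ (X (some i)) = C (X (.inl i)) * X 1 + C (X (.inr i)) := by
  simp [graphSection]

lemma pderiv_zero_graphSection (p : MvPolynomial (Option σ) k) :
    pderiv 0 (graphSection k σ p) = graphSection k σ (pderiv none p) := by
  classical
  induction p using MvPolynomial.induction_on with
  | C a => simp
  | add p q hp hq => simp [hp, hq]
  | mul_X p o hp =>
    rw [map_mul, pderiv_mul, hp, pderiv_mul, map_add, map_mul, map_mul]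
    rcases o with _ | i
    · simp
    · simp [pderiv_X]

/-- The substitution exhibiting the polynomials in `x, y, v_i, w_i` as polynomials in `y, v_i` over
the polynomials in the coordinates. -/
noncomputable def ofCoordinates :
    MvPolynomial (Option σ) (MvPolynomial (Option σ) k) →+*
      MvPolynomial (Fin 2) (MvPolynomial (σ ⊕ σ) k) :=
  eval₂Hom (graphSection k σ) fun o ↦ o.elim (X 1) fun i ↦ C (X (.inl i))

/-- The inverse substitution of `ofCoordinates`. -/
noncomputable def toCoordinates :
    MvPolynomial (Fin 2) (MvPolynomial (σ ⊕ σ) k) →+*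
      MvPolynomial (Option σ) (MvPolynomial (Option σ) k) :=
  eval₂Hom (eval₂Hom (C.comp C) (Sum.elim (fun i ↦ X (some i))
    fun i ↦ C (X (some i)) - X (some i) * X none)) ![C (X none), X none]

lemma ofCoordinates_toCoordinates (p : MvPolynomial (Fin 2) (MvPolynomial (σ ⊕ σ) k)) :
    ofCoordinates k σ (toCoordinates k σ p) = p := by
  have : (ofCoordinates k σ).comp (toCoordinates k σ) = RingHom.id _ := by
    refine MvPolynomial.ringHom_ext' (MvPolynomial.ringHom_ext ?_ ?_) ?_
    · intro a
      simp [ofCoordinates, toCoordinates]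
    · rintro (i | i)
      · simp [ofCoordinates, toCoordinates]
      · simp [ofCoordinates, toCoordinates]
    · intro i
      fin_cases i <;> simp [ofCoordinates, toCoordinates]
  exact RingHom.congr_fun this p

lemma pderiv_zero_ofCoordinates_map (q : MvPolynomial (Option σ) (MvPolynomial σ k)) :
    pderiv 0 (ofCoordinates k σ (map (rename some : MvPolynomial σ k →ₐ[k] _).toRingHom q)) = 0 := by
  induction q using MvPolynomial.induction_on with
  | C p =>
    simp only [ofCoordinates, map_C, coe_eval₂Hom, eval₂_C]
    rw [pderiv_zero_graphSection]
    refine (congr_arg _ (pderiv_eq_zero_of_notMem_vars fun hmem ↦ ?_)).trans (map_zero _)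
    classical
    obtain ⟨x, -, hx⟩ := Finset.mem_image.mp (vars_rename _ _ hmem)
    exact Option.some_ne_none x hx
  | add p q hp hq => rw [map_add, map_add, map_add, hp, hq, add_zero]
  | mul_X p o hp =>
    rw [map_mul, map_mul, pderiv_mul, hp, zero_mul, zero_add]
    rcases o with _ | i <;> simp [ofCoordinates]

variable {σ} {k} in
lemma exists_coeff_graphSection_ne_zero {f : MvPolynomial (Option σ) k} {d : ℕ}
    (hf : f.IsHomogeneous d) (h0 : f ≠ 0) : ∃ m, m.degree = d ∧ coeff m (graphSection k σ f) ≠ 0 := by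
  -- Specializing w = 0 makes every coordinate linear in x, y, so the section becomes homogeneous of
  -- degree d in them. Putting y = 1 and v_i = T_i then recovers f, so this specialization is
  -- nonzero.
  let α : MvPolynomial (σ ⊕ σ) k →+* MvPolynomial σ k :=
    eval₂Hom C (Sum.elim X 0)
  let β : MvPolynomial (Fin 2) (MvPolynomial σ k) →+* MvPolynomial (Option σ) k :=
    eval₂Hom (rename some : MvPolynomial σ k →ₐ[k] _).toRingHom ![X none, 1]
  have h1 : β (map α (graphSection k σ f)) = f := by
    have : (β.comp (map α)).comp (graphSection k σ) = RingHom.id _ := by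
      refine MvPolynomial.ringHom_ext ?_ ?_
      · intro a
        simp [α, β]
      · rintro (_ | i) <;> simp [α, β]
    exact RingHom.congr_fun this f
  have h2 : map α (graphSection k σ f) =
      eval₂ (C.comp C) (fun o ↦ o.elim (X 0) fun i ↦ C (X i) * X 1) f := by
    have : (map α).comp (graphSection k σ) =
        eval₂Hom (C.comp C) (fun o ↦ o.elim (X 0) fun i ↦ C (X i) * X 1) := by
      refine MvPolynomial.ringHom_ext ?_ ?_
      · intro a
        simp [α]
      · rintro (_ | i) <;> simp [α]
    exact RingHom.congr_fun this f
  have h3 : (map α (graphSection k σ f)).IsHomogeneous (1 * d) := by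
    rw [h2]
    refine hf.eval₂ _ _ (fun r ↦ isHomogeneous_C _ _) ?_
    rintro (_ | i)
    · exact isHomogeneous_X _ _
    · exact (isHomogeneous_X _ _).C_mul _
  have h4 : map α (graphSection k σ f) ≠ 0 := fun h ↦ h0 (by rw [← h1, h, map_zero])
  obtain ⟨m, hm⟩ := ne_zero_iff.mp h4
  have h5 := h3 hm
  refine ⟨m, ?_, fun h ↦ hm (by rw [coeff_map, h, map_zero])⟩
  rw [Finsupp.degree_eq_weight_one]
  exact h5.trans (one_mul d)

end GraphSection

section Parametrization

variable {k E : Type*} [Field k] [Field E] [Algebra k E] {σ : Type*} (t : Option σ → E)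

/-- The substitution `x = t`, `w_i = t_i - v_i y`, which kills the restriction of the defining
polynomial of `t`. -/
noncomputable def parametrization :
    MvPolynomial (Fin 2) (MvPolynomial (σ ⊕ σ) k) →+* MvPolynomial (Option σ) E :=
  eval₂Hom (eval₂Hom (C.comp (algebraMap k E)) (Sum.elim (fun i ↦ X (some i))
    fun i ↦ C (t (some i)) - X (some i) * X none)) ![C (t none), X none]

lemma parametrization_eq (p : MvPolynomial (Fin 2) (MvPolynomial (σ ⊕ σ) k)) :
    parametrization t p = map (aeval t : MvPolynomial (Option σ) k →ₐ[k] E).toRingHom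
      (toCoordinates k σ p) := by
  have : parametrization t = (map (aeval t : MvPolynomial (Option σ) k →ₐ[k] E).toRingHom).comp
      (toCoordinates k σ) := by
    refine MvPolynomial.ringHom_ext' (MvPolynomial.ringHom_ext ?_ ?_) ?_
    · intro a
      simp [parametrization, toCoordinates]
    · rintro (i | i) <;> simp [parametrization, toCoordinates]
    · intro i
      fin_cases i <;> simp [parametrization, toCoordinates]
  exact RingHom.congr_fun this p

lemma parametrization_graphSection (p : MvPolynomial (Option σ) k) :
    parametrization t (graphSection k σ p) = C (aeval t p) := by
  have : (parametrization t).comp (graphSection k σ) =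
      C.comp (aeval t : MvPolynomial (Option σ) k →ₐ[k] E).toRingHom := by
    refine MvPolynomial.ringHom_ext ?_ ?_
    · intro a
      simp [parametrization]
    · rintro (_ | i) <;> simp [parametrization]
  exact RingHom.congr_fun this p

lemma parametrization_ofCoordinates_map (q : MvPolynomial (Option σ) (MvPolynomial σ k)) :
    parametrization t (ofCoordinates k σ
      (map (rename some : MvPolynomial σ k →ₐ[k] _).toRingHom q)) =
      map (aeval (fun j ↦ t (some j)) : MvPolynomial σ k →ₐ[k] E).toRingHom q := by
  have : ((parametrization t).comp (ofCoordinates k σ)).comp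
      (map (rename some : MvPolynomial σ k →ₐ[k] _).toRingHom) =
      map (aeval (fun j ↦ t (some j)) : MvPolynomial σ k →ₐ[k] E).toRingHom := by
    refine MvPolynomial.ringHom_ext ?_ ?_
    · intro p
      simp [ofCoordinates, parametrization_graphSection, aeval_rename, Function.comp_def]
    · rintro (_ | i) <;> simp [ofCoordinates, parametrization]
  exact RingHom.congr_fun this q

/-- In the coordinates T, y, v the plane section of f is f itself as a constant coefficient, and the
parametrization just reduces coefficients modulo f. Its kernel is thus generated by the section. -/
lemma IsFunctionField.graphSection_dvd {t : Option σ → E} {f : MvPolynomial (Option σ) k}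
    (h : IsFunctionField f t) {p : MvPolynomial (Fin 2) (MvPolynomial (σ ⊕ σ) k)}
    (hp : parametrization t p = 0) : graphSection k σ f ∣ p := by
  rw [parametrization_eq] at hp
  have h1 : C f ∣ toCoordinates k σ p := by
    rw [C_dvd_iff_dvd_coeff]
    intro m
    rw [← h.aeval_eq_zero_iff]
    have := congr_arg (coeff m) hp
    rwa [coeff_map, coeff_zero] at this
  have h2 := map_dvd (ofCoordinates k σ) h1
  rw [ofCoordinates_toCoordinates] at h2
  simpa [ofCoordinates] using h2

variable {t} [Fintype σ] [DecidableEq σ] {D : σ → Derivation k E E}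
  (hD : ∀ i j, D i (t (some j)) = if i = j then 1 else 0)

-- The chain rule: the line derivation kills v_i and w_i = t_i - v_i y and sends y to 1, so only the
-- x and y dependence of p contributes.
include hD in
lemma lineDerivation_parametrization (p : MvPolynomial (Fin 2) (MvPolynomial (σ ⊕ σ) k)) :
    lineDerivation D (parametrization t p) =
      parametrization t (pderiv 0 p) * lineDerivation D (C (t none)) +
        parametrization t (pderiv 1 p) := by
  induction p using MvPolynomial.induction_on with
  | C a =>
    rw [pderiv_C, pderiv_C, map_zero, zero_mul, zero_add]
    induction a using MvPolynomial.induction_on with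
    | C a =>
      simp [parametrization, lineDerivation_C]
    | add p q hp hq =>
      rw [map_add, map_add, map_add, hp, hq, add_zero]
    | mul_X p i hp =>
      rw [map_mul, map_mul, Derivation.leibniz, hp, smul_zero, add_zero]
      rcases i with i | i
      · simp [parametrization, lineDerivation_X_some]
      · simp [parametrization, lineDerivation_X_some, lineDerivation_C, hD,
          lineDerivation_X_none]
  | add p q hp hq =>
    rw [map_add, map_add, map_add, map_add, map_add, map_add, hp, hq]
    ring
  | mul_X p i hp =>
    rw [map_mul, Derivation.leibniz, hp, pderiv_mul, pderiv_mul]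
    simp only [map_add, map_mul, smul_eq_mul]
    fin_cases i
    · simp [parametrization]
      ring
    · simp [parametrization, lineDerivation_X_none]
      ring

end Parametrization

/-! ### Nonvanishing of a minor for irreducible forms in characteristic zero -/

section ClosedForms

variable {k : Type*} [Field k] [CharZero k] [IsAlgClosed k] {σ : Type*} [Fintype σ]

/-- Along F = 0 closedness gives ω = c dF, where c is the residue of ω / F. The residue is constant
along the curves, hence comes from a polynomial in y, v, w, and then from a constant a in x, y.
Degree reasons upgrade ω ≡ a dF modulo F to equality. -/
lemma closedDefect_graphSection_eq_zero {E : Type*} [Field E] [Algebra k E] {t : Option σ → E}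
    {f : MvPolynomial (Option σ) k} {d : ℕ} (hE : IsFunctionField f t)
    (hf : f.IsHomogeneous d) (h0 : f ≠ 0) (hder : pderiv none f ≠ 0) (hd : 1 ≤ d)
    {g h : MvPolynomial (Fin 2) (MvPolynomial (σ ⊕ σ) k)}
    (hg : g.totalDegree ≤ d - 1) (hh : h.totalDegree ≤ d - 1)
    (hgh : (X 0 * g + X 1 * h).totalDegree ≤ d - 1)
    (hdef : closedDefect (graphSection k σ f) g h = 0) : g = 0 ∧ h = 0 := by
  classical
  obtain ⟨D, hD⟩ := hE.exists_partials hder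
  set F := graphSection k σ f with hF
  obtain ⟨m, hm, hmF⟩ := exists_coeff_graphSection_ne_zero hf h0
  have hdF : d ≤ F.totalDegree := by
    have := le_totalDegree (mem_support_iff.mpr hmF)
    change m.degree ≤ F.totalDegree at this
    omega
  have hs0 : aeval t (pderiv none f) ≠ 0 := hE.aeval_pderiv_ne_zero hder
  set s0 := aeval t (pderiv none f)
  let ψ := parametrization (k := k) t
  let D0 := lineDerivation D
  let ξ := D0 (C (t none))
  have hψF : ψ F = 0 := by
    rw [hF, parametrization_graphSection, (hE.aeval_eq_zero_iff f).mpr dvd_rfl, C_0]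
  have hψFx : ψ (pderiv 0 F) = C s0 := by
    rw [hF, pderiv_zero_graphSection, parametrization_graphSection]
  have hFx : pderiv 0 F ≠ 0 := fun h ↦ by
    rw [h, map_zero] at hψFx
    exact hs0 (C_eq_zero.mp hψFx.symm)
  have hS : (C s0 : MvPolynomial (Option σ) E) ≠ 0 := C_eq_zero.not.mpr hs0
  have hchain (p) : D0 (ψ p) = ψ (pderiv 0 p) * ξ + ψ (pderiv 1 p) :=
    lineDerivation_parametrization hD p
  have e0 : C s0 * ξ + ψ (pderiv 1 F) = 0 := by
    rw [← hψFx, ← hchain, hψF, map_zero]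
  have e1 : ψ g * ψ (pderiv 1 F) = ψ h * C s0 := by
    have := congr_arg ψ hdef
    simp only [closedDefect, map_sub, map_mul, hψF, hψFx, map_zero, zero_mul, zero_sub,
      neg_eq_zero, sub_eq_zero] at this
    exact this
  have e2 : C s0 * ψ (pderiv 1 g) - ψ (pderiv 0 g) * ψ (pderiv 1 F) -
      ψ g * ψ (pderiv 1 (pderiv 0 F)) + ψ h * ψ (pderiv 0 (pderiv 0 F)) = 0 := by
    have := congr_arg (fun p ↦ ψ (pderiv 0 p)) hdef
    simp only [closedDefect, map_sub, map_add, map_mul, pderiv_mul, hψF, hψFx, map_zero, zero_mul,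
      add_zero] at this
    linear_combination this + ψ g * congr_arg ψ (pderiv_comm 0 1 F)
  let c : MvPolynomial (Option σ) E := C s0⁻¹ * ψ g
  have hc : ψ g = C s0 * c := by
    rw [← mul_assoc, ← C_mul, mul_inv_cancel₀ hs0, C_1, one_mul]
  have e3 : ψ h + ψ g * ξ = 0 := by
    refine (mul_eq_zero.mp ?_).resolve_left hS
    linear_combination ψ g * e0 - e1
  -- The residue is constant along the curve: this combines the x-derivative of the closedness
  -- equation (`e2`), the slope ξ = -F_y / F_x (`e0`) and the proportionality of ω to dF (`e3`).
  have e4 : D0 c = 0 := by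
    have h1 := congr_arg D0 hc
    rw [Derivation.leibniz, smul_eq_mul, smul_eq_mul, hchain, ← hψFx, hchain, hψFx] at h1
    have h2 : C s0 * (C s0 * (C s0 * D0 c)) = 0 := by
      linear_combination (-C s0 * C s0) * h1 + (C s0 * ψ (pderiv 0 g)) * e0 + C s0 * e2 -
        C s0 * ψ (pderiv 0 (pderiv 0 F)) * e3 + C s0 * (ψ (pderiv 0 (pderiv 0 F)) * ξ +
          ψ (pderiv 1 (pderiv 0 F))) * hc
    exact (mul_eq_zero.mp ((mul_eq_zero.mp ((mul_eq_zero.mp h2).resolve_left hS)).resolve_left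
      hS)).resolve_left hS
  obtain ⟨q, hq⟩ := IsLineNilpotent.exists_map_eq hD hE hder (q := c) ⟨1, e4⟩
  rw [← parametrization_ofCoordinates_map t q] at hq
  have hq0 := pderiv_zero_ofCoordinates_map k σ q
  set p := ofCoordinates k σ (map (rename some : MvPolynomial σ k →ₐ[k] _).toRingHom q)
  -- Since p does not involve x, constancy of the residue says that F divides ∂p/∂y. This is free of
  -- x, whereas F is not, so it must be zero.
  have hp1 : pderiv 1 p = 0 := by
    by_contra hne
    have h1 : ψ (pderiv 1 p) = 0 := by
      have := hchain p
      rwa [hq0, map_zero, zero_mul, zero_add, ← hq, e4, eq_comm] at this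
    refine hFx (pderiv_eq_zero_of_dvd (hE.graphSection_dvd h1) hne ?_)
    rw [pderiv_comm, hq0, map_zero]
  obtain ⟨a, ha⟩ : ∃ a, p = C a := by
    refine ⟨_, eq_C_of_pderiv_eq_zero fun i ↦ ?_⟩
    fin_cases i
    · exact hq0
    · exact hp1
  rw [ha] at hq
  have hdeg (i : Fin 2) : (C a * pderiv i F).totalDegree < F.totalDegree := by
    refine (totalDegree_mul _ _).trans_lt ?_
    rw [totalDegree_C, zero_add]
    by_cases h : pderiv i F = 0
    · rw [h, totalDegree_zero]
      omega
    · exact totalDegree_pderiv_lt h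
  have hgeq : g = C a * pderiv 0 F := by
    rw [← sub_eq_zero]
    by_contra hne
    refine not_dvd_of_totalDegree_lt hne ?_ (hE.graphSection_dvd ?_)
    · exact (totalDegree_sub _ _).trans_lt (max_lt (show _ < F.totalDegree by omega) (hdeg 0))
    · change ψ _ = 0
      rw [map_sub, map_mul, hψFx, hc, hq, mul_comm]
      exact sub_self _
  have hheq : h = C a * pderiv 1 F := by
    rw [← sub_eq_zero]
    by_contra hne
    refine not_dvd_of_totalDegree_lt hne ?_ (hE.graphSection_dvd ?_)
    · exact (totalDegree_sub _ _).trans_lt (max_lt (show _ < F.totalDegree by omega) (hdeg 1))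
    · change ψ _ = 0
      refine (mul_eq_zero.mp ?_).resolve_left hS
      rw [map_sub, map_mul]
      have hq' : c = ψ (C a) := hq
      linear_combination -e1 + ψ (pderiv 1 F) * hc + ψ (pderiv 1 F) * C s0 * hq'
  -- For ω = a dF the degree d part of x g + y h is d · a times that of F, which is nonzero unless a
  -- = 0. This is where the trace condition excludes the trivial solution dF.
  have ha0 : a = 0 := by
    by_contra hne
    have h1 : X 0 * g + X 1 * h = C a * ∑ i, X i * pderiv i F := by
      rw [hgeq, hheq, Fin.sum_univ_two]
      ring
    have h2 := coeff_eq_zero_of_totalDegree_lt (hgh.trans_lt (?_ : d - 1 < ∑ i ∈ m.support, m i))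
    · rw [h1, coeff_C_mul, coeff_sum_X_mul_pderiv, hm] at h2
      refine mul_ne_zero hne (mul_ne_zero ?_ hmF) h2
      exact Nat.cast_ne_zero.mpr (by omega)
    · change _ < m.degree
      omega
  rw [hgeq, hheq, ha0]
  simp

end ClosedForms

/-- Over the fraction field the rows span: a functional killing them all would, after clearing
denominators, be a kernel vector. A basis can therefore be chosen among the rows, even though there
are infinitely many. -/
lemma exists_det_submatrix_ne_zero {A m ι : Type*} [CommRing A] [IsDomain A] [Fintype ι]
    [DecidableEq ι] (M : Matrix m ι A)
    (hM : ∀ c : ι → A, (∀ r, ∑ s, M r s * c s = 0) → c = 0) :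
    ∃ ρ : ι → m, (M.submatrix ρ id).det ≠ 0 := by
  let K := FractionRing A
  let φ : A →+* K := algebraMap A K
  have hφ : Function.Injective φ := IsFractionRing.injective A K
  let N : m → ι → K := fun r s ↦ φ (M r s)
  have hspan : Submodule.span K (Set.range N) = ⊤ := by
    by_contra hne
    obtain ⟨l, hl0, hl⟩ := Submodule.exists_le_ker_of_lt_top _ (lt_top_iff_ne_top.mpr hne)
    obtain ⟨b, hb⟩ := IsLocalization.exist_integer_multiples_of_finite (nonZeroDivisors A)
      fun s ↦ l (Pi.single s 1)
    choose c hc using hb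
    have hb0 : φ b ≠ 0 := IsLocalization.to_map_ne_zero_of_mem_nonZeroDivisors K le_rfl b.2
    have hc' (s : ι) : φ (c s) = φ b * l (Pi.single s 1) := by
      rw [hc, Algebra.smul_def]
    have hc0 : c = 0 := hM c fun r ↦ by
      apply hφ
      have h1 : l (N r) = 0 := hl (Submodule.subset_span ⟨r, rfl⟩)
      rw [LinearMap.pi_apply_eq_sum_univ] at h1
      rw [map_zero, map_sum, ← mul_zero (φ b), ← h1, Finset.mul_sum]
      refine Finset.sum_congr rfl fun s _ ↦ ?_
      have hs : (fun j ↦ if s = j then (1 : K) else 0) = Pi.single s 1 := by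
        ext j
        simp [Pi.single_apply, eq_comm]
      rw [map_mul, hc', smul_eq_mul, hs]
      ring
    apply hl0
    refine LinearMap.pi_ext' fun s ↦ LinearMap.ext_ring ?_
    have := hc' s
    rw [hc0, Pi.zero_apply, map_zero, eq_comm, mul_eq_zero] at this
    simpa using this.resolve_left hb0
  obtain ⟨b, hbsub, hbspan, hbli⟩ := exists_linearIndependent K (Set.range N)
  have B := Module.Basis.mk hbli (by rw [Subtype.range_coe, hbspan, hspan])
  let e : ι ≃ b := (Pi.basisFun K ι).indexEquiv B
  choose ρ hρ using fun i ↦ hbsub (e i).2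
  refine ⟨ρ, fun h0 ↦ ?_⟩
  have h1 : LinearIndependent K ((M.submatrix ρ id).map φ).row := by
    have : ((M.submatrix ρ id).map φ).row = fun i ↦ (e i : ι → K) := by
      ext i s
      rw [← hρ]
      rfl
    rw [this]
    exact hbli.comp e e.injective
  have h2 := Matrix.linearIndependent_rows_iff_isUnit.mp h1
  rw [Matrix.isUnit_iff_isUnit_det] at h2
  apply h2.ne_zero
  change (φ.mapMatrix (M.submatrix ρ id)).det = 0
  rw [← RingHom.map_det, h0, map_zero]

section Transport

variable {R : Type*} [CommRing R] {τ τ' : Type*}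

lemma det_submatrix_map_ne_zero {S : Type*} [CommRing S] {d : ℕ} (φ : R →+* S)
    {f : MvPolynomial (Fin 2) R} {ρ : FormIndex d → (Fin 2 →₀ ℕ)}
    (h : ((ruppertMatrix d (map φ f)).submatrix ρ id).det ≠ 0) :
    ((ruppertMatrix d f).submatrix ρ id).det ≠ 0 := by
  intro h0
  apply h
  rw [ruppertMatrix_map]
  change (φ.mapMatrix ((ruppertMatrix d f).submatrix ρ id)).det = 0
  rw [← RingHom.map_det, h0, map_zero]

lemma genericSection_rename (e : τ → τ') (f : MvPolynomial τ R) :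
    genericSection R τ' (rename e f) =
      map (rename (Prod.map e id) : MvPolynomial (τ × Fin 3) R →ₐ[R] _).toRingHom
        (genericSection R τ f) := by
  induction f using MvPolynomial.induction_on with
  | C a => simp
  | add p q hp hq => simp [hp, hq]
  | mul_X p t hp => simp [hp, genericLine]

/-- The planes T = x, T_i = v_i y + w_i specialize the generic plane, so a minor nonzero on them is
nonzero generically. -/
lemma graphSection_eq_map_genericSection {k σ : Type*} [Field k] (f : MvPolynomial (Option σ) k) :
    ∃ φ : MvPolynomial (Option σ × Fin 3) k →+* MvPolynomial (σ ⊕ σ) k,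
      graphSection k σ f = map φ (genericSection k (Option σ) f) := by
  refine ⟨eval₂Hom C fun p ↦ p.1.elim (![1, 0, 0] p.2) fun i ↦
    (![0, X (.inl i), X (.inr i)] : Fin 3 → MvPolynomial (σ ⊕ σ) k) p.2, ?_⟩
  induction f using MvPolynomial.induction_on with
  | C a => simp
  | add p q hp hq => simp [hp, hq]
  | mul_X p t hp => rcases t with _ | i <;> simp [hp, genericLine]

end Transport

lemma exists_det_ne_zero_of_pderiv_none_ne_zero {k : Type u} [Field k] [CharZero k] [IsAlgClosed k]
    {σ : Type v} [Fintype σ] {f : MvPolynomial (Option σ) k} {d : ℕ} (hd : 1 ≤ d)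
    (hf : Irreducible f) (hfd : f.IsHomogeneous d) (hder : pderiv none f ≠ 0) :
    ∃ ρ : FormIndex d → (Fin 2 →₀ ℕ),
      ((ruppertMatrix d (genericSection k (Option σ) f)).submatrix ρ id).det ≠ 0 := by
  obtain ⟨E, _, _, t, hE⟩ := exists_isFunctionField hf
  obtain ⟨φ, hφ⟩ := graphSection_eq_map_genericSection f
  obtain ⟨ρ, hρ⟩ := exists_det_submatrix_ne_zero (ruppertMatrix d (graphSection k σ f))
    fun c hc ↦ by
      have h := closedDefect_graphSection_eq_zero hE hfd hf.ne_zero hder hd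
        (totalDegree_sum_formX_le c) (totalDegree_sum_formY_le c)
        (totalDegree_trace_sum_forms_le c) (by
          refine MvPolynomial.ext _ _ fun m ↦ ?_
          rw [← ruppertMatrix_mulVec, hc, coeff_zero])
      exact forms_linearIndependent h.1 h.2
  rw [hφ] at hρ
  exact ⟨ρ, det_submatrix_map_ne_zero φ hρ⟩

/-- An irreducible form over an algebraically closed field of characteristic zero has a non-zero
Ruppert minor. -/
theorem exists_ruppertMinor_ne_zero {k : Type u} [Field k] [CharZero k] [IsAlgClosed k]
    {τ : Type v} [Fintype τ] {f : MvPolynomial τ k} {d : ℕ} (hd : 1 ≤ d)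
    (hf : Irreducible f) (hfd : f.IsHomogeneous d) :
    ∃ (ρ : FormIndex d → (Fin 2 →₀ ℕ)) (μ : (τ × Fin 3) →₀ ℕ), ruppertMinor d ρ μ f ≠ 0 := by
  classical
  obtain ⟨i, hi⟩ := exists_pderiv_ne_zero_of_irreducible hf hfd
  let e : τ ≃ Option {j // j ≠ i} := (Equiv.optionSubtypeNe i).symm
  have hei : e i = none := by simp [e]
  obtain ⟨ρ, hρ⟩ := exists_det_ne_zero_of_pderiv_none_ne_zero (f := rename e f) hd
    ((MulEquiv.irreducible_iff (renameEquiv k e)).mpr hf) (hfd.rename_isHomogeneous) (by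
      rw [← hei, pderiv_rename e.injective]
      exact (map_ne_zero_iff _ (rename_injective _ e.injective)).mpr hi)
  rw [genericSection_rename] at hρ
  obtain ⟨μ, hμ⟩ := ne_zero_iff.mp (det_submatrix_map_ne_zero _ hρ)
  exact ⟨ρ, μ, hμ⟩

end Ruppert

namespace Ruppert

open MvPolynomial NumberField IsDedekindDomain

/-! ### Local estimates at the places of the number field -/

section FinitePlaces

variable {K : Type*} [Field K] [NumberField K]

lemma finitePlace_algebraMap_le_one (w : FinitePlace K) (x : 𝓞 K) : w (algebraMap (𝓞 K) K x) ≤ 1 := by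
  rw [← FinitePlace.norm_embedding_eq]
  exact FinitePlace.norm_le_one K _ x

lemma finitePlace_algebraMap_eq_one_iff (w : FinitePlace K) (x : 𝓞 K) :
    w (algebraMap (𝓞 K) K x) = 1 ↔ x ∉ w.maximalIdeal.asIdeal := by
  rw [← FinitePlace.norm_embedding_eq]
  exact FinitePlace.norm_eq_one_iff_notMem K _ x

lemma finitePlace_le_one_iff (w : FinitePlace K) (x : K) :
    w x ≤ 1 ↔ w.maximalIdeal.valuation K x ≤ 1 := by
  rw [← FinitePlace.norm_embedding_eq, FinitePlace.norm_embedding]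
  rw [HeightOneSpectrum.adicAbv_def, ← NNReal.coe_one, NNReal.coe_le_coe]
  exact WithZeroMulInt.toNNReal_le_one_iff (HeightOneSpectrum.one_lt_absNorm_nnreal _)

/-- An element of the prime has valuation at least one. This is the source of the gain log N(𝔭) at a
bad prime. -/
lemma finitePlace_mul_absNorm_le_one (w : FinitePlace K) {x : 𝓞 K}
    (hx : x ∈ w.maximalIdeal.asIdeal) :
    w (algebraMap (𝓞 K) K x) * Ideal.absNorm w.maximalIdeal.asIdeal ≤ 1 := by
  rcases eq_or_ne x 0 with rfl | h0
  · simp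
  rw [← HeightOneSpectrum.embedding_mul_absNorm K w.maximalIdeal h0, FinitePlace.norm_embedding_eq]
  gcongr
  have hspan : Ideal.span {x} ≠ 0 := by simpa using h0
  refine Nat.le_of_dvd (Nat.pos_of_ne_zero ?_) (map_dvd Ideal.absNorm (dvd_pow_self _ ?_))
  · rw [HeightOneSpectrum.maxPowDividing, map_pow]
    exact pow_ne_zero _ (zero_lt_one.trans (HeightOneSpectrum.one_lt_absNorm _)).ne'
  · rw [Associates.count_ne_zero_iff_dvd hspan w.maximalIdeal.irreducible, Ideal.dvd_span_singleton]
    exact hx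

lemma exists_notMem_forall_mul_eq (w : FinitePlace K) {ι : Type*} (s : Finset ι) (x : ι → K)
    (hx : ∀ i ∈ s, w (x i) ≤ 1) :
    ∃ b : 𝓞 K, b ∉ w.maximalIdeal.asIdeal ∧
      ∀ i ∈ s, ∃ a : 𝓞 K, algebraMap (𝓞 K) K b * x i = algebraMap (𝓞 K) K a := by
  classical
  induction s using Finset.induction_on with
  | empty =>
    exact ⟨1, w.maximalIdeal.asIdeal.ne_top_iff_one.mp w.maximalIdeal.isPrime.ne_top, by simp⟩
  | insert j s hj ih =>
    obtain ⟨b, hb, h⟩ := ih fun i hi ↦ hx i (Finset.mem_insert_of_mem hi)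
    obtain ⟨a, c, hac⟩ := w.maximalIdeal.exists_primeCompl_mul_eq_of_integer (x j)
      ((finitePlace_le_one_iff w _).mp (hx j (Finset.mem_insert_self _ _)))
    refine ⟨b * c, w.maximalIdeal.asIdeal.primeCompl.mul_mem hb c.2, fun i hi ↦ ?_⟩
    rcases Finset.mem_insert.mp hi with rfl | hi
    · exact ⟨b * a, by rw [map_mul, map_mul, ← hac]; ring⟩
    · obtain ⟨a', ha'⟩ := h i hi
      exact ⟨a' * c, by rw [map_mul, map_mul, ← ha']; ring⟩

/-- A polynomial over a number field has a multiple with integral coefficients which is primitive at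
a given finite place. -/
lemma exists_primitive_multiple (w : FinitePlace K) {τ : Type*} {f : MvPolynomial τ K}
    (h0 : f ≠ 0) :
    ∃ (c : K) (φ : MvPolynomial τ (𝓞 K)), c ≠ 0 ∧ map (algebraMap (𝓞 K) K) φ = C c * f ∧
      w c * (⨆ m : f.support, w (coeff m.1 f)) = 1 ∧
      ∃ m, coeff m φ ∉ w.maximalIdeal.asIdeal := by
  classical
  have hne : Nonempty f.support := by
    obtain ⟨m, hm⟩ := ne_zero_iff.mp h0
    exact ⟨m, mem_support_iff.mpr hm⟩
  obtain ⟨m0, hm0⟩ := exists_eq_ciSup_of_finite (f := fun m : f.support ↦ w (coeff m.1 f))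
  have hle (m : f.support) : w (coeff m.1 f) ≤ w (coeff m0.1 f) := by
    rw [hm0]
    exact le_ciSup (Set.finite_range fun m : f.support ↦ w (coeff m.1 f)).bddAbove m
  have ha0 : coeff m0.1 f ≠ 0 := mem_support_iff.mp m0.2
  have hw0 : 0 < w (coeff m0.1 f) := FinitePlace.pos_iff.mpr ha0
  -- Dividing by a coefficient of maximal absolute value makes f integral and primitive at w; the
  -- remaining denominators are cleared by an integer b which is a unit at w.
  obtain ⟨b, hb, h⟩ := exists_notMem_forall_mul_eq w f.support (fun m ↦ coeff m f / coeff m0.1 f)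
    fun m hm ↦ by
      rw [map_div₀, div_le_one hw0]
      exact hle ⟨m, hm⟩
  have hb0 : algebraMap (𝓞 K) K b ≠ 0 := by
    rw [Ne, FaithfulSMul.algebraMap_eq_zero_iff]
    rintro rfl
    exact hb (zero_mem _)
  choose! a ha using h
  have hmap : map (algebraMap (𝓞 K) K) (∑ m ∈ f.support, monomial m (a m)) =
      C (algebraMap (𝓞 K) K b / coeff m0.1 f) * f := by
    rw [map_sum]
    trans ∑ m ∈ f.support, C (algebraMap (𝓞 K) K b / coeff m0.1 f) * monomial m (coeff m f)
    · refine Finset.sum_congr rfl fun m hm ↦ ?_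
      rw [map_monomial, C_mul_monomial, ← ha m hm]
      congr 1
      ring
    · rw [← Finset.mul_sum, ← f.as_sum]
  refine ⟨_, _, div_ne_zero hb0 ha0, hmap, ?_, m0.1, ?_⟩
  · rw [← hm0, ← map_mul, div_mul_cancel₀ _ ha0, finitePlace_algebraMap_eq_one_iff]
    exact hb
  · have h1 := congr_arg (coeff m0.1) hmap
    rw [coeff_map, coeff_C_mul, div_mul_cancel₀ _ ha0] at h1
    rw [FaithfulSMul.algebraMap_injective (𝓞 K) K h1]
    exact hb

end FinitePlaces

section LocalBounds

variable {K : Type*} [Field K] [NumberField K] {τ : Type*}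

/-- An absolute value as a ring seminorm. -/
def absoluteValueSeminorm {R : Type*} [CommRing R] [Nontrivial R] (v : AbsoluteValue R ℝ) :
    RingSeminorm R where
  toFun := v
  map_zero' := map_zero v
  neg' := v.map_neg
  add_le' := v.add_le
  mul_le' x y := (map_mul v x y).le

lemma card_support_le {R : Type*} [CommSemiring R] {n d : ℕ} {f : MvPolynomial (Fin (n + 1)) R}
    (hf : f.IsHomogeneous d) : f.support.card ≤ (n + d).choose d := by
  classical
  let e : f.support → Sym (Fin (n + 1)) d := fun m ↦ ⟨Finsupp.toMultiset m.1, by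
    rw [Finsupp.card_toMultiset]
    exact (DFunLike.congr_fun Finsupp.degree_eq_weight_one m.1).trans
      (hf (mem_support_iff.mp m.2))⟩
  have he : Function.Injective e := fun a b h ↦
    Subtype.ext ((Multiset.toFinsupp (α := Fin (n + 1))).symm.injective (congr_arg Subtype.val h))
  have := Fintype.card_le_of_injective e he
  rw [Sym.card_sym_eq_choose, Fintype.card_coe, Fintype.card_fin] at this
  rwa [show n + d = n + 1 + d - 1 by omega]

omit [NumberField K] in
lemma infinitePlace_ruppertMinor_le (v : InfinitePlace K) {n d : ℕ} (hd : 1 ≤ d)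
    {f : MvPolynomial (Fin (n + 1)) K} (hf : f.IsHomogeneous d)
    (ρ : FormIndex d → (Fin 2 →₀ ℕ)) (μ : (Fin (n + 1) × Fin 3) →₀ ℕ) :
    v (ruppertMinor d ρ μ f) ≤ (((d : ℝ) ^ 3 * 3 ^ d * (n + d).choose d) *
      ⨆ m : f.support, v (coeff m.1 f)) ^ (d ^ 2 - 1) := by
  have h := seminorm_ruppertMinor_le (absoluteValueSeminorm v.1) (map_one v.1).le hf ρ μ
  rw [card_formIndex hd] at h
  change v _ ≤ _ at h
  -- In degree 1 the exponent d^2 - 1 is zero and both sides are trivial; the comparison 4 d ≤ d^3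
  -- used below needs d ≥ 2.
  rcases hd.eq_or_lt with rfl | hd
  · simpa using h
  refine h.trans ?_
  have hsup : coeffSum (absoluteValueSeminorm v.1) f ≤
      (n + d).choose d * ⨆ m : f.support, v (coeff m.1 f) := by
    have h1 : coeffSum (absoluteValueSeminorm v.1) f ≤
        f.support.card • ⨆ m : f.support, v (coeff m.1 f) :=
      Finset.sum_le_card_nsmul _ _ _ fun m hm ↦
        le_ciSup (f := fun m : f.support ↦ v (coeff m.1 f)) (Set.finite_range _).bddAbove ⟨m, hm⟩
    refine h1.trans ?_
    rw [nsmul_eq_mul]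
    gcongr
    · exact Real.iSup_nonneg fun _ ↦ apply_nonneg _ _
    · exact card_support_le hf
  have h4 : 4 * (d : ℝ) ≤ (d : ℝ) ^ 3 := by
    have : (2 : ℝ) ≤ d := by exact_mod_cast hd
    nlinarith [mul_nonneg (sub_nonneg.mpr this) (by positivity : (0 : ℝ) ≤ d * (d + 2))]
  have hnn : 0 ≤ coeffSum (absoluteValueSeminorm v.1) f := apply_nonneg _ _
  have h5 : 4 * (d : ℝ) * (3 ^ d * coeffSum (absoluteValueSeminorm v.1) f) ≤
      (d : ℝ) ^ 3 * 3 ^ d * (n + d).choose d * ⨆ m : f.support, v (coeff m.1 f) := by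
    calc _ ≤ (d : ℝ) ^ 3 * (3 ^ d * ((n + d).choose d * ⨆ m : f.support, v (coeff m.1 f))) := by
          gcongr
      _ = _ := by ring
  gcongr

/-- The minor is homogeneous of degree d^2 - 1 in the polynomial, and the normalization makes w(c)
the inverse of the local height of f. -/
lemma finitePlace_ruppertMinor_eq (w : FinitePlace K) {d : ℕ} (hd : 1 ≤ d)
    {f : MvPolynomial τ K} {c : K} {φ : MvPolynomial τ (𝓞 K)}
    (hφ : map (algebraMap (𝓞 K) K) φ = C c * f)
    (hc : w c * (⨆ m : f.support, w (coeff m.1 f)) = 1)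
    (ρ : FormIndex d → (Fin 2 →₀ ℕ)) (μ : (τ × Fin 3) →₀ ℕ) :
    w (ruppertMinor d ρ μ f) = w (algebraMap (𝓞 K) K (ruppertMinor d ρ μ φ)) *
      (⨆ m : f.support, w (coeff m.1 f)) ^ (d ^ 2 - 1) := by
  rw [← ruppertMinor_map, hφ, ruppertMinor_C_mul, map_mul, map_pow, card_formIndex hd,
    mul_right_comm, ← mul_pow, hc, one_pow, one_mul]

end LocalBounds

/-! ### From local bounds to the height inequality -/

section ProductFormula

variable {K : Type*} [Field K] [NumberField K]

/-- If a non-zero `D` is bounded at all places by the `N`-th power of the local heights of `x`, up to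
a constant at the infinite places and with a gain at the primes in `B`, then `B` is finite and its
primes are bounded by the height of `x`. -/
lemma finite_and_sum_log_absNorm_le {ι : Type*} [Finite ι] [Nonempty ι] {x : ι → K}
    (hx : ∀ i, x i ≠ 0) {D : K} (hD : D ≠ 0) {N : ℕ} {c : ℝ} (hc : 0 < c)
    (B : Set (FinitePlace K)) (hinf : ∀ v : InfinitePlace K, v D ≤ (c * ⨆ i, v (x i)) ^ N)
    (hfin : ∀ w : FinitePlace K, w D ≤ (⨆ i, w (x i)) ^ N)
    (hB : ∀ w ∈ B, w D * Ideal.absNorm w.maximalIdeal.asIdeal ≤ (⨆ i, w (x i)) ^ N) :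
    B.Finite ∧ ∑ᶠ w ∈ B, Real.log (Ideal.absNorm w.maximalIdeal.asIdeal) ≤
      N * Real.log (Height.mulHeight x) + Module.finrank ℚ K * (N * Real.log c) := by
  classical
  have := Fintype.ofFinite ι
  have hsupp : (Function.mulSupport fun w : FinitePlace K ↦ ⨆ i, w (x i)).Finite := by
    refine (Set.finite_iUnion fun i ↦ FinitePlace.hasFiniteMulSupport (hx i)).subset fun w hw ↦ ?_
    by_contra hcon
    simp only [Set.mem_iUnion, Function.mem_mulSupport, not_exists, not_not] at hcon
    apply hw
    simp [hcon]
  have hsuppD := FinitePlace.hasFiniteMulSupport hD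
  -- At all but finitely many places both D and the local height have size 1, which leaves no room
  -- for a gain N(𝔭) > 1.
  have hBsub : B ⊆ (Function.mulSupport fun w : FinitePlace K ↦ ⨆ i, w (x i)) ∪
      Function.mulSupport fun w : FinitePlace K ↦ w D := by
    intro w hw
    by_contra hcon
    simp only [Set.mem_union, Function.mem_mulSupport, not_or, not_not] at hcon
    have h1 := hB w hw
    rw [hcon.1, hcon.2, one_mul, one_pow] at h1
    have h2 := HeightOneSpectrum.one_lt_absNorm w.maximalIdeal
    have h3 : (1 : ℝ) < Ideal.absNorm w.maximalIdeal.asIdeal := by exact_mod_cast h2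
    linarith
  have hBfin : B.Finite := (hsupp.union hsuppD).subset hBsub
  refine ⟨hBfin, ?_⟩
  let S : Finset (FinitePlace K) := (hsupp.union hsuppD).toFinset
  let b : FinitePlace K → ℝ := fun w ↦ if w ∈ B then Ideal.absNorm w.maximalIdeal.asIdeal else 1
  have hb (w) : 1 ≤ b w := by
    dsimp only [b]
    split_ifs
    · exact_mod_cast (HeightOneSpectrum.one_lt_absNorm w.maximalIdeal).le
    · exact le_rfl
  have hsum : ∑ᶠ w ∈ B, Real.log (Ideal.absNorm w.maximalIdeal.asIdeal) =
      Real.log (∏ w ∈ S, b w) := by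
    rw [Real.log_prod fun w _ ↦ (zero_lt_one.trans_le (hb w)).ne', finsum_mem_def,
      finsum_eq_sum_of_support_subset (s := S)]
    · refine Finset.sum_congr rfl fun w _ ↦ ?_
      by_cases hw : w ∈ B <;> simp [b, hw]
    · refine Set.support_indicator_subset.trans (hBsub.trans ?_)
      rw [Set.Finite.coe_toFinset]
  have hfinprod : ∏ᶠ w : FinitePlace K, w D = ∏ w ∈ S, w D :=
    finprod_eq_prod_of_mulSupport_subset _ (by simp [S])
  have hfinprod' : ∏ᶠ w : FinitePlace K, ⨆ i, w (x i) = ∏ w ∈ S, ⨆ i, w (x i) :=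
    finprod_eq_prod_of_mulSupport_subset _ (by simp [S])
  have hx0 : x ≠ 0 := fun h ↦ hx (Classical.arbitrary ι) (congr_fun h _)
  have hheight := NumberField.mulHeight_eq hx0
  have hprod := prod_abs_eq_one hD
  rw [hfinprod'] at hheight
  rw [hfinprod] at hprod
  have h1 : (∏ w ∈ S, w D) * ∏ w ∈ S, b w ≤ (∏ w ∈ S, ⨆ i, w (x i)) ^ N := by
    rw [← Finset.prod_mul_distrib, ← Finset.prod_pow]
    refine Finset.prod_le_prod (fun w _ ↦ mul_nonneg (apply_nonneg w D)
      (zero_le_one.trans (hb w))) fun w _ ↦ ?_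
    dsimp only [b]
    split_ifs with hw
    · exact hB w hw
    · simpa using hfin w
  have h2 : ∏ v : InfinitePlace K, v D ^ v.mult ≤
      (c ^ N) ^ Module.finrank ℚ K * (∏ v : InfinitePlace K, (⨆ i, v (x i)) ^ v.mult) ^ N := by
    calc _ ≤ ∏ v : InfinitePlace K, ((c * ⨆ i, v (x i)) ^ N) ^ v.mult :=
          Finset.prod_le_prod (fun v _ ↦ by positivity) fun v _ ↦ by
            have := hinf v
            gcongr
      _ = _ := by
          simp only [mul_pow, Finset.prod_mul_distrib, Finset.prod_pow_eq_pow_sum,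
            InfinitePlace.sum_mult_eq, ← Finset.prod_pow]
          congr 1
          exact Finset.prod_congr rfl fun v _ ↦ by ring
  have hbpos : 0 < ∏ w ∈ S, b w := Finset.prod_pos fun w _ ↦ zero_lt_one.trans_le (hb w)
  have h3 : ∏ w ∈ S, b w ≤ (c ^ N) ^ Module.finrank ℚ K * Height.mulHeight x ^ N := by
    calc ∏ w ∈ S, b w = (∏ v : InfinitePlace K, v D ^ v.mult) *
          ((∏ w ∈ S, w D) * ∏ w ∈ S, b w) := by rw [← mul_assoc, hprod, one_mul]
      _ ≤ ((c ^ N) ^ Module.finrank ℚ K * (∏ v : InfinitePlace K, (⨆ i, v (x i)) ^ v.mult) ^ N) *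
          (∏ w ∈ S, ⨆ i, w (x i)) ^ N :=
        mul_le_mul h2 h1 (mul_nonneg (Finset.prod_nonneg fun w _ ↦ apply_nonneg w D) hbpos.le)
          (mul_nonneg (by positivity) (pow_nonneg (Finset.prod_nonneg fun v _ ↦
            pow_nonneg (Real.iSup_nonneg fun i ↦ apply_nonneg _ _) _) _))
      _ = _ := by rw [hheight]; ring
  rw [hsum]
  refine (Real.log_le_log hbpos h3).trans (le_of_eq ?_)
  rw [Real.log_mul (by positivity) (pow_ne_zero _ (Height.mulHeight_ne_zero x)), Real.log_pow,
    Real.log_pow, Real.log_pow]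
  ring

end ProductFormula

variable {K : Type u} [Field K] [NumberField K]

/-- The finite places of a number field correspond to the maximal ideals of its ring of integers. -/
noncomputable def finitePlaceEquiv (K : Type u) [Field K] [NumberField K] :
    FinitePlace K ≃ MaximalSpectrum (𝓞 K) :=
  FinitePlace.equivHeightOneSpectrum.trans
    (HeightOneSpectrum.equivMaximalSpectrum (RingOfIntegers.not_isField K))

lemma finitePlaceEquiv_asIdeal (w : FinitePlace K) :
    (finitePlaceEquiv K w).asIdeal = w.maximalIdeal.asIdeal := rfl

/-- The arithmetic part of the bound: the primes at which the reductions of an absolutely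
irreducible form are reducible. -/
theorem finite_and_sum_log_card_le {n d : ℕ} (hn : 1 ≤ n) (hd : 1 ≤ d)
    {f : MvPolynomial (Fin (n + 1)) K} (hf : f.IsHomogeneous d)
    (hirr : Irreducible (map (algebraMap K (AlgebraicClosure K)) f))
    (B : Set (MaximalSpectrum (𝓞 K)))
    (hB : ∀ 𝔭 ∈ B, ∀ (c : K) (φ : MvPolynomial (Fin (n + 1)) (𝓞 K)), c ≠ 0 →
      map (algebraMap (𝓞 K) K) φ = C c * f → (∃ m, coeff m φ ∉ 𝔭.asIdeal) →
      ∃ (Ω : Type u) (_ : Field Ω) (_ : IsAlgClosed Ω) (χ : 𝓞 K →+* Ω),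
        RingHom.ker χ = 𝔭.asIdeal ∧ ¬ Irreducible (map χ φ)) :
    B.Finite ∧ (1 / (Module.finrank ℚ K : ℝ)) *
        ∑ᶠ 𝔭 ∈ B, Real.log (Nat.card (𝓞 K ⧸ 𝔭.asIdeal)) ≤
      ((d : ℝ) ^ 2 - 1) * HypersurfaceReduction.naiveHeight f + ((d : ℝ) ^ 2 - 1) *
        (3 * Real.log d + d * Real.log 3 + Real.log ((n + d).choose d)) := by
  have hf0 : f ≠ 0 := by
    rintro rfl
    exact hirr.ne_zero (map_zero _)
  -- The indices are found over the algebraic closure, but compatibility with base change makes the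
  -- minor with these indices nonzero already over K.
  obtain ⟨ρ, μ, hD⟩ := exists_ruppertMinor_ne_zero hd hirr (hf.map _)
  rw [ruppertMinor_map] at hD
  have hD0 : ruppertMinor d ρ μ f ≠ 0 := fun h ↦ hD (by rw [h, map_zero])
  have hne : Nonempty f.support := by
    obtain ⟨m, hm⟩ := ne_zero_iff.mp hf0
    exact ⟨m, mem_support_iff.mpr hm⟩
  have hnt : Nontrivial (Fin (n + 1)) := Fin.nontrivial_iff_two_le.mpr (by omega)
  have hsup (w : FinitePlace K) : 0 ≤ (⨆ m : f.support, w (coeff m.1 f)) ^ (d ^ 2 - 1) :=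
    pow_nonneg (Real.iSup_nonneg fun _ ↦ apply_nonneg _ _) _
  have hc : 0 < (d : ℝ) ^ 3 * 3 ^ d * (n + d).choose d := by
    have h1 : (0 : ℝ) < d := by exact_mod_cast hd
    have h2 : (0 : ℝ) < (n + d).choose d := by exact_mod_cast Nat.choose_pos (by omega)
    positivity
  obtain ⟨hfin, hle⟩ := finite_and_sum_log_absNorm_le
    (x := fun m : f.support ↦ coeff m.1 f) (fun m ↦ mem_support_iff.mp m.2) hD0 hc
    (finitePlaceEquiv K ⁻¹' B) (fun v ↦ infinitePlace_ruppertMinor_le v hd hf ρ μ)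
    (fun w ↦ by
      obtain ⟨c, φ, -, hφ, hc, -⟩ := exists_primitive_multiple w hf0
      rw [finitePlace_ruppertMinor_eq w hd hφ hc]
      exact mul_le_of_le_one_left (hsup w) (finitePlace_algebraMap_le_one w _))
    (fun w hw ↦ by
      obtain ⟨c, φ, hc0, hφ, hc, hprim⟩ := exists_primitive_multiple w hf0
      obtain ⟨Ω, _, _, χ, hχ, hred⟩ := hB _ hw c φ hc0 hφ hprim
      rw [finitePlaceEquiv_asIdeal] at hχ
      have hφd : φ.IsHomogeneous d := by
        refine IsHomogeneous.of_map (FaithfulSMul.algebraMap_injective (𝓞 K) K) ?_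
        rw [hφ]
        exact hf.C_mul c
      have hφ0 : map χ φ ≠ 0 := by
        obtain ⟨m, hm⟩ := hprim
        refine fun h ↦ hm ?_
        rw [← hχ, RingHom.mem_ker, ← coeff_map, h, coeff_zero]
      have hmem : ruppertMinor d ρ μ φ ∈ w.maximalIdeal.asIdeal := by
        rw [← hχ, RingHom.mem_ker, ← ruppertMinor_map]
        exact ruppertMinor_eq_zero_of_not_irreducible (hφd.map χ) hφ0 hd hred ρ μ
      rw [finitePlace_ruppertMinor_eq w hd hφ hc, mul_right_comm]
      exact mul_le_of_le_one_left (hsup w) (finitePlace_mul_absNorm_le_one w hmem))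
  have himage : finitePlaceEquiv K '' (finitePlaceEquiv K ⁻¹' B) = B :=
    Set.image_preimage_eq B (finitePlaceEquiv K).surjective
  refine ⟨himage ▸ hfin.image _, ?_⟩
  have hsum : ∑ᶠ 𝔭 ∈ B, Real.log (Nat.card (𝓞 K ⧸ 𝔭.asIdeal)) =
      ∑ᶠ w ∈ finitePlaceEquiv K ⁻¹' B, Real.log (Ideal.absNorm w.maximalIdeal.asIdeal) := by
    conv_lhs => rw [← himage]
    rw [finsum_mem_image (finitePlaceEquiv K).injective.injOn]
    rfl
  have hN : ((d ^ 2 - 1 : ℕ) : ℝ) = (d : ℝ) ^ 2 - 1 := by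
    rw [Nat.cast_sub (Nat.one_le_pow _ _ hd)]
    push_cast
    ring
  have hlog : Real.log ((d : ℝ) ^ 3 * 3 ^ d * (n + d).choose d) =
      3 * Real.log d + d * Real.log 3 + Real.log ((n + d).choose d) := by
    have h1 : (d : ℝ) ≠ 0 := by
      have : d ≠ 0 := by omega
      exact_mod_cast this
    have h2 : ((n + d).choose d : ℝ) ≠ 0 := by
      exact_mod_cast (Nat.choose_pos (by omega)).ne'
    rw [Real.log_mul (by positivity) h2, Real.log_mul (by positivity) (by positivity), Real.log_pow,
      Real.log_pow]
    norm_num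
  have hK : (0 : ℝ) < Module.finrank ℚ K := by exact_mod_cast Module.finrank_pos
  rw [hN, hlog] at hle
  rw [hsum, HypersurfaceReduction.naiveHeight]
  refine (mul_le_mul_of_nonneg_left hle (by positivity)).trans (le_of_eq ?_)
  field_simp

end Ruppert

namespace Ruppert

open MvPolynomial

/-! ### Irreducibility of a form read on the standard charts -/

section Dehomogenization

variable {ι : Type*} [Fintype ι] [DecidableEq ι] (j : ι) {R S : Type*} [CommRing R] [CommRing S]

/-- Dehomogenization of polynomials with respect to the variable `T_j`. -/
noncomputable def dehom (R : Type*) [CommRing R] :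
    MvPolynomial ι R →+* MvPolynomial {i // i ≠ j} R :=
  eval₂Hom C fun i ↦ if h : i = j then 1 else X ⟨i, h⟩

omit [Fintype ι] in
@[simp]
lemma dehom_C (a : R) : dehom j R (C a) = C a := by simp [dehom]

omit [Fintype ι] in
@[simp]
lemma dehom_X_self : dehom j R (X j) = 1 := by simp [dehom]

omit [Fintype ι] in
lemma dehom_X_of_ne {i : ι} (h : i ≠ j) : dehom j R (X i) = X ⟨i, h⟩ := by simp [dehom, h]

omit [Fintype ι] in
lemma map_dehom (φ : R →+* S) (p : MvPolynomial ι R) :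
    map φ (dehom j R p) = dehom j S (map φ p) := by
  induction p using MvPolynomial.induction_on with
  | C a => simp
  | add p q hp hq => simp [hp, hq]
  | mul_X p i hp =>
    rcases eq_or_ne i j with rfl | h
    · simp [hp]
    · simp [hp, dehom_X_of_ne j h]

lemma dehom_monomial (m : ι →₀ ℕ) (a : R) :
    dehom j R (monomial m a) = monomial (m.subtypeDomain (· ≠ j)) a := by
  rw [monomial_eq, monomial_eq, map_mul, dehom_C, Finsupp.prod_fintype _ _ (by simp),
    Finsupp.prod_fintype _ _ (by simp), map_prod, Fintype.prod_eq_mul_prod_subtype_ne _ j]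
  simp only [map_pow, dehom_X_self, one_pow, one_mul]
  congr 1
  exact Finset.prod_congr rfl fun i _ ↦ by rw [dehom_X_of_ne j i.2]; rfl

lemma eq_of_subtypeDomain_eq {m m' : ι →₀ ℕ} (h : m.degree = m'.degree)
    (h' : m.subtypeDomain (· ≠ j) = m'.subtypeDomain (· ≠ j)) : m = m' := by
  have hne (i : ι) (hi : i ≠ j) : m i = m' i := DFunLike.congr_fun h' ⟨i, hi⟩
  ext i
  rcases eq_or_ne i j with rfl | hi
  · rw [Finsupp.degree_eq_sum, Finsupp.degree_eq_sum, ← Finset.add_sum_erase _ _ (Finset.mem_univ i),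
      ← Finset.add_sum_erase _ _ (Finset.mem_univ i)] at h
    rw [Finset.sum_congr rfl fun k hk ↦ hne k (Finset.ne_of_mem_erase hk)] at h
    exact Nat.add_right_cancel h
  · exact hne i hi

lemma coeff_subtypeDomain_dehom {p : MvPolynomial ι R} {e : ℕ} (hp : p.IsHomogeneous e)
    {m : ι →₀ ℕ} (hm : m.degree = e) :
    coeff (m.subtypeDomain (· ≠ j)) (dehom j R p) = coeff m p := by
  conv_lhs => rw [p.as_sum]
  simp only [map_sum, dehom_monomial, coeff_sum, coeff_monomial]
  rw [Finset.sum_eq_single m]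
  · rw [if_pos rfl]
  · intro m' hm' hne
    refine if_neg fun h ↦ hne (eq_of_subtypeDomain_eq j ?_ h)
    rw [hm]
    exact (DFunLike.congr_fun Finsupp.degree_eq_weight_one m').trans (hp (mem_support_iff.mp hm'))
  · intro h
    rw [if_pos rfl, notMem_support_iff.mp h]

lemma eq_zero_of_dehom_eq_zero {p : MvPolynomial ι R} {e : ℕ} (hp : p.IsHomogeneous e)
    (h : dehom j R p = 0) : p = 0 := by
  by_contra h0
  obtain ⟨m, hm⟩ := ne_zero_iff.mp h0
  refine hm ?_
  rw [← coeff_subtypeDomain_dehom j hp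
    ((DFunLike.congr_fun Finsupp.degree_eq_weight_one m).trans (hp hm)), h, coeff_zero]

lemma eq_of_dehom_eq {p q : MvPolynomial ι R} {e : ℕ} (hp : p.IsHomogeneous e)
    (hq : q.IsHomogeneous e) (h : dehom j R p = dehom j R q) : p = q :=
  sub_eq_zero.mp (eq_zero_of_dehom_eq_zero j (hp.sub hq) (by rw [map_sub, h, sub_self]))

omit [Fintype ι] in
lemma exists_isHomogeneous_dehom_eq (x : MvPolynomial {i // i ≠ j} R) :
    ∃ e₀, ∀ e, e₀ ≤ e → ∃ p : MvPolynomial ι R, p.IsHomogeneous e ∧ dehom j R p = x := by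
  induction x using MvPolynomial.induction_on with
  | C a =>
    refine ⟨0, fun e _ ↦ ⟨C a * X j ^ e, ?_, by simp⟩⟩
    simpa using ((isHomogeneous_X R j).pow e).C_mul a
  | add x y hx hy =>
    obtain ⟨e₁, h₁⟩ := hx
    obtain ⟨e₂, h₂⟩ := hy
    refine ⟨max e₁ e₂, fun e he ↦ ?_⟩
    obtain ⟨p, hp, rfl⟩ := h₁ e (le_of_max_le_left he)
    obtain ⟨q, hq, rfl⟩ := h₂ e (le_of_max_le_right he)
    exact ⟨p + q, hp.add hq, map_add _ _ _⟩
  | mul_X x i hx =>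
    obtain ⟨e₁, h₁⟩ := hx
    refine ⟨e₁ + 1, fun e he ↦ ?_⟩
    obtain ⟨p, hp, rfl⟩ := h₁ (e - 1) (by omega)
    refine ⟨p * X i.1, ?_, by rw [map_mul, dehom_X_of_ne j i.2]⟩
    have := hp.mul (isHomogeneous_X R i.1)
    rwa [show e - 1 + 1 = e by omega] at this

variable {L : Type*} [Field L]

lemma eq_C_mul_X_pow_of_isUnit_dehom {p : MvPolynomial ι L} {e : ℕ} (hp : p.IsHomogeneous e)
    (h : IsUnit (dehom j L p)) : ∃ c : L, c ≠ 0 ∧ p = C c * X j ^ e := by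
  obtain ⟨c, hc, hc'⟩ := MvPolynomial.isUnit_iff_eq_C_of_isReduced.mp h
  refine ⟨c, hc.ne_zero, eq_of_dehom_eq j hp ?_ ?_⟩
  · simpa using ((isHomogeneous_X L j).pow e).C_mul c
  · simp [hc']

/-- A divisibility between dehomogenizations comes from a divisibility between forms, up to a power
of the variable. -/
lemma exists_dvd_mul_X_pow_of_dehom_dvd {p q : MvPolynomial ι L} {d e : ℕ}
    (hp : p.IsHomogeneous d) (hq : q.IsHomogeneous e) (h : dehom j L p ∣ dehom j L q) :
    ∃ N, p ∣ q * X j ^ N := by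
  obtain ⟨z, hz⟩ := h
  obtain ⟨e₀, h₀⟩ := exists_isHomogeneous_dehom_eq j z
  obtain ⟨r, hr, rfl⟩ := h₀ (e₀ + e) (by omega)
  refine ⟨d + e₀, r, eq_of_dehom_eq j (hq.mul ((isHomogeneous_X L j).pow _)) ?_ (by simp [hz])⟩
  have := hp.mul hr
  rwa [show d + (e₀ + e) = e + 1 * (d + e₀) by ring] at this

section Irreducible

variable {p : MvPolynomial ι L} {d : ℕ}

omit [Fintype ι] in
lemma dvd_X_of_dvd_X_pow (hirr : Irreducible p) {N : ℕ} (h : p ∣ X j ^ N) :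
    IsUnit (dehom j L p) := by
  have := map_dvd (dehom j L) (hirr.prime.dvd_of_dvd_pow h)
  rw [dehom_X_self] at this
  exact isUnit_of_dvd_one this

/-- A divisibility on the chart homogenizes to one up to a power of T_j. The prime p can divide that
power only if its dehomogenization is a unit. -/
lemma dehom_prime_of_not_isUnit (hp : p.IsHomogeneous d) (hirr : Irreducible p)
    (h : ¬ IsUnit (dehom j L p)) : Prime (dehom j L p) := by
  refine ⟨fun h0 ↦ hirr.ne_zero (eq_zero_of_dehom_eq_zero j hp h0), h, fun x y hxy ↦ ?_⟩
  obtain ⟨e₁, h₁⟩ := exists_isHomogeneous_dehom_eq j x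
  obtain ⟨e₂, h₂⟩ := exists_isHomogeneous_dehom_eq j y
  obtain ⟨x, hx, rfl⟩ := h₁ e₁ le_rfl
  obtain ⟨y, hy, rfl⟩ := h₂ e₂ le_rfl
  rw [← map_mul] at hxy
  obtain ⟨N, hN⟩ := exists_dvd_mul_X_pow_of_dehom_dvd j hp (hx.mul hy) hxy
  rcases hirr.prime.dvd_or_dvd hN with h' | h'
  · exact (hirr.prime.dvd_or_dvd h').imp (map_dvd _) (map_dvd _)
  · exact absurd (dvd_X_of_dvd_X_pow j hirr h') h

lemma not_dehom_dvd_X (hp : p.IsHomogeneous d) (hirr : Irreducible p) {l : ι} (hl : l ≠ j)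
    (h : ¬ IsUnit (dehom j L p)) (h' : ¬ IsUnit (dehom l L p)) :
    ¬ dehom j L p ∣ X ⟨l, hl⟩ := by
  rw [← dehom_X_of_ne j hl]
  intro hdvd
  obtain ⟨N, hN⟩ := exists_dvd_mul_X_pow_of_dehom_dvd j hp (isHomogeneous_X L l) hdvd
  rcases hirr.prime.dvd_or_dvd hN with hN | hN
  · exact h' (dvd_X_of_dvd_X_pow l hirr (N := 1) (by rwa [pow_one]))
  · exact h (dvd_X_of_dvd_X_pow j hirr hN)

lemma exists_not_isUnit_dehom [Nontrivial ι] (hp : p.IsHomogeneous d) (hirr : Irreducible p) :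
    ∃ j, ¬ IsUnit (dehom j L p) := by
  by_contra! h
  obtain ⟨j, l, hjl⟩ := exists_pair_ne ι
  obtain ⟨c, hc, hpc⟩ := eq_C_mul_X_pow_of_isUnit_dehom j hp (h j)
  have hl := h l
  have hd : d ≠ 0 := by
    rintro rfl
    refine hirr.not_isUnit ?_
    rw [hpc, pow_zero, mul_one]
    exact (isUnit_iff_ne_zero.mpr hc).map C
  rw [hpc, map_mul, map_pow, dehom_X_of_ne l hjl] at hl
  have := (isUnit_pow_iff hd).mp (isUnit_of_mul_isUnit_right hl)
  exact X_prime.not_isUnit this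

end Irreducible

/-- A form is irreducible if its dehomogenizations are units or primes, not all units, and the
corresponding charts meet. -/
lemma irreducible_of_dehom {p : MvPolynomial ι L} {d : ℕ} (hp : p.IsHomogeneous d) (h0 : p ≠ 0)
    (hex : ∃ j, ¬ IsUnit (dehom j L p))
    (hprime : ∀ j, ¬ IsUnit (dehom j L p) → Prime (dehom j L p))
    (hmeet : ∀ j l (hl : l ≠ j), ¬ IsUnit (dehom j L p) → ¬ IsUnit (dehom l L p) →
      ¬ dehom j L p ∣ X ⟨l, hl⟩) : Irreducible p ∧ Nontrivial ι := by
  obtain ⟨j, hj⟩ := hex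
  have hnt : Nontrivial ι := by
    by_contra hcon
    rw [not_nontrivial_iff_subsingleton] at hcon
    have : IsEmpty {i // i ≠ j} := ⟨fun i ↦ i.2 (Subsingleton.elim _ _)⟩
    have h1 : dehom j L p ≠ 0 := fun h ↦ h0 (eq_zero_of_dehom_eq_zero j hp h)
    rw [eq_C_of_isEmpty (dehom j L p)] at h1 hj
    exact hj ((isUnit_iff_ne_zero.mpr fun h ↦ h1 (by rw [h, C_0])).map C)
  refine ⟨⟨fun h ↦ hj (h.map _), ?_⟩, hnt⟩
  -- A factor invisible on chart j is c T_j^e. If e > 0, then on another chart l the prime equation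
  -- of p is T_j up to a unit, so the hypersurface would miss D₊(T_j) there, contrary to `hmeet`.
  have key (a b : MvPolynomial ι L) (e : ℕ) (ha : a.IsHomogeneous e) (hab : p = a * b)
      (hu : IsUnit (dehom j L a)) : IsUnit a := by
    obtain ⟨c, hc, hac⟩ := eq_C_mul_X_pow_of_isUnit_dehom j ha hu
    rcases Nat.eq_zero_or_pos e with rfl | he
    · rw [hac, pow_zero, mul_one]
      exact (isUnit_iff_ne_zero.mpr hc).map C
    obtain ⟨l, hl⟩ := exists_ne j
    have hfac : dehom l L p = X ⟨j, hl.symm⟩ * (C c * X ⟨j, hl.symm⟩ ^ (e - 1) * dehom l L b) := by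
      obtain ⟨e, rfl⟩ := Nat.exists_eq_add_of_le' he
      rw [hab, hac, map_mul, map_mul, map_pow, dehom_X_of_ne l hl.symm, dehom_C,
        Nat.add_sub_cancel]
      ring
    have hlu : ¬ IsUnit (dehom l L p) := fun h ↦ by
      rw [hfac] at h
      exact X_prime.not_isUnit (isUnit_of_mul_isUnit_left h)
    have hunit := ((hprime l hlu).irreducible.isUnit_or_isUnit hfac).resolve_left X_prime.not_isUnit
    refine absurd ?_ (hmeet l j hl.symm hlu hj)
    obtain ⟨v, hv⟩ := hunit
    refine ⟨(v⁻¹ : Units _), ?_⟩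
    rw [hfac, ← hv, mul_assoc, Units.mul_inv, mul_one]
  intro a b hab
  obtain ⟨e, e', ha, hb, -⟩ := isHomogeneous_of_mul (hab ▸ hp) (hab ▸ h0)
  have hirr := (hprime j hj).irreducible.isUnit_or_isUnit (hab ▸ map_mul (dehom j L) a b)
  exact hirr.imp (key a b e ha hab) (key b a e' hb (hab.trans (mul_comm a b)))

end Dehomogenization

lemma irreducible_of_irreducible_map {L Ω ι : Type*} [Field L] [Field Ω] (φ : L →+* Ω)
    {p : MvPolynomial ι L} (h : Irreducible (map φ p)) : Irreducible p := by
  have : IsLocalHom (map φ : MvPolynomial ι L →+* MvPolynomial ι Ω) := ⟨fun a ha ↦ by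
    obtain ⟨c, hc, hc'⟩ := MvPolynomial.isUnit_iff_eq_C_of_isReduced.mp ha
    have h1 : a = C (coeff 0 a) := by
      classical
      ext m
      apply φ.injective
      rw [← coeff_map, hc', coeff_C, coeff_C]
      split_ifs with hm
      · rw [← coeff_map, hc', coeff_zero_C]
      · rw [map_zero]
    rw [h1]
    refine (isUnit_iff_ne_zero.mpr fun h0 ↦ hc.ne_zero ?_).map C
    rw [← coeff_zero_C (R := Ω) (σ := ι) c, ← hc', coeff_map, h0, map_zero]⟩
  exact Irreducible.of_map h

/-! ### Gauss's lemma at a prime -/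

section Gauss

open NumberField IsDedekindDomain

variable {K : Type*} [Field K] [NumberField K]

/-- A form of Gauss's lemma: divisibility over `K` by a polynomial which is primitive at a prime
implies divisibility modulo this prime. -/
lemma map_dvd_map_of_primitive (w : FinitePlace K) {τ L : Type*} [Field L] (χ : 𝓞 K →+* L)
    (hχ : RingHom.ker χ = w.maximalIdeal.asIdeal) {g p : MvPolynomial τ (𝓞 K)}
    (hg : map χ g ≠ 0) (h : map (algebraMap (𝓞 K) K) g ∣ map (algebraMap (𝓞 K) K) p) :
    map χ g ∣ map χ p := by
  have hinj := map_injective (σ := τ) _ (FaithfulSMul.algebraMap_injective (𝓞 K) K)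
  have hχ' (a : 𝓞 K) : χ a ≠ 0 ↔ a ∉ w.maximalIdeal.asIdeal := by rw [← hχ, RingHom.mem_ker]
  obtain ⟨b, hb⟩ := h
  rcases eq_or_ne b 0 with rfl | hb0
  · rw [mul_zero, map_eq_zero_iff _ hinj] at hb
    rw [hb, map_zero]
    exact dvd_zero _
  obtain ⟨c, ψ, hc0, hψ, -, m, hm⟩ := exists_primitive_multiple w hb0
  have h1 : map (algebraMap (𝓞 K) K) (g * ψ) = C c * map (algebraMap (𝓞 K) K) p := by
    rw [map_mul, hψ, hb]
    ring
  have hψ0 : map χ ψ ≠ 0 := fun h0 ↦ by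
    have := congr_arg (coeff m) h0
    rw [coeff_map, coeff_zero] at this
    exact (hχ' _).mpr hm this
  have h2 : map χ (g * ψ) ≠ 0 := by
    rw [map_mul]
    exact mul_ne_zero hg hψ0
  obtain ⟨m', hm'⟩ := ne_zero_iff.mp h2
  rw [coeff_map, hχ', ← finitePlace_algebraMap_eq_one_iff, ← coeff_map, h1, coeff_C_mul, coeff_map,
    map_mul] at hm'
  -- Both g and ψ are nonzero modulo the prime, hence so is their product c p. As p is integral,
  -- this forces |c| ≥ 1, so p = c⁻¹ g ψ can be reduced after multiplication by a unit at w.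
  have hwc : w c⁻¹ ≤ 1 := by
    have hpos := FinitePlace.pos_iff (w := w).mpr hc0
    rw [map_inv₀]
    refine inv_le_one_of_one_le₀ ?_
    have h3 := mul_le_of_le_one_right hpos.le
      (finitePlace_algebraMap_le_one w (coeff m' p))
    linarith
  obtain ⟨o, s, hos⟩ := w.maximalIdeal.exists_primeCompl_mul_eq_of_integer c⁻¹
    ((finitePlace_le_one_iff w _).mp hwc)
  have h4 : C (s : 𝓞 K) * p = C o * (g * ψ) := by
    apply hinj
    rw [map_mul, map_mul _ (C o), h1, map_C, map_C, ← hos, C_mul]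
    have : (C c⁻¹ : MvPolynomial τ K) * C c = 1 := by
      rw [← C_mul, inv_mul_cancel₀ hc0, C_1]
    linear_combination (-(C (algebraMap (𝓞 K) K (s : 𝓞 K))) *
      map (algebraMap (𝓞 K) K) p) * this
  have hs : χ s ≠ 0 := (hχ' _).mpr s.2
  refine (IsUnit.dvd_mul_left ((isUnit_iff_ne_zero.mpr hs).map C)).mp
    (⟨C (χ o) * map χ ψ, ?_⟩ : _ ∣ C (χ s) * map χ p)
  have h5 := congr_arg (map χ) h4
  simp only [map_mul, map_C] at h5
  rw [h5]
  ring

end Gauss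

/-! ### Charts of projective space and base change of closed subschemes -/

section ChartRing

open HypersurfaceReduction HomogeneousLocalization

attribute [local instance] MvPolynomial.gradedAlgebra

variable {n : ℕ} (R : Type u) [CommRing R] (j : Fin (n + 1))

/-- The coordinate ring of the chart `D₊(T_j)` maps to the polynomial ring. -/
noncomputable def chartHom :
    Away (grading n R) (X j : MvPolynomial (Fin (n + 1)) R) →+* MvPolynomial {i // i ≠ j} R :=
  (IsLocalization.Away.lift (S := Localization.Away (X j : MvPolynomial (Fin (n + 1)) R)) (X j)
    (g := dehom j R) (by simp)).comp (algebraMap _ (Localization.Away _))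

variable {R} in
lemma chartHom_mk (d : ℕ) (p : MvPolynomial (Fin (n + 1)) R) (hp : p ∈ grading n R (d • 1)) :
    chartHom R j (Away.mk (grading n R) (X_mem_grading n R j) d p hp) = dehom j R p := by
  rw [chartHom, RingHom.comp_apply, HomogeneousLocalization.algebraMap_apply, Away.val_mk,
    Localization.mk_eq_mk', IsLocalization.Away.lift, IsLocalization.lift_mk'_spec]
  rw [map_pow, dehom_X_self, one_pow, one_mul]

lemma chartHom_bijective : Function.Bijective (chartHom R j) := by
  constructor
  · rw [injective_iff_map_eq_zero]
    intro a ha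
    obtain ⟨d, p, hp, rfl⟩ := Away.mk_surjective (grading n R) (X_mem_grading n R j) a
    rw [chartHom_mk] at ha
    have hp0 := eq_zero_of_dehom_eq_zero j ((mem_homogeneousSubmodule _ _).mp hp) ha
    subst hp0
    apply val_injective
    rw [Away.val_mk, Localization.mk_zero, val_zero]
  · intro x
    obtain ⟨e₀, h⟩ := exists_isHomogeneous_dehom_eq j x
    obtain ⟨p, hp, rfl⟩ := h e₀ le_rfl
    exact ⟨Away.mk (grading n R) (X_mem_grading n R j) e₀ p (by simpa using hp), chartHom_mk j _ _ _⟩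

/-- The coordinate ring of the chart `D₊(T_j)` is a polynomial ring. -/
noncomputable def chartEquiv :
    Away (grading n R) (X j : MvPolynomial (Fin (n + 1)) R) ≃+* MvPolynomial {i // i ≠ j} R :=
  RingEquiv.ofBijective (chartHom R j) (chartHom_bijective R j)

variable {R} in
lemma chartEquiv_mk (d : ℕ) (p : MvPolynomial (Fin (n + 1)) R) (hp : p ∈ grading n R (d • 1)) :
    chartEquiv R j (Away.mk (grading n R) (X_mem_grading n R j) d p hp) = dehom j R p :=
  chartHom_mk j d p hp

lemma chartEquiv_fromZeroRingHom (a : R) :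
    chartEquiv R j (fromZeroRingHom (grading n R) _ (algebraMap R (grading n R 0) a)) = C a := by
  have : fromZeroRingHom (grading n R) _ (algebraMap R (grading n R 0) a) =
      Away.mk (grading n R) (X_mem_grading n R j) 0 (C a) (by
        simp) := by
    apply val_injective
    rw [Away.val_mk]
    change Localization.mk _ _ = _
    congr 1
  rw [this, chartEquiv_mk, dehom_C]

end ChartRing

section Pushout

variable {R A L : Type u} [CommRing R] [CommRing A] [CommRing L] {τ : Type} (ρ : R →+* A)
  (g : R →+* L) (e : A ≃+* MvPolynomial τ R) (I : Ideal A) (P : MvPolynomial τ L)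

/-- The base change to `L` of a quotient of a polynomial ring over `R`. -/
lemma isPushout_quotient (he : ∀ a, e (ρ a) = C a) (h1 : ∃ a ∈ I, map g (e a) = P)
    (κ : A ⧸ I →+* MvPolynomial τ L ⧸ Ideal.span {P})
    (hκ : ∀ a, κ (Ideal.Quotient.mk I a) = Ideal.Quotient.mk _ (map g (e a))) :
    IsPushout (CommRingCat.ofHom ((Ideal.Quotient.mk I).comp ρ)) (CommRingCat.ofHom g)
      (CommRingCat.ofHom κ)
      (CommRingCat.ofHom ((Ideal.Quotient.mk (Ideal.span {P})).comp C)) := by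
  have w : CommRingCat.ofHom ((Ideal.Quotient.mk I).comp ρ) ≫ CommRingCat.ofHom κ =
      CommRingCat.ofHom g ≫
        CommRingCat.ofHom ((Ideal.Quotient.mk (Ideal.span {P})).comp C) := by
    ext a
    simp [hκ, he]
  have key (s : PushoutCocone (CommRingCat.ofHom ((Ideal.Quotient.mk I).comp ρ))
      (CommRingCat.ofHom g)) (q : MvPolynomial τ R) :
      eval₂Hom s.inr.hom (fun t ↦ s.inl.hom (Ideal.Quotient.mk I (e.symm (X t)))) (map g q) =
        s.inl.hom (Ideal.Quotient.mk I (e.symm q)) := by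
    induction q using MvPolynomial.induction_on with
    | C a =>
      have h := congr_arg (fun φ ↦ φ.hom a) s.condition
      have h' : e.symm (C a) = ρ a := by rw [← he, e.symm_apply_apply]
      simp only [map_C, coe_eval₂Hom, eval₂_C, h']
      exact h.symm
    | add p q hp hq => simp only [map_add, hp, hq]
    | mul_X p t hp =>
      simp only [map_mul, map_X, hp]
      simp
  -- The comparison map is evaluation of polynomials over L at the images of the variables. It
  -- factors through the quotient because P lifts to an element of I; existence of κ supplies the
  -- opposite inclusion.
  refine ⟨⟨w⟩, ⟨PushoutCocone.IsColimit.mk w (fun s ↦ CommRingCat.ofHom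
    (Ideal.Quotient.lift _ (eval₂Hom s.inr.hom
      fun t ↦ s.inl.hom (Ideal.Quotient.mk I (e.symm (X t)))) ?_)) ?_ ?_ ?_⟩⟩
  · obtain ⟨a, ha, rfl⟩ := h1
    intro x hx
    obtain ⟨y, rfl⟩ := Ideal.mem_span_singleton'.mp hx
    rw [map_mul, key, e.symm_apply_apply, Ideal.Quotient.eq_zero_iff_mem.mpr ha, map_zero, mul_zero]
  · intro s
    refine CommRingCat.hom_ext (Ideal.Quotient.ringHom_ext (RingHom.ext fun a ↦ ?_))
    simp only [CommRingCat.hom_comp, CommRingCat.hom_ofHom, RingHom.comp_apply, hκ,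
      Ideal.Quotient.lift_mk]
    rw [key, e.symm_apply_apply]
  · intro s
    ext x
    simp
  · intro s m hm₁ hm₂
    refine CommRingCat.hom_ext (Ideal.Quotient.ringHom_ext (RingHom.ext fun q ↦ ?_))
    simp only [CommRingCat.hom_ofHom, RingHom.comp_apply, Ideal.Quotient.lift_mk]
    induction q using MvPolynomial.induction_on with
    | C a =>
      rw [coe_eval₂Hom, eval₂_C, ← hm₂]
      rfl
    | add p q hp hq => simp only [map_add, hp, hq]
    | mul_X p t hp =>
      simp only [map_mul, hp]
      congr 1
      rw [coe_eval₂Hom, eval₂_X, ← hm₁, CommRingCat.hom_comp, RingHom.comp_apply,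
        CommRingCat.hom_ofHom, hκ, e.apply_symm_apply, map_X]

end Pushout

section SubschemeChart

variable {R L : Type u} [CommRing R] [CommRing L] {τ : Type} {X : Scheme.{u}}
  (I : X.IdealSheafData) (s : X ⟶ Spec (.of R)) (U : X.affineOpens) (g : R →+* L)

/-- On an affine open subset which is an affine space over `R`, the base change to `L` of a closed
subscheme is cut out by a polynomial `P` if the ideal contains a polynomial reducing to `P`, and
all the elements of the ideal reduce to multiples of `P`. -/
lemma exists_subscheme_chart (ρ : R →+* Γ(X, U.1))
    (hρ : U.2.fromSpec ≫ s = Spec.map (CommRingCat.ofHom ρ))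
    (e : Γ(X, U.1) ≃+* MvPolynomial τ R) (he : ∀ a, e (ρ a) = C a) (P : MvPolynomial τ L)
    (h1 : ∃ a ∈ I.ideal U, map g (e a) = P) (h2 : ∀ a ∈ I.ideal U, P ∣ map g (e a)) :
    ∃ w : Spec (.of (MvPolynomial τ L ⧸ Ideal.span {P})) ⟶
        pullback (I.subschemeι ≫ s) (Spec.map (CommRingCat.ofHom g)),
      IsOpenImmersion w ∧
      w ≫ pullback.fst _ _ ≫ I.subschemeι =
        Spec.map (CommRingCat.ofHom (((Ideal.Quotient.mk (Ideal.span {P})).comp (map g)).comp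
          e.toRingHom)) ≫ U.2.fromSpec ∧
      Set.range w = pullback.fst (I.subschemeι ≫ s) (Spec.map (CommRingCat.ofHom g)) ⁻¹'
        (I.subschemeι ⁻¹' (U.1 : Set X)) := by
  let κ : Γ(X, U.1) ⧸ I.ideal U →+* MvPolynomial τ L ⧸ Ideal.span {P} :=
    Ideal.Quotient.lift _ (((Ideal.Quotient.mk (Ideal.span {P})).comp (map g)).comp e.toRingHom)
      fun a ha ↦ Ideal.Quotient.eq_zero_iff_mem.mpr (Ideal.mem_span_singleton.mpr (h2 a ha))
  obtain ⟨F, hF, hf, hr⟩ : ∃ F : Spec (.of (Γ(X, U.1) ⧸ I.ideal U)) ⟶ I.subscheme,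
      IsOpenImmersion F ∧ F ≫ I.subschemeι =
        Spec.map (CommRingCat.ofHom (Ideal.Quotient.mk (I.ideal U))) ≫ U.2.fromSpec ∧
      Set.range F = I.subschemeι ⁻¹' (U.1 : Set X) :=
    ⟨I.subschemeCover.f U, I.subschemeCover.map_prop U,
      (I.subschemeCover_map_subschemeι U).trans (I.glueDataObjι_ι U),
      congr_arg SetLike.coe (I.opensRange_subschemeCover_map U)⟩
  have hfs : F ≫ I.subschemeι ≫ s =
      Spec.map (CommRingCat.ofHom ((Ideal.Quotient.mk (I.ideal U)).comp ρ)) := by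
    rw [reassoc_of% hf, hρ, ← Spec.map_comp]
    rfl
  have hpb := (isPullback_SpecMap_of_isPushout _ _ _ _
    (isPushout_quotient ρ g e (I.ideal U) P he h1 κ fun a ↦ rfl)).flip
  rw [← hfs] at hpb
  -- Pasting: the base change of the affine piece is also the pullback of the open immersion F along
  -- the first projection, so it is an open subscheme of the total base change.
  have hw := IsPullback.of_right' hpb (IsPullback.of_hasPullback (I.subschemeι ≫ s)
    (Spec.map (CommRingCat.ofHom g))).flip
  refine ⟨_, MorphismProperty.of_isPullback hw.flip hF, ?_, ?_⟩
  · rw [reassoc_of% hw.w, hf, ← Spec.map_comp_assoc]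
    rfl
  · have h := Scheme.image_preimage_eq_of_isPullback hw.flip Set.univ
    rw [Set.preimage_univ, Set.image_univ, Set.image_univ] at h
    rw [h, hr]

end SubschemeChart

section Chart

open HypersurfaceReduction HomogeneousLocalization

attribute [local instance] MvPolynomial.gradedAlgebra

variable {n : ℕ} (R : Type u) [CommRing R] (j : Fin (n + 1))

/-- The sections over a chart of projective space form a polynomial ring. -/
noncomputable def sectionEquiv :
    Γ(projectiveSpace n R, (chart n R j).1) ≃+* MvPolynomial {i // i ≠ j} R :=
  (show CommRingCat.of (Away (grading n R) (X j : MvPolynomial (Fin (n + 1)) R)) ≅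
      Γ(projectiveSpace n R, (chart n R j).1) from Proj.basicOpenIsoAway (grading n R) (X j)
    (X_mem_grading n R j) one_pos).commRingCatIsoToRingEquiv.symm.trans (chartEquiv R j)

/-- The coordinate ring of a chart maps to the sections. -/
noncomputable def awayToChart :
    Away (grading n R) (X j : MvPolynomial (Fin (n + 1)) R) →+*
      Γ(projectiveSpace n R, (chart n R j).1) :=
  (Proj.awayToSection (grading n R) (X j)).hom

lemma sectionEquiv_awayToChart (a : Away (grading n R) (X j : MvPolynomial (Fin (n + 1)) R)) :
    sectionEquiv R j (awayToChart R j a) = chartEquiv R j a := by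
  rw [sectionEquiv, RingEquiv.trans_apply]
  congr 1
  rw [RingEquiv.symm_apply_eq]
  rfl

lemma awayToChart_surjective : Function.Surjective (awayToChart R j) :=
  (show CommRingCat.of (Away (grading n R) (X j : MvPolynomial (Fin (n + 1)) R)) ≅
      Γ(projectiveSpace n R, (chart n R j).1) from Proj.basicOpenIsoAway (grading n R) (X j)
    (X_mem_grading n R j) one_pos).commRingCatIsoToRingEquiv.surjective

lemma fromSpec_chart : (chart n R j).2.fromSpec =
    Spec.map (CommRingCat.ofHom (awayToChart R j)) ≫
      Proj.awayι (grading n R) (X j) (X_mem_grading n R j) one_pos := by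
  have : (Proj.isAffineOpen_basicOpen (grading n R) (X j) (X_mem_grading n R j)
      one_pos).isoSpec.inv = Spec.map (Proj.awayToSection (grading n R) (X j)) ≫
        (Proj.basicOpenIsoSpec (grading n R) (X j) (X_mem_grading n R j) one_pos).inv := by
    rw [Iso.eq_comp_inv, Iso.inv_comp_eq, Proj.basicOpenIsoSpec_hom]
    rfl
  exact (congr_arg (· ≫ Scheme.Opens.ι _) this).trans (Category.assoc _ _ _)

/-- The structure map of the ring of sections over a chart. -/
noncomputable def scalarToSection : R →+* Γ(projectiveSpace n R, (chart n R j).1) :=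
  ((awayToChart R j).comp (fromZeroRingHom (grading n R) _)).comp (algebraMap R (grading n R 0))

lemma fromSpec_chart_comp : (chart n R j).2.fromSpec ≫ projectiveSpaceToSpec n R =
    Spec.map (CommRingCat.ofHom (scalarToSection R j)) := by
  rw [fromSpec_chart, projectiveSpaceToSpec, Category.assoc, Proj.awayι_toSpecZero_assoc,
    ← Spec.map_comp, ← Spec.map_comp]
  rfl

lemma sectionEquiv_scalarToSection (a : R) :
    sectionEquiv R j (scalarToSection R j a) = C a :=
  (sectionEquiv_awayToChart R j _).trans (chartEquiv_fromZeroRingHom R j a)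

/-- The intersection of two charts of projective space. -/
lemma fromSpec_chart_preimage {l : Fin (n + 1)} (hl : l ≠ j) :
    (chart n R j).2.fromSpec ⁻¹ᵁ (chart n R l).1 =
      PrimeSpectrum.basicOpen ((sectionEquiv R j).symm (X ⟨l, hl⟩)) := by
  have h1 : (sectionEquiv R j).symm (X ⟨l, hl⟩) = awayToChart R j
      (Away.isLocalizationElem (X_mem_grading n R j) (X_mem_grading n R l)) := by
    rw [RingEquiv.symm_apply_eq, sectionEquiv_awayToChart]
    refine Eq.trans ?_ (chartEquiv_mk j _ _ _).symm
    rw [pow_one, dehom_X_of_ne j hl]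
  rw [h1, fromSpec_chart]
  change Spec.map _ ⁻¹ᵁ (Proj.awayι (grading n R) (X j) (X_mem_grading n R j) one_pos ⁻¹ᵁ
    Proj.basicOpen (grading n R) (X l)) = _
  rw [Proj.awayι_preimage_basicOpen (grading n R) _ _ (X_mem_grading n R l) one_pos]
  rfl

lemma iSup_chart : ⨆ j, (chart n R j).1 = ⊤ := by
  refine Proj.iSup_basicOpen_eq_top' (grading n R) (fun j ↦ X j)
    (fun j ↦ ⟨1, X_mem_grading n R j⟩) (top_le_iff.mp fun x _ ↦ ?_)
  induction x using MvPolynomial.induction_on with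
  | C a => exact Subalgebra.algebraMap_mem _ (algebraMap R (grading n R 0) a)
  | add p q hp hq => exact add_mem (hp trivial) (hq trivial)
  | mul_X p i hp => exact mul_mem (hp trivial) (Algebra.subset_adjoin ⟨i, rfl⟩)

end Chart

end Ruppert

namespace Ruppert

/-! ### Integrality from affine charts, some of which may be empty -/

section Gluing

variable {ι : Type*} {W : Scheme.{u}} (Q : ι → CommRingCat.{u}) (w : ∀ j, Spec (Q j) ⟶ W)
  [∀ j, IsOpenImmersion (w j)] (t : ∀ j, ι → Q j)

/-- Integrality of a scheme covered by affine open subschemes, whose intersections are basic opens. -/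
lemma isIntegral_iff_of_affine_charts (hcov : ∀ x, ∃ j, x ∈ Set.range (w j))
    (ht : ∀ j l, l ≠ j → ∀ z : Spec (Q j),
      w j z ∈ Set.range (w l) ↔ z ∈ PrimeSpectrum.basicOpen (t j l)) :
    IsIntegral W ↔ (∃ j, Nontrivial (Q j)) ∧ (∀ j, Nontrivial (Q j) → IsDomain (Q j)) ∧
      ∀ j l, l ≠ j → Nontrivial (Q j) → Nontrivial (Q l) → t j l ≠ 0 := by
  have hopen (j) : IsOpen (Set.range (w j)) := (w j).isOpenEmbedding.isOpen_range
  constructor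
  · intro hW
    refine ⟨?_, fun j hj ↦ ?_, fun j l hjl hj hl h0 ↦ ?_⟩
    · obtain ⟨j, x, -⟩ := hcov (Classical.arbitrary W)
      exact ⟨j, PrimeSpectrum.nontrivial x⟩
    · have : Nonempty (Spec (Q j)) := inferInstanceAs (Nonempty (PrimeSpectrum (Q j)))
      have := isIntegral_of_isOpenImmersion (w j)
      exact (affine_isIntegral_iff (Q j)).mp this
    · have x : PrimeSpectrum (Q j) := Classical.arbitrary _
      have y : PrimeSpectrum (Q l) := Classical.arbitrary _
      obtain ⟨_, ⟨z, rfl⟩, hz⟩ := nonempty_preirreducible_inter (hopen j) (hopen l)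
        ⟨w j x, Set.mem_range_self _⟩ ⟨w l y, Set.mem_range_self _⟩
      rw [ht j l hjl, h0, PrimeSpectrum.basicOpen_zero] at hz
      exact hz
  · rintro ⟨⟨j₀, hj₀⟩, hdom, hmeet⟩
    have hred (j) : IsReduced (Spec (Q j)) := by
      rw [affine_isReduced_iff]
      cases subsingleton_or_nontrivial (Q j) with
      | inl h => exact ⟨fun x _ ↦ Subsingleton.elim _ _⟩
      | inr h =>
        have := hdom j h
        infer_instance
    have : IsReduced W := by
      let 𝒰 : W.OpenCover := Scheme.Cover.mkOfCovers ι (fun j ↦ Spec (Q j)) w hcov inferInstance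
      have (i : _) : IsReduced (𝒰.X i) := hred i
      exact IsReduced.of_openCover W 𝒰
    have hne (j) (x : Spec (Q j)) : Nontrivial (Q j) := PrimeSpectrum.nontrivial x
    have hirr (j) (x : Spec (Q j)) : IrreducibleSpace (Spec (Q j)) := by
      have := hne j x
      have := hdom j this
      exact inferInstanceAs (IrreducibleSpace (PrimeSpectrum (Q j)))
    have hpre : PreirreducibleSpace W := by
      refine ⟨?_⟩
      rintro U V hU hV ⟨x, -, hxU⟩ ⟨y, -, hyV⟩
      obtain ⟨j, x, rfl⟩ := hcov x
      obtain ⟨l, y, rfl⟩ := hcov y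
      have := hirr j x
      have := hirr l y
      -- Two nonempty charts meet because `t j l` is nonzero in a domain. Irreducibility of chart j
      -- moves the point of U into chart l, where irreducibility of that chart finishes.
      obtain ⟨z, hzU, z', hz'⟩ : ∃ z, w j z ∈ U ∧ w j z ∈ Set.range (w l) := by
        rcases eq_or_ne l j with rfl | hjl
        · exact ⟨x, hxU, Set.mem_range_self x⟩
        refine nonempty_preirreducible_inter (hU.preimage (w j).continuous)
          ((hopen l).preimage (w j).continuous) ⟨x, hxU⟩ ?_
        have := hdom j (hne j x)
        by_contra hemp
        have hbot : PrimeSpectrum.basicOpen (t j l) = ⊥ :=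
          TopologicalSpace.Opens.ext (Set.eq_empty_of_forall_notMem fun z hz ↦
            hemp ⟨z, (ht j l hjl z).mpr hz⟩)
        exact hmeet j l hjl (hne j x) (hne l y)
          ((PrimeSpectrum.basicOpen_eq_bot_iff _).mp hbot).eq_zero
      obtain ⟨v, hvU, hvV⟩ := nonempty_preirreducible_inter (hU.preimage (w l).continuous)
        (hV.preimage (w l).continuous) ⟨z', by rwa [Set.mem_preimage, hz']⟩ ⟨y, hyV⟩
      exact ⟨w l v, Set.mem_univ _, hvU, hvV⟩
    have : IrreducibleSpace W := ⟨⟨w j₀ (Classical.arbitrary (PrimeSpectrum (Q j₀)))⟩⟩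
    exact isIntegral_of_irreducibleSpace_of_isReduced W

end Gluing

end Ruppert

namespace Ruppert

open MvPolynomial

/-! ### Integrality of projective hypersurfaces and of reductions of the closure -/

section ProjectiveHypersurface

open HypersurfaceReduction

attribute [local instance] MvPolynomial.gradedAlgebra

variable {n : ℕ} {R L : Type u} [CommRing R] [Field L]
  (I : (projectiveSpace n R).IdealSheafData) (g : R →+* L)

/-- The base change to a field `L` of a closed subscheme of projective space is integral if and only
if the form `P` over `L` which cuts it out in the standard charts is irreducible. -/
theorem isIntegral_pullback_iff_irreducible {P : MvPolynomial (Fin (n + 1)) L} {d : ℕ}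
    (hP : P.IsHomogeneous d) (h0 : P ≠ 0)
    (h1 : ∀ j, ∃ a ∈ I.ideal (chart n R j), map g (sectionEquiv R j a) = dehom j L P)
    (h2 : ∀ j, ∀ a ∈ I.ideal (chart n R j), dehom j L P ∣ map g (sectionEquiv R j a)) :
    IsIntegral (pullback (I.subschemeι ≫ projectiveSpaceToSpec n R)
      (Spec.map (CommRingCat.ofHom g))) ↔ Irreducible P ∧ 1 ≤ n := by
  choose w hw hw' hr using fun j ↦ exists_subscheme_chart I (projectiveSpaceToSpec n R)
    (chart n R j) g (scalarToSection R j) (fromSpec_chart_comp R j) (sectionEquiv R j)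
    (sectionEquiv_scalarToSection R j) (dehom j L P) (h1 j) (h2 j)
  have hd0 (j) : dehom j L P ≠ 0 := fun h ↦ h0 (eq_zero_of_dehom_eq_zero j hP h)
  have hnt (j) : Nontrivial (MvPolynomial {i // i ≠ j} L ⧸ Ideal.span {dehom j L P}) ↔
      ¬ IsUnit (dehom j L P) := by
    rw [Ideal.Quotient.nontrivial_iff, Ne, Ideal.span_singleton_eq_top]
  have hdom (j) : IsDomain (MvPolynomial {i // i ≠ j} L ⧸ Ideal.span {dehom j L P}) ↔
      Prime (dehom j L P) := by
    rw [Ideal.Quotient.isDomain_iff_prime, Ideal.span_singleton_prime (hd0 j)]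
  have hX (j l) (hl : l ≠ j) : Ideal.Quotient.mk (Ideal.span {dehom j L P}) (X ⟨l, hl⟩) ≠ 0 ↔
      ¬ dehom j L P ∣ X ⟨l, hl⟩ := by
    rw [Ne, Ideal.Quotient.eq_zero_iff_mem, Ideal.mem_span_singleton]
  have hn : Nontrivial (Fin (n + 1)) ↔ 1 ≤ n := by
    rw [Fin.nontrivial_iff_two_le]
    omega
  have hcov (x) : ∃ j, x ∈ Set.range (w j) := by
    have hx : I.subschemeι (pullback.fst (I.subschemeι ≫ projectiveSpaceToSpec n R)
        (Spec.map (CommRingCat.ofHom g)) x) ∈ (⨆ j, (chart n R j).1) := by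
      rw [iSup_chart]
      trivial
    obtain ⟨j, hj⟩ := TopologicalSpace.Opens.mem_iSup.mp hx
    exact ⟨j, by rw [hr j]; exact hj⟩
  rw [isIntegral_iff_of_affine_charts (fun j ↦ .of (MvPolynomial {i // i ≠ j} L ⧸
    Ideal.span {dehom j L P})) w (fun j l ↦ if hl : l ≠ j then Ideal.Quotient.mk _ (X ⟨l, hl⟩)
      else 0) hcov ?_]
  · change (∃ j, Nontrivial (MvPolynomial {i // i ≠ j} L ⧸ Ideal.span {dehom j L P})) ∧
      (∀ j, Nontrivial (MvPolynomial {i // i ≠ j} L ⧸ Ideal.span {dehom j L P}) →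
        IsDomain (MvPolynomial {i // i ≠ j} L ⧸ Ideal.span {dehom j L P})) ∧
      (∀ j l, l ≠ j → Nontrivial (MvPolynomial {i // i ≠ j} L ⧸ Ideal.span {dehom j L P}) →
        Nontrivial (MvPolynomial {i // i ≠ l} L ⧸ Ideal.span {dehom l L P}) → _ ≠ _) ↔ _
    simp only [hnt, hdom, ← hn]
    constructor
    · rintro ⟨hex, hprime, hmeet⟩
      refine irreducible_of_dehom hP h0 hex hprime fun j l hl hj hl' ↦ ?_
      have := hmeet j l hl hj hl'
      rwa [dif_pos hl, hX] at this
    · rintro ⟨hirr, hnt'⟩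
      refine ⟨exists_not_isUnit_dehom hP hirr,
        fun j hj ↦ dehom_prime_of_not_isUnit j hP hirr hj, fun j l hl hj hl' ↦ ?_⟩
      rw [dif_pos hl, hX]
      exact not_dehom_dvd_X j hP hirr hl hj hl'
  · intro j l hl z
    rw [hr l, dif_pos hl]
    change (w j ≫ pullback.fst _ _ ≫ I.subschemeι) z ∈ (chart n R l).1 ↔ _
    rw [hw' j]
    change _ ∈ (chart n R j).2.fromSpec ⁻¹ᵁ (chart n R l).1 ↔ _
    rw [fromSpec_chart_preimage R j hl]
    change ¬ (((Ideal.Quotient.mk (Ideal.span {dehom j L P})).comp (map g)).comp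
      (sectionEquiv R j).toRingHom) _ ∈ z.asIdeal ↔ ¬ _ ∈ z.asIdeal
    simp

end ProjectiveHypersurface

section Kernel

open HypersurfaceReduction HomogeneousLocalization

attribute [local instance] MvPolynomial.gradedAlgebra

instance compactSpace_projectiveSpace (n : ℕ) (R : Type u) [CommRing R] :
    CompactSpace (projectiveSpace n R) := by
  refine ⟨?_⟩
  have h : (Set.univ : Set (projectiveSpace n R)) = ⋃ j, ((chart n R j).1 : Set _) := by
    rw [← TopologicalSpace.Opens.coe_iSup, iSup_chart]
    rfl
  rw [h]
  exact isCompact_iUnion fun j ↦ (chart n R j).2.isCompact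

lemma quasiCompact_to_projectiveSpace {n m : ℕ} {R S : Type u} [CommRing R] [CommRing S]
    {X : Scheme.{u}} (i : X ⟶ projectiveSpace n S) [QuasiCompact i]
    (f : X ⟶ projectiveSpace m R) : QuasiCompact f := by
  have := QuasiCompact.compactSpace_of_compactSpace i
  infer_instance

/-- A transport lemma: the image of T_j under scalar extension equals T_j only propositionally,
while the open set and the localization both depend on it. -/
lemma awayToSection_mk_eq_zero_iff {n : ℕ} {S : Type u} [CommRing S] {X : Scheme.{u}}
    (i : X ⟶ projectiveSpace n S) {x y : MvPolynomial (Fin (n + 1)) S} (hxy : x = y)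
    (hx : x ∈ grading n S 1) (hy : y ∈ grading n S 1) (d : ℕ) (p : MvPolynomial (Fin (n + 1)) S)
    (hp : p ∈ grading n S (d • 1)) :
    (i.app (Proj.basicOpen (grading n S) x)).hom ((Proj.awayToSection (grading n S) x).hom
      (Away.mk (grading n S) hx d p hp)) = 0 ↔
    (i.app (Proj.basicOpen (grading n S) y)).hom ((Proj.awayToSection (grading n S) y).hom
      (Away.mk (grading n S) hy d p hp)) = 0 := by
  subst hxy
  rfl

variable {n : ℕ} {R S : Type u} [CommRing R] [CommRing S] [Algebra R S] {X : Scheme.{u}}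
  (i : X ⟶ projectiveSpace n S) [QuasiCompact i]

/-- The ideal of the closure in `ℙⁿ_R` of a closed subscheme of `ℙⁿ_S`. -/
lemma awayToChart_mk_mem_ker_iff (j : Fin (n + 1)) (d : ℕ) (p : MvPolynomial (Fin (n + 1)) R)
    (hp : p ∈ grading n R (d • 1))
    (hp' : map (algebraMap R S) p ∈ grading n S (d • 1)) :
    awayToChart R j (Away.mk (grading n R) (X_mem_grading n R j) d p hp) ∈
        (i ≫ projectiveSpaceMap n R S).ker.ideal (chart n R j) ↔
      awayToChart S j (Away.mk (grading n S) (X_mem_grading n S j) d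
        (map (algebraMap R S) p) hp') ∈ i.ker.ideal (chart n S j) := by
  have := quasiCompact_to_projectiveSpace i (i ≫ projectiveSpaceMap n R S)
  rw [Scheme.Hom.ker_apply, Scheme.Hom.ker_apply, RingHom.mem_ker, RingHom.mem_ker]
  have h1 : ((projectiveSpaceMap n R S).app (Proj.basicOpen (grading n R) (MvPolynomial.X j))).hom
      ((Proj.awayToSection (grading n R) (MvPolynomial.X j)).hom
        (Away.mk (grading n R) (X_mem_grading n R j) d p hp)) =
      (Proj.awayToSection (grading n S) (scalarExtension n R S (MvPolynomial.X j))).hom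
        (Away.map (scalarExtension n R S) (MvPolynomial.X j)
          (Away.mk (grading n R) (X_mem_grading n R j) d p hp)) := by
    have := congr_arg (fun φ ↦ φ.hom (Away.mk (grading n R) (X_mem_grading n R j) d p hp))
      (Proj.awayToSection_comp_appLE (scalarExtension n R S)
        (irrelevant_le_map_scalarExtension n R S) (X_mem_grading n R j))
    rw [Scheme.Hom.app_eq_appLE]
    exact this
  rw [Away.map_mk] at h1
  rw [Scheme.Hom.comp_app]
  refine Iff.trans (Eq.congr_left ?_) (awayToSection_mk_eq_zero_iff i
    (map_X (algebraMap R S) j) ((scalarExtension n R S).2 (X_mem_grading n R j))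
      (X_mem_grading n S j) d _ hp')
  exact congr_arg (i.app (Proj.basicOpen (grading n S)
    (scalarExtension n R S (MvPolynomial.X j)))).hom h1

end Kernel

section Hypersurface

open HypersurfaceReduction HomogeneousLocalization

attribute [local instance] MvPolynomial.gradedAlgebra

variable {n δ : ℕ} {K : Type u} [Field K] {X : Scheme.{u}} {i : X ⟶ projectiveSpace n K}
  {f : MvPolynomial (Fin (n + 1)) K}

lemma sectionEquiv_dehomogenize {R : Type u} [CommRing R] {d : ℕ}
    {p : MvPolynomial (Fin (n + 1)) R} (hp : p.IsHomogeneous d) (j : Fin (n + 1)) :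
    sectionEquiv R j (dehomogenize p hp j) = dehom j R p :=
  (sectionEquiv_awayToChart R j _).trans (chartEquiv_mk j _ _ _)

lemma mem_ker_ideal_iff_dehom_dvd (hX : IsHypersurface i δ f) (j : Fin (n + 1))
    (s : Γ(projectiveSpace n K, (chart n K j).1)) :
    s ∈ i.ker.ideal (chart n K j) ↔ dehom j K f ∣ sectionEquiv K j s := by
  rw [hX.ideal_eq j, Ideal.mem_span_singleton, ← sectionEquiv_dehomogenize hX.isHomogeneous]
  exact (map_dvd_iff (sectionEquiv K j)).symm

/-- The defining form of a geometrically integral hypersurface is absolutely irreducible. -/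
theorem irreducible_of_geometricallyIntegral (hX : IsHypersurface i δ f)
    (hint : GeometricallyIntegral (i ≫ projectiveSpaceToSpec n K)) :
    Irreducible (map (algebraMap K (AlgebraicClosure K)) f) ∧ 1 ≤ n := by
  have := hX.isClosedImmersion
  have hinj := map_injective (σ := Fin (n + 1)) _ (algebraMap K (AlgebraicClosure K)).injective
  refine (isIntegral_pullback_iff_irreducible i.ker (algebraMap K (AlgebraicClosure K))
    (hX.isHomogeneous.map _) ((map_ne_zero_iff _ hinj).mpr hX.ne_zero)
    (fun j ↦ ⟨dehomogenize f hX.isHomogeneous j, ?_, ?_⟩) fun j a ha ↦ ?_).mp ?_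
  · rw [hX.ideal_eq j]
    exact Ideal.mem_span_singleton_self _
  · rw [sectionEquiv_dehomogenize, map_dehom]
  · rw [← map_dehom]
    exact _root_.map_dvd _ ((mem_ker_ideal_iff_dehom_dvd hX j a).mp ha)
  -- The hypothesis concerns X and the criterion the subscheme defined by the kernel; a closed
  -- immersion identifies X with its scheme-theoretic image.
  · refine hint.geometrically_isIntegral (Spec.map (CommRingCat.ofHom
      (algebraMap K (AlgebraicClosure K)))) (pullback.fst _ _ ≫ inv i.toImage) (pullback.snd _ _) ?_
    refine (IsPullback.of_hasPullback (i.imageι ≫ projectiveSpaceToSpec n K) (Spec.map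
      (CommRingCat.ofHom (algebraMap K (AlgebraicClosure K))))).of_iso (Iso.refl _)
      (asIso i.toImage).symm (Iso.refl _) (Iso.refl _) ?_ ?_ ?_ ?_
    · simp
    · simp
    · simp
    · simp

end Hypersurface

section Reduction

open HypersurfaceReduction HomogeneousLocalization NumberField

attribute [local instance] MvPolynomial.gradedAlgebra

variable {n δ : ℕ} {K : Type u} [Field K] [NumberField K] {X : Scheme.{u}}
  {i : X ⟶ projectiveSpace n K} {f : MvPolynomial (Fin (n + 1)) K}

/-- Base change of the closure of a hypersurface to a field over a residue field. -/
theorem isIntegral_pullback_zariskiClosure (hX : IsHypersurface i δ f) (hn : 1 ≤ n)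
    (𝔭 : MaximalSpectrum (𝓞 K)) {c : K} {φ : MvPolynomial (Fin (n + 1)) (𝓞 K)} (hc : c ≠ 0)
    (hφ : map (algebraMap (𝓞 K) K) φ = C c * f)
    {L : Type u} [Field L] (χ : 𝓞 K →+* L) (hχ : RingHom.ker χ = 𝔭.asIdeal)
    (hirr : Irreducible (map χ φ)) :
    IsIntegral (pullback (zariskiClosureToSpec i) (Spec.map (CommRingCat.ofHom χ))) := by
  have := hX.isClosedImmersion
  have hφh : φ.IsHomogeneous δ := by
    refine IsHomogeneous.of_map (FaithfulSMul.algebraMap_injective (𝓞 K) K) ?_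
    rw [hφ]
    exact hX.isHomogeneous.C_mul c
  have hφ0 : map χ φ ≠ 0 := hirr.ne_zero
  -- On a chart, the ideal of the closure consists of the integral polynomials divisible by φ over
  -- K. This is not yet divisibility over 𝓞 K, which is why Gauss's lemma is needed below.
  have hmem (j : Fin (n + 1)) {d : ℕ} (p : MvPolynomial (Fin (n + 1)) (𝓞 K))
      (hp : p ∈ grading n (𝓞 K) (d • 1)) :
      awayToChart (𝓞 K) j (Away.mk _ (X_mem_grading n (𝓞 K) j) d p hp) ∈
        (i ≫ projectiveSpaceMap n (𝓞 K) K).ker.ideal (chart n (𝓞 K) j) ↔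
      map (algebraMap (𝓞 K) K) (dehom j (𝓞 K) φ) ∣
        map (algebraMap (𝓞 K) K) (dehom j (𝓞 K) p) := by
    have hp' : map (algebraMap (𝓞 K) K) p ∈ grading n K (d • 1) := IsHomogeneous.map hp _
    rw [awayToChart_mk_mem_ker_iff i j d p hp hp',
      mem_ker_ideal_iff_dehom_dvd hX, sectionEquiv_awayToChart, chartEquiv_mk, map_dehom,
      map_dehom, hφ, map_mul, dehom_C]
    exact (((isUnit_iff_ne_zero.mpr hc).map C).mul_left_dvd).symm
  refine (isIntegral_pullback_iff_irreducible _ χ (hφh.map χ) hφ0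
    (fun j ↦ ⟨dehomogenize φ hφh j, (hmem j φ _).mpr dvd_rfl, ?_⟩) fun j a ha ↦ ?_).mpr ⟨hirr, hn⟩
  · rw [sectionEquiv_dehomogenize, map_dehom]
  · obtain ⟨a, rfl⟩ := awayToChart_surjective (𝓞 K) j a
    obtain ⟨d, p, hp, rfl⟩ := Away.mk_surjective (grading n (𝓞 K)) (X_mem_grading n (𝓞 K) j) a
    rw [hmem] at ha
    rw [sectionEquiv_awayToChart, chartEquiv_mk, ← map_dehom]
    refine map_dvd_map_of_primitive ((finitePlaceEquiv K).symm 𝔭) χ ?_ ?_ ha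
    · rw [hχ, ← finitePlaceEquiv_asIdeal, Equiv.apply_symm_apply]
    · rw [map_dehom]
      exact fun h ↦ hφ0 (eq_zero_of_dehom_eq_zero j (hφh.map χ) h)

/-- The reduction of the closure of a hypersurface at a prime is geometrically integral if the
reduction of a primitive form is absolutely irreducible. -/
theorem geometricallyIntegral_reductionToSpec (hX : IsHypersurface i δ f) (hn : 1 ≤ n)
    (𝔭 : MaximalSpectrum (𝓞 K)) {c : K} {φ : MvPolynomial (Fin (n + 1)) (𝓞 K)} (hc : c ≠ 0)
    (hφ : map (algebraMap (𝓞 K) K) φ = C c * f)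
    (hirr : ∀ (Ω : Type u) [Field Ω] [IsAlgClosed Ω] (χ : 𝓞 K →+* Ω),
      RingHom.ker χ = 𝔭.asIdeal → Irreducible (map χ φ)) :
    GeometricallyIntegral (reductionToSpec i 𝔭) := by
  have hiso : ObjectProperty.IsClosedUnderIsomorphisms (IsIntegral : ObjectProperty Scheme.{u}) :=
    ⟨fun e _ ↦ IsIntegral.of_isIso e.hom⟩
  rw [geometricallyIntegral_iff, geometrically_iff_of_commRing_of_isClosedUnderIsomorphisms]
  intro L _ _
  let χ : 𝓞 K →+* L := (algebraMap (𝓞 K ⧸ 𝔭.asIdeal) L).comp (Ideal.Quotient.mk 𝔭.asIdeal)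
  have := 𝔭.isMaximal
  let _ : Field (𝓞 K ⧸ 𝔭.asIdeal) := Ideal.Quotient.field _
  have hχ : RingHom.ker χ = 𝔭.asIdeal := by
    rw [RingHom.ker_comp_of_injective _ (algebraMap (𝓞 K ⧸ 𝔭.asIdeal) L).injective, Ideal.mk_ker]
  -- Irreducibility over L descends from its algebraic closure, so only algebraically closed fields
  -- need to be tested.
  have h := isIntegral_pullback_zariskiClosure hX hn 𝔭 hc hφ χ hχ <| by
    refine irreducible_of_irreducible_map (algebraMap L (AlgebraicClosure L)) ?_
    rw [MvPolynomial.map_map]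
    exact hirr _ _ (by rw [RingHom.ker_comp_of_injective _ (RingHom.injective _), hχ])
  have hχ' : Spec.map (CommRingCat.ofHom χ) =
      Spec.map (CommRingCat.ofHom (algebraMap (𝓞 K ⧸ 𝔭.asIdeal) L)) ≫
        Spec.map (CommRingCat.ofHom (Ideal.Quotient.mk 𝔭.asIdeal)) := by
    rw [← Spec.map_comp]
    rfl
  rw [hχ'] at h
  exact ObjectProperty.prop_of_iso IsIntegral (pullbackLeftPullbackSndIso _ _ _).symm h

end Reduction

end Ruppert

open Ruppert in
theorem proposition4p1 {K : Type u} [Field K] [NumberField K] (n δ : ℕ) (X : Scheme.{u})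
    (i : X ⟶ HypersurfaceReduction.projectiveSpace n K) (f : MvPolynomial (Fin (n + 1)) K)
    (hX : HypersurfaceReduction.IsHypersurface i δ f)
    (hint : GeometricallyIntegral (i ≫ HypersurfaceReduction.projectiveSpaceToSpec n K)) :
    (HypersurfaceReduction.badPrimes i).Finite ∧
      (1 / (Module.finrank ℚ K : ℝ)) *
          ∑ᶠ 𝔭 ∈ HypersurfaceReduction.badPrimes i,
            Real.log (Nat.card (NumberField.RingOfIntegers K ⧸ 𝔭.asIdeal)) ≤
        ((δ : ℝ) ^ 2 - 1) * HypersurfaceReduction.naiveHeight f +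
          ((δ : ℝ) ^ 2 - 1) *
            (3 * Real.log δ + δ * Real.log 3 + Real.log ((n + δ).choose δ)) := by
  -- Integrality of X excludes the degenerate cases: a hypersurface in ℙ⁰, and one of degree zero,
  -- are empty. Hence n ≥ 1 and δ ≥ 1 from here on.
  obtain ⟨hirr, hn⟩ := irreducible_of_geometricallyIntegral hX hint
  have hd := one_le_of_not_isUnit (hX.isHomogeneous.map _) hirr.ne_zero hirr.not_isUnit
  refine finite_and_sum_log_card_le hn hd hX.isHomogeneous hirr _
    fun 𝔭 h𝔭 c φ hc hφ _ ↦ ?_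
  by_contra! h
  exact h𝔭 (geometricallyIntegral_reductionToSpec hX hn 𝔭 hc hφ
    fun Ω _ _ χ hχ ↦ h Ω inferInstance inferInstance χ hχ)
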